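/- **Theorem 3.3 (induced subgraph counts).** Let $0<p<1$, let $F$ be a simple graph on $k=v(F)$ vertices, and let $e(F)$, $s(F)$, $t(F)$ be the numbers of edges, of 2-stars (a vertex together with two of its neighbours, not necessarily induced) and of triangles of $F$. For $n\ge k$ let $\xi_{i,j}$ be the edge indicators of the Erdős–Rényi random graph $G(n,p)$ on $\{1,\dots,n\}$, and let $$T_F^{\mathrm{ind}}=\sum_{1\le \alpha(1)<\dots<\alpha(k)\le n}\ \sum_{H\cong F}\ \prod_{ij\in E(H)}\xi_{\alpha(i),\alpha(j)}\prod_{ij\notin E(H)}\bigl(1-\xi_{\alpha(i),\alpha(j)}\bigr)$$ be the number of induced copies of $F$ in $G(n,p)$, where $H$ ranges over the graphs on $\{1,\dots,k\}$ isomorphic to $F$ and the products are over pairs $i<j$. Let $\Phi$ be the standard normal distribution function. Consider the conditions * (G1) $e(F)\ne p\binom{k}{2}$; * (G2) $e(F)=p\binom{k}{2}$ and $s(F)\ne 3p^2\binom{k}{3}$; * (G3) $e(F)=p\binom{k}{2}$, $s(F)=3p^2\binom{k}{3}$ and $t(F)\ne p^3\binom{k}{3}$. If (G1) or (G3) holds,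 then there is a constant $C>0$ depending only on $F$ and $p$ such that for all $n\ge k$ one has $\operatorname{Var}(T_F^{\mathrm{ind}})>0$ and $$\sup_{z\in\mathbb R}\left|\mathbb P\left[\frac{T_F^{\mathrm{ind}}-\mathbb E\,T_F^{\mathrm{ind}}}{(\operatorname{Var}T_F^{\mathrm{ind}})^{1/2}}\le z\right]-\Phi(z)\right|\le C n^{-1}.$$ If (G2) holds, the same is true with $C n^{-1}$ replaced by $C n^{-1/2}$. -/

import Mathlib

open MeasureTheory ProbabilityTheory
open scoped Classical

namespace InducedCount

/-- The kernel `φ_F^ind` of the induced subgraph count, for a graph `F` on `k` vertices: the sum,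
over all graphs `H` on the vertex set `{0, …, k - 1}` that are isomorphic to `F`, of
`∏_{ij ∈ E(H)} x i j * ∏_{ij ∉ E(H)} (1 - x i j)`, the products being over pairs `i < j`. -/
noncomputable def phiInd {k : ℕ} (F : SimpleGraph (Fin k)) (x : Fin k → Fin k → ℝ) : ℝ :=
  ∑ H : SimpleGraph (Fin k) with Nonempty (H ≃g F),
    (∏ e : Fin k × Fin k with e.1 < e.2 ∧ H.Adj e.1 e.2, x e.1 e.2) *
      ∏ e : Fin k × Fin k with e.1 < e.2 ∧ ¬ H.Adj e.1 e.2, (1 - x e.1 e.2)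

/-- The edge indicator `ξ_{i,j}` of a graph `G`. -/
noncomputable def edgeInd {n : ℕ} (G : SimpleGraph (Fin n)) (i j : Fin n) : ℝ :=
  if G.Adj i j then 1 else 0

/-- The induced subgraph count `T_F^ind(G)`: the sum of `φ_F^ind` over all increasing `k`-tuples
`α(1) < ⋯ < α(k)` of vertices of `G`. -/
noncomputable def indCount {k n : ℕ} (F : SimpleGraph (Fin k)) (G : SimpleGraph (Fin n)) : ℝ :=
  ∑ α : Fin k ↪o Fin n, phiInd F fun i j => edgeInd G (α i) (α j)

/-- The number `e(F)` of edges. -/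
noncomputable def numEdges {k : ℕ} (F : SimpleGraph (Fin k)) : ℕ :=
  F.edgeFinset.card

/-- The number `s(F)` of (not necessarily induced) 2-stars in `F`. A 2-star is given by its
center together with the set of its two leaves. -/
noncomputable def numTwoStars {k : ℕ} (F : SimpleGraph (Fin k)) : ℕ :=
  (Finset.univ.filter fun c : Fin k × Finset (Fin k) =>
    c.2.card = 2 ∧ ∀ v ∈ c.2, F.Adj c.1 v).card

/-- The number `t(F)` of triangles. -/
noncomputable def numTriangles {k : ℕ} (F : SimpleGraph (Fin k)) : ℕ :=
  (F.cliqueFinset 3).card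

/-- `e(F) ≠ p * binom(v(F), 2)`. -/
def CondG1 {k : ℕ} (F : SimpleGraph (Fin k)) (p : ℝ) : Prop :=
  (numEdges F : ℝ) ≠ p * (k.choose 2 : ℝ)

/-- `e(F) = p * binom(v(F), 2)` and `s(F) ≠ 3 * p ^ 2 * binom(v(F), 3)`. -/
def CondG2 {k : ℕ} (F : SimpleGraph (Fin k)) (p : ℝ) : Prop :=
  (numEdges F : ℝ) = p * (k.choose 2 : ℝ) ∧
    (numTwoStars F : ℝ) ≠ 3 * p ^ 2 * (k.choose 3 : ℝ)

/-- `e(F) = p * binom(v(F), 2)`, `s(F) = 3 * p ^ 2 * binom(v(F), 3)` and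
`t(F) ≠ p ^ 3 * binom(v(F), 3)`. -/
def CondG3 {k : ℕ} (F : SimpleGraph (Fin k)) (p : ℝ) : Prop :=
  (numEdges F : ℝ) = p * (k.choose 2 : ℝ) ∧
    (numTwoStars F : ℝ) = 3 * p ^ 2 * (k.choose 3 : ℝ) ∧
    (numTriangles F : ℝ) ≠ p ^ 3 * (k.choose 3 : ℝ)

/-- `sup_z |P[(T - E T) / √(Var T) ≤ z] - Φ(z)|`, where `Φ` is the distribution function of the
standard normal law. For a probability measure `P` the quantities are bounded by `1`, so the
supremum is a genuine one. -/
noncomputable def normalDist {Ω : Type*} [MeasurableSpace Ω] (P : Measure Ω) (T : Ω → ℝ) : ℝ :=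
  ⨆ z : ℝ, |P.real {ω | (T ω - ∫ ω', T ω' ∂P) / √(variance T P) ≤ z} - cdf (gaussianReal 0 1) z|

end InducedCount

/-! Expand the centred count in the orthogonal monomials `mono p γ`, where γ is a set of edges of
the complete graph and each factor is a centred edge indicator. If γ covers v vertices, its
coefficient is O(n^(k-v)), and for a given shape it is a multiple of `placementSum`. A single edge
has v = 2; the 2-star and the triangle have v = 3. Their placement sums vanish exactly when the
successive equalities separating (G1), (G2), (G3) hold. A shape on m vertices with nonzero placement
sum forces a variance of order at least n^(2k-m) (`exists_pow_le_countVar`), so the normalized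
coefficients are O(n^(m/2-v)).

The normal approximation is Stein's method on the biased cube. For W = Σ Y_e C_e, with C_e
independent of the coordinate e, `abs_Ex_centredInd_le` bounds the error at every z by E|1 - p(1-p)
Σ C_e D_e W| + 2 E|Σ Y_e |C_e| D_e W|. The Stein solution of a half-line has a kink, but its
increments are trapped between values of monotone functions (`steinSol_sub_bounds`). A second
integration by parts then turns the remainder into the divergence in the second term, so no
smoothing is needed and the rate 1/n can be reached.

Both terms are bounded in L²: the first by the Efron-Stein inequality, the second by a second moment
formula for divergences. The resulting moments expand over quadruples of edge sets, and a quadruple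
survives only if each edge lies in two of its members. If the four vertex counts add up to S and the
union has U vertices, such quadruples contribute n^(2m+U-S) to the square of the first term. Rate
1/n thus requires S ≥ U + 2m + 2. For m = 2 this always holds (`Linked.card_add_six_le`). For m = 3
without single edges only S ≥ U + 7 is available (`Linked.card_add_seven_le`), whence the rate
n^(-1/2) under (G2). If the 2-stars vanish too, every remaining set on three vertices is a triangle,
and S ≥ U + 8 is recovered (`Linked.card_add_eight_le`). -/

set_option linter.unusedSectionVars false

/-! ### Stein's equation for the normal law and half-lines. -/

namespace NormalStein

open Filter Topology

/-- The standard normal density. -/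
noncomputable def npdf (x : ℝ) : ℝ := gaussianPDFReal 0 1 x

/-- The standard normal distribution function. -/
noncomputable def ncdf (x : ℝ) : ℝ := cdf (gaussianReal 0 1) x

lemma npdf_pos (x : ℝ) : 0 < npdf x := gaussianPDFReal_pos 0 1 x one_ne_zero

lemma ncdf_nonneg (x : ℝ) : 0 ≤ ncdf x := cdf_nonneg _ x

lemma ncdf_le_one (x : ℝ) : ncdf x ≤ 1 := cdf_le_one _ x

lemma npdf_eq (x : ℝ) : npdf x = (√(2 * Real.pi))⁻¹ * Real.exp (-x ^ 2 / 2) := by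
  simp [npdf, gaussianPDFReal]

lemma hasDerivAt_npdf (x : ℝ) : HasDerivAt npdf (-x * npdf x) x := by
  have h : npdf = fun x => (√(2 * Real.pi))⁻¹ * Real.exp (-x ^ 2 / 2) := funext npdf_eq
  have h1 : HasDerivAt (fun x : ℝ => -x ^ 2 / 2) (-x) x := by
    have := ((hasDerivAt_pow 2 x).neg.div_const 2)
    refine HasDerivAt.congr_deriv this ?_
    push_cast
    ring
  rw [h]
  refine HasDerivAt.congr_deriv ((h1.exp.const_mul (√(2 * Real.pi))⁻¹)) ?_
  ring

lemma continuous_npdf : Continuous npdf :=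
  continuous_iff_continuousAt.2 fun x => (hasDerivAt_npdf x).continuousAt

lemma ncdf_eq_integral (x : ℝ) : ncdf x = ∫ t in Set.Iic x, npdf t := by
  rw [ncdf, cdf_eq_real, Measure.real, gaussianReal_apply_eq_integral 0 one_ne_zero,
    ENNReal.toReal_ofReal]
  · rfl
  · exact setIntegral_nonneg measurableSet_Iic fun t _ => gaussianPDFReal_nonneg 0 1 t

lemma hasDerivAt_ncdf (x : ℝ) : HasDerivAt ncdf (npdf x) x := by
  have hi : Integrable npdf := integrable_gaussianPDFReal 0 1
  have h : ncdf = fun x => (∫ t in (0 : ℝ)..x, npdf t) + ncdf 0 := by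
    funext y
    rw [ncdf_eq_integral, ncdf_eq_integral,
      ← intervalIntegral.integral_Iic_sub_Iic hi.integrableOn hi.integrableOn]
    ring
  rw [h]
  exact (intervalIntegral.integral_hasDerivAt_right (hi.intervalIntegrable)
    (continuous_npdf.stronglyMeasurableAtFilter _ _) continuous_npdf.continuousAt).add_const _

lemma npdf_le_one (x : ℝ) : npdf x ≤ 1 := by
  rw [npdf_eq]
  have h1 : (√(2 * Real.pi))⁻¹ ≤ 1 := by
    apply inv_le_one_of_one_le₀
    rw [Real.one_le_sqrt]
    nlinarith [Real.pi_gt_three]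
  have h2 : Real.exp (-x ^ 2 / 2) ≤ 1 := Real.exp_le_one_iff.2 (by nlinarith [sq_nonneg x])
  have h3 : 0 < Real.exp (-x ^ 2 / 2) := Real.exp_pos _
  have h4 : 0 ≤ (√(2 * Real.pi))⁻¹ := by positivity
  nlinarith

lemma tendsto_ncdf_atTop : Tendsto (fun x => 1 - ncdf x) atTop (𝓝 0) := by
  simpa [ncdf] using (tendsto_cdf_atTop (gaussianReal 0 1)).const_sub 1

lemma tendsto_ncdf_atBot : Tendsto ncdf atBot (𝓝 0) := tendsto_cdf_atBot _

lemma abs_ratio_mul_npdf_le (x : ℝ) : |x * npdf x / (1 + x ^ 2)| ≤ |x|⁻¹ := by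
  rcases eq_or_ne x 0 with rfl | hx
  · simp
  have h0 : 0 < |x| := abs_pos.2 hx
  rw [abs_div, abs_mul, abs_of_pos (npdf_pos x), abs_of_pos (by positivity : 0 < 1 + x ^ 2),
    div_le_iff₀ (by positivity), ← sq_abs]
  have : |x|⁻¹ * (1 + |x| ^ 2) = |x|⁻¹ + |x| := by field_simp
  rw [this]
  have := npdf_le_one x
  have h2 : 0 < |x|⁻¹ := inv_pos.2 h0
  nlinarith

lemma abs_npdf_div_le (x : ℝ) : |npdf x / x| ≤ |x|⁻¹ := by
  rw [abs_div, abs_of_pos (npdf_pos x), div_eq_mul_inv]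
  have : 0 ≤ |x|⁻¹ := by positivity
  nlinarith [npdf_le_one x]

lemma tendsto_abs_inv_atTop : Tendsto (fun x : ℝ => |x|⁻¹) atTop (𝓝 0) :=
  tendsto_inv_atTop_zero.comp tendsto_abs_atTop_atTop

lemma tendsto_abs_inv_atBot : Tendsto (fun x : ℝ => |x|⁻¹) atBot (𝓝 0) :=
  tendsto_inv_atTop_zero.comp tendsto_abs_atBot_atTop

lemma hasDerivAt_ratio (x : ℝ) : HasDerivAt (fun x => x * npdf x / (1 + x ^ 2))
    (npdf x * (1 - 2 * x ^ 2 - x ^ 4) / (1 + x ^ 2) ^ 2) x := by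
  have h0 : (1 + x ^ 2) ≠ 0 := by positivity
  have h := (((hasDerivAt_id x).mul (hasDerivAt_npdf x)).div
    ((hasDerivAt_pow 2 x).const_add 1) h0)
  refine HasDerivAt.congr_deriv (h) ?_
  simp only [id, Pi.mul_apply]
  field_simp
  push_cast
  ring

/-- The difference `(1 - ncdf x) - x * npdf x / (1 + x ^ 2)` has a negative derivative and tends to
`0` at infinity. This sharp form of Mills' inequality is what makes `x * millsR x` monotone. -/
lemma mills_lower_right (x : ℝ) : x * npdf x ≤ (1 + x ^ 2) * (1 - ncdf x) := by
  have hd : ∀ y, HasDerivAt (fun x => (1 - ncdf x) - x * npdf x / (1 + x ^ 2))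
      (-(2 * npdf y / (1 + y ^ 2) ^ 2)) y := by
    intro y
    refine HasDerivAt.congr_deriv (((hasDerivAt_ncdf y).const_sub 1).sub (hasDerivAt_ratio y)) ?_
    have : (1 + y ^ 2) ≠ 0 := by positivity
    field_simp
    ring
  have ha : Antitone (fun x => (1 - ncdf x) - x * npdf x / (1 + x ^ 2)) :=
    antitone_of_hasDerivAt_nonpos hd fun y => by
      have := npdf_pos y
      simp only [Left.neg_nonpos_iff, Pi.zero_apply]
      positivity
  have hl : Tendsto (fun x => (1 - ncdf x) - x * npdf x / (1 + x ^ 2)) atTop (𝓝 0) := by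
    simpa using tendsto_ncdf_atTop.sub
      (squeeze_zero_norm abs_ratio_mul_npdf_le tendsto_abs_inv_atTop)
  have := ha.le_of_tendsto hl x
  have h0 : 0 < (1 + x ^ 2) := by positivity
  simp only [sub_nonneg] at this
  rw [div_le_iff₀ h0] at this
  linarith

lemma mills_lower_left (x : ℝ) : -x * npdf x ≤ (1 + x ^ 2) * ncdf x := by
  have hd : ∀ y, HasDerivAt (fun x => ncdf x + x * npdf x / (1 + x ^ 2))
      (2 * npdf y / (1 + y ^ 2) ^ 2) y := by
    intro y
    refine HasDerivAt.congr_deriv ((hasDerivAt_ncdf y).add (hasDerivAt_ratio y)) ?_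
    have : (1 + y ^ 2) ≠ 0 := by positivity
    field_simp
    ring
  have ha : Monotone (fun x => ncdf x + x * npdf x / (1 + x ^ 2)) :=
    monotone_of_hasDerivAt_nonneg hd fun y => by
      have := npdf_pos y
      simp only [Pi.zero_apply]
      positivity
  have hl : Tendsto (fun x => ncdf x + x * npdf x / (1 + x ^ 2)) atBot (𝓝 0) := by
    simpa using tendsto_ncdf_atBot.add
      (squeeze_zero_norm abs_ratio_mul_npdf_le tendsto_abs_inv_atBot)
  have : 0 ≤ (fun x => ncdf x + x * npdf x / (1 + x ^ 2)) x :=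
    le_of_tendsto hl (eventually_atBot.2 ⟨x, fun _ hy => ha hy⟩)
  simp only at this
  have h0 : 0 < (1 + x ^ 2) := by positivity
  have h1 : -(x * npdf x / (1 + x ^ 2)) ≤ ncdf x := by linarith
  rw [← neg_div, div_le_iff₀ h0] at h1
  linarith

lemma hasDerivAt_npdf_div {x : ℝ} (hx : x ≠ 0) :
    HasDerivAt (fun x => npdf x / x) (-npdf x - npdf x / x ^ 2) x := by
  refine HasDerivAt.congr_deriv ((hasDerivAt_npdf x).div (hasDerivAt_id x) hx) ?_
  field_simp

/-- For positive `x` the difference `npdf x / x - (1 - ncdf x)` decreases to `0`; for the other `x`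
the signs suffice. -/
lemma mills_upper_right (x : ℝ) : x * (1 - ncdf x) ≤ npdf x := by
  rcases le_or_gt x 0 with hx | hx
  · nlinarith [ncdf_le_one x, npdf_pos x]
  have hd : ∀ y ∈ Set.Ici x, HasDerivAt (fun x => npdf x / x - (1 - ncdf x))
      (-(npdf y / y ^ 2)) y := by
    intro y hy
    have hy0 : y ≠ 0 := (hx.trans_le hy).ne'
    refine HasDerivAt.congr_deriv ((hasDerivAt_npdf_div hy0).sub ((hasDerivAt_ncdf y).const_sub 1)) ?_
    ring
  have ha : AntitoneOn (fun x => npdf x / x - (1 - ncdf x)) (Set.Ici x) := by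
    apply antitoneOn_of_deriv_nonpos (convex_Ici x)
    · exact fun y hy => (hd y hy).continuousAt.continuousWithinAt
    · exact fun y hy => (hd y (interior_subset hy)).differentiableAt.differentiableWithinAt
    · intro y hy
      rw [(hd y (interior_subset hy)).deriv]
      have := npdf_pos y
      simp only [Left.neg_nonpos_iff]
      positivity
  have hl : Tendsto (fun x => npdf x / x - (1 - ncdf x)) atTop (𝓝 0) := by
    simpa using (squeeze_zero_norm abs_npdf_div_le tendsto_abs_inv_atTop).sub tendsto_ncdf_atTop
  have := le_of_tendsto hl (eventually_atTop.2 ⟨x, fun y hy => ha Set.self_mem_Ici hy hy⟩)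
  have h1 : 1 - ncdf x ≤ npdf x / x := by linarith
  rw [le_div_iff₀ hx] at h1
  linarith

lemma mills_upper_left (x : ℝ) : -x * ncdf x ≤ npdf x := by
  rcases le_or_gt 0 x with hx | hx
  · nlinarith [ncdf_nonneg x, npdf_pos x]
  have hd : ∀ y ∈ Set.Iic x, HasDerivAt (fun x => npdf x / x + ncdf x)
      (-(npdf y / y ^ 2)) y := by
    intro y hy
    have hy0 : y ≠ 0 := (lt_of_le_of_lt hy hx).ne
    refine HasDerivAt.congr_deriv ((hasDerivAt_npdf_div hy0).add (hasDerivAt_ncdf y)) ?_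
    ring
  have ha : AntitoneOn (fun x => npdf x / x + ncdf x) (Set.Iic x) := by
    apply antitoneOn_of_deriv_nonpos (convex_Iic x)
    · exact fun y hy => (hd y hy).continuousAt.continuousWithinAt
    · exact fun y hy => (hd y (interior_subset hy)).differentiableAt.differentiableWithinAt
    · intro y hy
      rw [(hd y (interior_subset hy)).deriv]
      have := npdf_pos y
      simp only [Left.neg_nonpos_iff]
      positivity
  have hl : Tendsto (fun x => npdf x / x + ncdf x) atBot (𝓝 0) := by
    simpa using (squeeze_zero_norm abs_npdf_div_le tendsto_abs_inv_atBot).add tendsto_ncdf_atBot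
  have := ge_of_tendsto hl (eventually_atBot.2 ⟨x, fun y hy => ha hy Set.self_mem_Iic hy⟩)
  have h2 : (npdf x / x + ncdf x) * x ≥ 0 := mul_nonneg_of_nonpos_of_nonpos this hx.le
  have h3 : (npdf x / x + ncdf x) * x = npdf x + ncdf x * x := by field_simp [hx.ne]
  linarith

/-- `Φ / φ`. -/
noncomputable def millsL (x : ℝ) : ℝ := ncdf x / npdf x

/-- The Mills ratio `(1 - Φ) / φ`. -/
noncomputable def millsR (x : ℝ) : ℝ := (1 - ncdf x) / npdf x

lemma hasDerivAt_millsL (x : ℝ) : HasDerivAt millsL (x * millsL x + 1) x := by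
  refine HasDerivAt.congr_deriv ((hasDerivAt_ncdf x).div (hasDerivAt_npdf x) (npdf_pos x).ne') ?_
  have := (npdf_pos x).ne'
  simp only [millsL]
  field_simp
  ring

lemma hasDerivAt_millsR (x : ℝ) : HasDerivAt millsR (x * millsR x - 1) x := by
  refine HasDerivAt.congr_deriv
    (((hasDerivAt_ncdf x).const_sub 1).div (hasDerivAt_npdf x) (npdf_pos x).ne') ?_
  have := (npdf_pos x).ne'
  simp only [millsR]
  field_simp
  ring

/-- The derivative is `(1 + x ^ 2) * millsL x + x`, and its nonnegativity is `mills_lower_left`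
divided by the density. -/
lemma monotone_mul_millsL : Monotone fun x => x * millsL x := by
  refine monotone_of_hasDerivAt_nonneg
    (fun x => (hasDerivAt_id x).mul (hasDerivAt_millsL x)) fun x => ?_
  have h : -x ≤ (1 + x ^ 2) * millsL x := by
    rw [millsL, ← mul_div_assoc, le_div_iff₀ (npdf_pos x)]
    exact mills_lower_left x
  simp only [id, Pi.zero_apply]
  nlinarith

lemma monotone_mul_millsR : Monotone fun x => x * millsR x := by
  refine monotone_of_hasDerivAt_nonneg
    (fun x => (hasDerivAt_id x).mul (hasDerivAt_millsR x)) fun x => ?_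
  have h : x ≤ (1 + x ^ 2) * millsR x := by
    rw [millsR, ← mul_div_assoc, le_div_iff₀ (npdf_pos x)]
    exact mills_lower_right x
  simp only [id, Pi.zero_apply]
  nlinarith

lemma mul_millsR_le_one (x : ℝ) : x * millsR x ≤ 1 := by
  rw [millsR, ← mul_div_assoc, div_le_one (npdf_pos x)]
  exact mills_upper_right x

lemma neg_one_le_mul_millsL (x : ℝ) : -1 ≤ x * millsL x := by
  have : -x * millsL x ≤ 1 := by
    rw [millsL, ← mul_div_assoc, div_le_one (npdf_pos x)]
    exact mills_upper_left x
  linarith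

/-- The solution of the Stein equation for the half-line `(-∞, z]`. -/
noncomputable def steinSol (z w : ℝ) : ℝ :=
  if w ≤ z then (1 - ncdf z) * millsL w else ncdf z * millsR w

/-- The centred indicator of the half-line `(-∞, z]`. -/
noncomputable def centredInd (z w : ℝ) : ℝ := (if w ≤ z then 1 else 0) - ncdf z

lemma steinSol_of_le {z w : ℝ} (h : w ≤ z) : steinSol z w = (1 - ncdf z) * millsL w := if_pos h

lemma steinSol_of_ge {z w : ℝ} (h : z ≤ w) : steinSol z w = ncdf z * millsR w := by
  rcases h.eq_or_lt with rfl | h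
  · rw [steinSol_of_le le_rfl, millsL, millsR]
    ring
  · exact if_neg h.not_ge

/-- On each side of `z` this is a nonnegative multiple of a monotone function, and the two branches
agree at `z`. -/
lemma monotone_mul_steinSol (z : ℝ) : Monotone fun w => w * steinSol z w := by
  have h1 : MonotoneOn (fun w => w * steinSol z w) (Set.Iic z) := by
    intro u hu v hv huv
    simp only [Set.mem_Iic] at hu hv
    simp only [steinSol_of_le hu, steinSol_of_le hv]
    have := mul_le_mul_of_nonneg_left (monotone_mul_millsL huv) (sub_nonneg.2 (ncdf_le_one z))
    simp only at this
    linarith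
  have h2 : MonotoneOn (fun w => w * steinSol z w) (Set.Ici z) := by
    intro u hu v hv huv
    simp only [Set.mem_Ici] at hu hv
    simp only [steinSol_of_ge hu, steinSol_of_ge hv]
    have := mul_le_mul_of_nonneg_left (monotone_mul_millsR huv) (ncdf_nonneg z)
    simp only at this
    linarith
  exact h1.Iic_union_Ici h2

lemma mul_steinSol_le (z w : ℝ) : w * steinSol z w ≤ ncdf z := by
  have key : ∀ v, z ≤ v → v * steinSol z v ≤ ncdf z := by
    intro v hv
    rw [steinSol_of_ge hv]
    nlinarith [mul_le_mul_of_nonneg_left (mul_millsR_le_one v) (ncdf_nonneg z)]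
  rcases le_total z w with h | h
  · exact key w h
  · exact (monotone_mul_steinSol z h).trans (key z le_rfl)

lemma le_mul_steinSol (z w : ℝ) : ncdf z - 1 ≤ w * steinSol z w := by
  have key : ∀ v, v ≤ z → ncdf z - 1 ≤ v * steinSol z v := by
    intro v hv
    rw [steinSol_of_le hv]
    nlinarith [mul_le_mul_of_nonneg_left (neg_one_le_mul_millsL v)
      (sub_nonneg.2 (ncdf_le_one z))]
  rcases le_total w z with h | h
  · exact key w h
  · exact (key z le_rfl).trans (monotone_mul_steinSol z h)

lemma abs_mul_steinSol_le (z w : ℝ) : |w * steinSol z w| ≤ 1 :=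
  abs_le.2 ⟨by linarith [le_mul_steinSol z w, ncdf_nonneg z],
    by linarith [mul_steinSol_le z w, ncdf_le_one z]⟩

lemma abs_centredInd_le (z w : ℝ) : |centredInd z w| ≤ 1 := by
  rw [centredInd, abs_le]
  split_ifs <;> constructor <;> linarith [ncdf_nonneg z, ncdf_le_one z]

/-- By Stein's equation the quantity inside is the derivative of `steinSol z` away from `z`. -/
lemma abs_mul_steinSol_add_centredInd_le (z w : ℝ) :
    |w * steinSol z w + centredInd z w| ≤ 1 := by
  rw [centredInd, abs_le]
  have h1 := le_mul_steinSol z w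
  have h2 := mul_steinSol_le z w
  have h3 := ncdf_nonneg z
  have h4 := ncdf_le_one z
  split_ifs with h
  · constructor <;> linarith
  · constructor <;> linarith

lemma antitone_centredInd (z : ℝ) : Antitone (centredInd z) := by
  intro u v huv
  simp only [centredInd]
  split_ifs with h1 h2
  · rfl
  · exact absurd (huv.trans h1) h2
  · linarith
  · rfl

/-- Mean value theorem: left of `z` the derivative is `w * steinSol z w + (1 - ncdf z)`, which is
monotone and hence lies between its values at the ends. -/
lemma steinSol_sub_of_le {z u v : ℝ} (huv : u ≤ v) (hv : v ≤ z) :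
    (v - u) * (u * steinSol z u + (1 - ncdf z)) ≤ steinSol z v - steinSol z u ∧
    steinSol z v - steinSol z u ≤ (v - u) * (v * steinSol z v + (1 - ncdf z)) := by
  rcases huv.eq_or_lt with rfl | hlt
  · simp
  obtain ⟨c, hc, he⟩ := exists_hasDerivAt_eq_slope (fun w => (1 - ncdf z) * millsL w)
    (fun w => (1 - ncdf z) * (w * millsL w + 1)) hlt
    (fun w _ => ((hasDerivAt_millsL w).const_mul _).continuousAt.continuousWithinAt)
    (fun w _ => (hasDerivAt_millsL w).const_mul _)
  rw [eq_div_iff (sub_pos.2 hlt).ne'] at he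
  rw [← steinSol_of_le hv, ← steinSol_of_le (hlt.le.trans hv)] at he
  have h0 := sub_pos.2 hlt
  have h1 := monotone_mul_steinSol z hc.1.le
  have h2 := monotone_mul_steinSol z hc.2.le
  simp only [steinSol_of_le (hc.2.le.trans hv)] at h1 h2
  rw [← he]
  constructor <;> nlinarith

lemma steinSol_sub_of_ge {z u v : ℝ} (huv : u ≤ v) (hu : z ≤ u) :
    (v - u) * (u * steinSol z u - ncdf z) ≤ steinSol z v - steinSol z u ∧
    steinSol z v - steinSol z u ≤ (v - u) * (v * steinSol z v - ncdf z) := by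
  rcases huv.eq_or_lt with rfl | hlt
  · simp
  obtain ⟨c, hc, he⟩ := exists_hasDerivAt_eq_slope (fun w => ncdf z * millsR w)
    (fun w => ncdf z * (w * millsR w - 1)) hlt
    (fun w _ => ((hasDerivAt_millsR w).const_mul _).continuousAt.continuousWithinAt)
    (fun w _ => (hasDerivAt_millsR w).const_mul _)
  rw [eq_div_iff (sub_pos.2 hlt).ne'] at he
  rw [← steinSol_of_ge hu, ← steinSol_of_ge (hu.trans hlt.le)] at he
  have h0 := sub_pos.2 hlt
  have h1 := monotone_mul_steinSol z hc.1.le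
  have h2 := monotone_mul_steinSol z hc.2.le
  simp only [steinSol_of_ge (hu.trans hc.1.le)] at h1 h2
  rw [← he]
  constructor <;> nlinarith

/-- A form of Stein's equation that survives the kink at `z`: the increasing part and the decreasing
indicator are evaluated at opposite ends. If `z` separates `u` and `v`, the bounds on the two sides
of `z` are added. -/
lemma steinSol_sub_bounds (z : ℝ) {u v : ℝ} (huv : u ≤ v) :
    (v - u) * (u * steinSol z u + centredInd z v) ≤ steinSol z v - steinSol z u ∧
    steinSol z v - steinSol z u ≤ (v - u) * (v * steinSol z v + centredInd z u) := by
  simp only [centredInd]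
  rcases le_or_gt v z with hv | hv
  · simpa [hv, huv.trans hv] using steinSol_sub_of_le huv hv
  rcases le_or_gt u z with hu | hu
  · obtain ⟨a1, a2⟩ := steinSol_sub_of_le hu le_rfl
    obtain ⟨b1, b2⟩ := steinSol_sub_of_ge hv.le le_rfl
    have h1 := monotone_mul_steinSol z hu
    have h2 := monotone_mul_steinSol z hv.le
    simp only at h1 h2
    simp only [hu, hv.not_ge, if_true, if_false]
    constructor <;> nlinarith
  · simpa [hv.not_ge, hu.not_ge, sub_eq_add_neg] using steinSol_sub_of_ge huv hu.le

end NormalStein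

/-! ### Calculus on the biased cube and the abstract normal approximation bound. -/

namespace BiasedCube

variable {E : Type*} [Fintype E] (p : ℝ)

/-- The weight of a point of the `p`-biased cube. -/
noncomputable def wt (x : E → Bool) : ℝ := ∏ e, (if x e then p else 1 - p)

/-- The expectation on the `p`-biased cube. -/
noncomputable def Ex (G : (E → Bool) → ℝ) : ℝ := ∑ x, wt p x * G x

/-- The centred coordinate. -/
noncomputable def Y (e : E) (x : E → Bool) : ℝ := (if x e then 1 else 0) - p

/-- The discrete derivative in direction `e`. -/
noncomputable def D (e : E) (G : (E → Bool) → ℝ) (x : E → Bool) : ℝ :=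
  G (Function.update x e true) - G (Function.update x e false)

/-- The average over the coordinate `e`. -/
noncomputable def avg (e : E) (G : (E → Bool) → ℝ) (x : E → Bool) : ℝ :=
  p * G (Function.update x e true) + (1 - p) * G (Function.update x e false)

/-- The function `G` does not depend on the coordinate `e`. -/
def Indep (e : E) (G : (E → Bool) → ℝ) : Prop := ∀ x b, G (Function.update x e b) = G x

lemma Ex_add (G H : (E → Bool) → ℝ) : Ex p (fun x => G x + H x) = Ex p G + Ex p H := by
  simp only [Ex, mul_add, Finset.sum_add_distrib]

lemma Ex_sub (G H : (E → Bool) → ℝ) : Ex p (fun x => G x - H x) = Ex p G - Ex p H := by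
  simp only [Ex, mul_sub, Finset.sum_sub_distrib]

lemma Ex_const_mul (c : ℝ) (G : (E → Bool) → ℝ) : Ex p (fun x => c * G x) = c * Ex p G := by
  simp only [Ex, Finset.mul_sum]
  exact Finset.sum_congr rfl fun x _ => by ring

lemma Ex_sum {ι : Type*} (s : Finset ι) (G : ι → (E → Bool) → ℝ) :
    Ex p (fun x => ∑ i ∈ s, G i x) = ∑ i ∈ s, Ex p (G i) := by
  simp only [Ex, Finset.mul_sum]
  exact Finset.sum_comm

lemma Ex_prod (h : E → Bool → ℝ) :
    Ex p (fun x => ∏ e, h e (x e)) = ∏ e, (p * h e true + (1 - p) * h e false) := by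
  have : ∀ e, p * h e true + (1 - p) * h e false
      = ∑ b : Bool, (if b then p else 1 - p) * h e b := fun e => by simp
  simp only [this, Finset.prod_univ_sum, Fintype.piFinset_univ, Ex, wt, Finset.prod_mul_distrib]

lemma Ex_const (c : ℝ) : Ex p (fun _ : E → Bool => c) = c := by
  have h := Ex_prod (E := E) p (fun _ _ => 1)
  have h2 := Ex_const_mul (E := E) p c (fun _ => 1)
  simp at h h2
  rw [h2, h, mul_one]

variable {p}

lemma wt_nonneg (h0 : 0 ≤ p) (h1 : p ≤ 1) (x : E → Bool) : 0 ≤ wt p x :=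
  Finset.prod_nonneg fun e _ => by split_ifs <;> linarith

lemma Ex_mono (h0 : 0 ≤ p) (h1 : p ≤ 1) {G H : (E → Bool) → ℝ} (h : ∀ x, G x ≤ H x) :
    Ex p G ≤ Ex p H :=
  Finset.sum_le_sum fun x _ => mul_le_mul_of_nonneg_left (h x) (wt_nonneg h0 h1 x)

lemma Ex_nonneg (h0 : 0 ≤ p) (h1 : p ≤ 1) {G : (E → Bool) → ℝ} (h : ∀ x, 0 ≤ G x) :
    0 ≤ Ex p G :=
  Finset.sum_nonneg fun x _ => mul_nonneg (wt_nonneg h0 h1 x) (h x)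

lemma abs_Ex_le (h0 : 0 ≤ p) (h1 : p ≤ 1) (G : (E → Bool) → ℝ) :
    |Ex p G| ≤ Ex p (fun x => |G x|) := by
  refine (Finset.abs_sum_le_sum_abs _ _).trans (Finset.sum_le_sum fun x _ => ?_)
  rw [abs_mul, abs_of_nonneg (wt_nonneg h0 h1 x)]

lemma sq_Ex_abs_le (h0 : 0 ≤ p) (h1 : p ≤ 1) (G : (E → Bool) → ℝ) :
    Ex p (fun x => |G x|) ^ 2 ≤ Ex p (fun x => G x ^ 2) := by
  set c := Ex p (fun x => |G x|) with hc
  have h := Ex_nonneg (p := p) h0 h1 (G := fun x => (|G x| - c) ^ 2) fun x => sq_nonneg _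
  have h2 : Ex p (fun x => (|G x| - c) ^ 2) = Ex p (fun x => G x ^ 2) - 2 * c * c + c ^ 2 := by
    have : (fun x => (|G x| - c) ^ 2) = fun x => (G x ^ 2 - (2 * c) * |G x|) + c ^ 2 := by
      funext x
      rw [sub_sq, sq_abs]
      ring
    rw [this, Ex_add, Ex_sub, Ex_const_mul, Ex_const, ← hc]
  rw [h2] at h
  nlinarith

lemma Ex_abs_le_sqrt (h0 : 0 ≤ p) (h1 : p ≤ 1) {G : (E → Bool) → ℝ} {c : ℝ}
    (h : Ex p (fun x => G x ^ 2) ≤ c ^ 2) (hc : 0 ≤ c) : Ex p (fun x => |G x|) ≤ c :=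
  (abs_le.1 (abs_le_of_sq_le_sq ((sq_Ex_abs_le h0 h1 G).trans h) hc)).2

variable (p)

lemma wt_update (x : E → Bool) (e : E) (b : Bool) :
    wt p (Function.update x e b) = (if b then p else 1 - p) *
      ∏ f ∈ Finset.univ.erase e, (if x f then p else 1 - p) := by
  rw [wt, ← Finset.mul_prod_erase _ _ (Finset.mem_univ e)]
  congr 1
  · simp
  · refine Finset.prod_congr rfl fun f hf => ?_
    rw [Function.update_of_ne (Finset.ne_of_mem_erase hf)]

/-- Pair each point with the one obtained by flipping the coordinate `e`. Within a pair the weighted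
sums of `G` and of its average agree, and summing over the involution counts every point twice. -/
lemma Ex_avg (e : E) (G : (E → Bool) → ℝ) : Ex p (avg p e G) = Ex p G := by
  let flip : (E → Bool) → (E → Bool) := fun x => Function.update x e (!x e)
  have hinv : Function.Involutive flip := by
    intro x
    simp [flip]
  have hsum : ∀ F : (E → Bool) → ℝ, ∑ x, F (flip x) = ∑ x, F x := fun F =>
    Equiv.sum_comp hinv.toPerm F
  have key : ∀ x, wt p x * avg p e G x + wt p (flip x) * avg p e G (flip x)
      = wt p x * G x + wt p (flip x) * G (flip x) := by
    intro x
    have h1 : wt p x = wt p (Function.update x e (x e)) := by simp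
    have h2 : G x = G (Function.update x e (x e)) := by simp
    rw [h2, h1]
    simp only [flip, avg, wt_update, Function.update_idem]
    cases x e <;> simp <;> ring
  have : 2 * Ex p (avg p e G) = 2 * Ex p G := by
    rw [two_mul, two_mul]
    nth_rewrite 2 [Ex]
    nth_rewrite 3 [Ex]
    rw [← hsum, ← hsum (fun x => wt p x * G x), Ex, Ex, ← Finset.sum_add_distrib,
      ← Finset.sum_add_distrib]
    exact Finset.sum_congr rfl fun x _ => key x
  linarith

lemma Y_update_true (e : E) (x : E → Bool) : Y p e (Function.update x e true) = 1 - p := by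
  simp [Y]

lemma Y_update_false (e : E) (x : E → Bool) : Y p e (Function.update x e false) = -p := by
  simp [Y]

lemma Y_update_of_ne {e f : E} (h : f ≠ e) (x : E → Bool) (b : Bool) :
    Y p f (Function.update x e b) = Y p f x := by
  simp [Y, Function.update_of_ne h]

/-- Integration by parts: averaging over the coordinate `e` leaves `p * (1 - p)` times the
difference of the two values of `G`. -/
lemma Ex_Y_mul (e : E) (G : (E → Bool) → ℝ) :
    Ex p (fun x => Y p e x * G x) = p * (1 - p) * Ex p (D e G) := by
  rw [← Ex_avg p e, ← Ex_const_mul]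
  congr 1
  funext x
  simp only [avg, D, Y_update_true, Y_update_false]
  ring

lemma Indep.avg {e f : E} {G : (E → Bool) → ℝ} (h : Indep f G) : Indep f (avg p e G) := by
  intro x b
  simp only [BiasedCube.avg]
  by_cases hef : e = f
  · subst hef
    simp
  · rw [Function.update_comm (Ne.symm hef), Function.update_comm (Ne.symm hef), h, h]

lemma indep_avg (e : E) (G : (E → Bool) → ℝ) : Indep e (avg p e G) := by
  intro x b
  simp [avg]

lemma indep_D (e : E) (G : (E → Bool) → ℝ) : Indep e (D e G) := by
  intro x b
  simp [D]

lemma Indep.mul {e : E} {G H : (E → Bool) → ℝ} (hG : Indep e G) (hH : Indep e H) :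
    Indep e (fun x => G x * H x) := fun x b => by simp only [hG x b, hH x b]

lemma Indep.D_eq_zero {e : E} {G : (E → Bool) → ℝ} (h : Indep e G) (x : E → Bool) :
    D e G x = 0 := by
  rw [D, h, h, sub_self]

lemma D_mul_of_indep {e : E} {G : (E → Bool) → ℝ} (h : Indep e G) (H : (E → Bool) → ℝ)
    (x : E → Bool) : D e (fun x => G x * H x) x = G x * D e H x := by
  simp only [D, h x]
  ring

lemma D_sum {ι : Type*} (e : E) (s : Finset ι) (G : ι → (E → Bool) → ℝ) (x : E → Bool) :
    D e (fun x => ∑ i ∈ s, G i x) x = ∑ i ∈ s, D e (G i) x := by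
  simp only [D, Finset.sum_sub_distrib]

lemma D_const_mul (e : E) (c : ℝ) (G : (E → Bool) → ℝ) (x : E → Bool) :
    D e (fun x => c * G x) x = c * D e G x := by
  simp only [D, mul_sub]

variable {p}

/-- The Efron-Stein inequality, for the coordinates in a given set. -/
lemma exists_partial_avg (h0 : 0 ≤ p) (h1 : p ≤ 1) (V : (E → Bool) → ℝ) (S : Finset E) :
    ∃ U : (E → Bool) → ℝ, Ex p U = Ex p V ∧ (∀ e ∈ S, Indep e U) ∧
      Ex p (fun x => (V x - U x) ^ 2) ≤ p * (1 - p) * ∑ f ∈ S, Ex p (fun x => D f V x ^ 2) := by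
  induction S using Finset.induction_on with
  | empty => exact ⟨V, rfl, by simp, by simp [Ex]⟩
  | insert e S he ih =>
    obtain ⟨U, hU1, hU2, hU3⟩ := ih
    refine ⟨avg p e U, by rw [Ex_avg, hU1], ?_, ?_⟩
    · intro f hf
      rcases Finset.mem_insert.1 hf with rfl | hf
      · exact indep_avg p _ U
      · exact (hU2 f hf).avg p
    -- The new error is `V - avg V`, of mean zero in the coordinate `e`, plus `H`, which does not
    -- depend on `e`. The squares therefore add, and averaging does not increase the old error.
    · set H : (E → Bool) → ℝ := avg p e (fun x => V x - U x) with hH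
      have hHi : Indep e H := indep_avg p e _
      have hVi : Indep e (avg p e V) := indep_avg p e _
      have e1 : Ex p (fun x => (V x - avg p e V x) ^ 2)
          = p * (1 - p) * Ex p (fun x => D e V x ^ 2) := by
        rw [← Ex_avg p e, ← Ex_const_mul]
        congr 1
        funext x
        rw [avg, hVi, hVi, D, avg]
        ring
      have e2 : Ex p (fun x => (V x - avg p e V x) * H x) = 0 := by
        rw [← Ex_avg p e, ← Ex_const p (E := E) 0]
        congr 1
        funext x
        rw [avg, hVi, hVi, hHi, hHi, avg]
        ring
      have e3 : Ex p (fun x => H x ^ 2) ≤ Ex p (fun x => (V x - U x) ^ 2) := by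
        rw [← Ex_avg p e (fun x => (V x - U x) ^ 2)]
        refine Ex_mono h0 h1 fun x => ?_
        simp only [hH, avg]
        set a := V (Function.update x e true) - U (Function.update x e true)
        set b := V (Function.update x e false) - U (Function.update x e false)
        nlinarith [mul_nonneg (mul_nonneg h0 (sub_nonneg.2 h1)) (sq_nonneg (a - b))]
      have e4 : (fun x => (V x - avg p e U x) ^ 2) = fun x => ((V x - avg p e V x) ^ 2
          + 2 * ((V x - avg p e V x) * H x)) + H x ^ 2 := by
        funext x
        have : V x - avg p e U x = (V x - avg p e V x) + H x := by
          simp only [hH, avg]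
          ring
        rw [this]
        ring
      rw [e4, Ex_add, Ex_add, Ex_const_mul, e2, e1, Finset.sum_insert he]
      linarith

/-- The Efron-Stein inequality on the `p`-biased cube. -/
lemma efron_stein (h0 : 0 ≤ p) (h1 : p ≤ 1) (V : (E → Bool) → ℝ) :
    Ex p (fun x => (V x - Ex p V) ^ 2) ≤ p * (1 - p) * ∑ f, Ex p (fun x => D f V x ^ 2) := by
  obtain ⟨U, hU1, hU2, hU3⟩ := exists_partial_avg h0 h1 V Finset.univ
  have hc : ∀ x y : E → Bool, U x = U y := by
    -- Constancy follows by changing the coordinates in `S` one at a time.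
    have : ∀ (S : Finset E) (x y : E → Bool), (∀ e ∉ S, x e = y e) → U x = U y := by
      intro S
      induction S using Finset.induction_on with
      | empty =>
        intro x y h
        rw [show x = y from funext fun e => h e (by simp)]
      | insert e S he ih =>
        intro x y h
        rw [← hU2 e (Finset.mem_univ e) x (y e)]
        refine ih _ _ fun f hf => ?_
        by_cases hfe : f = e
        · subst hfe
          simp
        · rw [Function.update_of_ne hfe]
          exact h f (by simp [hfe, hf])
    exact fun x y => this Finset.univ x y (by simp)
  have hU : ∀ x, U x = Ex p V := by
    intro x
    rw [← hU1, ← Ex_const p (E := E) (U x)]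
    congr 1
    funext y
    exact hc x y
  simpa only [hU] using hU3

variable (p)

/-- The monomial `∏_{e ∈ γ} Y_e`. -/
noncomputable def mono (γ : Finset E) (x : E → Bool) : ℝ := ∏ e ∈ γ, Y p e x

lemma indep_mono {e : E} {γ : Finset E} (h : e ∉ γ) : Indep e (mono p γ) := by
  intro x b
  exact Finset.prod_congr rfl fun f hf => Y_update_of_ne p (by rintro rfl; exact h hf) x b

lemma mono_eq_mul_erase {e : E} {γ : Finset E} (h : e ∈ γ) (x : E → Bool) :
    mono p γ x = Y p e x * mono p (γ.erase e) x :=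
  (Finset.mul_prod_erase γ (fun e => Y p e x) h).symm

lemma D_mono {e : E} {γ : Finset E} (h : e ∈ γ) (x : E → Bool) :
    D e (mono p γ) x = mono p (γ.erase e) x := by
  have hi : Indep e (mono p (γ.erase e)) := indep_mono p (Finset.notMem_erase e γ)
  simp only [D, mono_eq_mul_erase p h, hi x, Y_update_true, Y_update_false]
  ring

variable {p}

lemma abs_Y_le (h0 : 0 ≤ p) (h1 : p ≤ 1) (e : E) (x : E → Bool) : |Y p e x| ≤ 1 := by
  rw [Y, abs_le]
  split_ifs <;> constructor <;> linarith

lemma abs_mono_le (h0 : 0 ≤ p) (h1 : p ≤ 1) (γ : Finset E) (x : E → Bool) :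
    |mono p γ x| ≤ 1 := by
  rw [mono, Finset.abs_prod]
  exact Finset.prod_le_one (fun _ _ => abs_nonneg _) fun e _ => abs_Y_le h0 h1 e x

variable (p)

/-- Once the factor `Y_g` is pulled out, the rest does not depend on `g`, so integration by parts
produces a zero derivative. -/
lemma Ex_mono_mul_eq_zero {g : E} {γ : Finset E} (h : g ∈ γ) {G : (E → Bool) → ℝ}
    (hG : Indep g G) : Ex p (fun x => mono p γ x * G x) = 0 := by
  have : (fun x => mono p γ x * G x) = fun x => Y p g x * (mono p (γ.erase g) x * G x) := by
    funext x
    rw [mono_eq_mul_erase p h, mul_assoc]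
  have hz : D g (fun x => mono p (γ.erase g) x * G x) = fun _ => 0 :=
    funext ((indep_mono p (Finset.notMem_erase g γ)).mul hG).D_eq_zero
  rw [this, Ex_Y_mul, hz, Ex_const, mul_zero]

lemma Ex_mono_sq (γ : Finset E) : Ex p (fun x => mono p γ x * mono p γ x) = (p * (1 - p)) ^ γ.card := by
  have h : ∀ x : E → Bool, mono p γ x * mono p γ x
      = ∏ e, (fun (e : E) (b : Bool) => if e ∈ γ then ((if b then 1 else 0) - p) ^ 2 else 1)
        e (x e) := by
    intro x
    rw [mono, ← Finset.prod_mul_distrib, Finset.prod_ite_mem, Finset.univ_inter]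
    exact Finset.prod_congr rfl fun e _ => by rw [Y, sq]
  rw [show (fun x => mono p γ x * mono p γ x) = _ from funext h,
    Ex_prod p (fun (e : E) (b : Bool) => if e ∈ γ then ((if b then 1 else 0) - p) ^ 2 else 1)]
  simp only [Bool.false_eq_true, if_true, if_false]
  have : ∀ e : E, (p * (if e ∈ γ then ((1 : ℝ) - p) ^ 2 else 1) + (1 - p) *
      if e ∈ γ then ((0 : ℝ) - p) ^ 2 else 1) = if e ∈ γ then p * (1 - p) else 1 := by
    intro e
    split_ifs <;> ring
  simp only [this]
  rw [Finset.prod_ite_mem, Finset.univ_inter, Finset.prod_const]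

lemma Ex_mono_mul_mono (γ δ : Finset E) :
    Ex p (fun x => mono p γ x * mono p δ x) = if γ = δ then (p * (1 - p)) ^ γ.card else 0 := by
  split_ifs with h
  · rw [h, Ex_mono_sq]
  · have : ∃ g, (g ∈ γ ∧ g ∉ δ) ∨ (g ∈ δ ∧ g ∉ γ) := by
      by_contra hc
      push Not at hc
      exact h (Finset.ext fun g => ⟨(hc g).1, (hc g).2⟩)
    obtain ⟨g, hg | hg⟩ := this
    · exact Ex_mono_mul_eq_zero p hg.1 (indep_mono p hg.2)
    · simp only [mul_comm (mono p γ _)]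
      exact Ex_mono_mul_eq_zero p hg.1 (indep_mono p hg.2)

/-- An edge in only one of the four sets leaves an unmatched centred factor. This is the source of
`DoublyCovered`. -/
lemma Ex_four_eq_zero {γ : Fin 4 → Finset E} {g : E} {i : Fin 4} (hi : g ∈ γ i)
    (hj : ∀ j ≠ i, g ∉ γ j) : Ex p (fun x => ∏ j, mono p (γ j) x) = 0 := by
  have h : ∀ x, ∏ j, mono p (γ j) x = mono p (γ i) x * ∏ j ∈ Finset.univ.erase i, mono p (γ j) x :=
    fun x => (Finset.mul_prod_erase _ _ (Finset.mem_univ i)).symm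
  simp only [h]
  refine Ex_mono_mul_eq_zero p hi fun x b => Finset.prod_congr rfl fun j hj' => ?_
  exact indep_mono p (hj j (Finset.ne_of_mem_erase hj')) x b

variable {p}

lemma abs_Ex_four_le (h0 : 0 ≤ p) (h1 : p ≤ 1) (γ : Fin 4 → Finset E) :
    |Ex p (fun x => ∏ j, mono p (γ j) x)| ≤ 1 := by
  refine (abs_Ex_le h0 h1 _).trans ?_
  rw [← Ex_const p (E := E) 1]
  refine Ex_mono h0 h1 fun x => ?_
  rw [Finset.abs_prod]
  exact Finset.prod_le_one (fun _ _ => abs_nonneg _) fun j _ => abs_mono_le h0 h1 _ x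

/-- A normal approximation bound on the cube for `W = ∑ Y_e C_e` with `C_e` not depending on the
coordinate `e`. -/
theorem abs_Ex_centredInd_le (h0 : 0 ≤ p) (h1 : p ≤ 1) {W : (E → Bool) → ℝ}
    {C : E → (E → Bool) → ℝ} (hC : ∀ e, Indep e (C e)) (hW : ∀ x, W x = ∑ e, Y p e x * C e x)
    (z : ℝ) :
    |Ex p (fun x => NormalStein.centredInd z (W x))| ≤
      Ex p (fun x => |1 - p * (1 - p) * ∑ e, C e x * D e W x|) +
        2 * Ex p (fun x => |∑ e, Y p e x * (|C e x| * D e W x)|) := by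
  set f := NormalStein.steinSol z
  set h := NormalStein.centredInd z
  set g : ℝ → ℝ := fun w => w * f w with hg
  set σ := p * (1 - p) with hσ
  have hσ0 : 0 ≤ σ := mul_nonneg h0 (sub_nonneg.2 h1)
  -- First integration by parts, with `C e` passing through `D e` by independence.
  have hWf : Ex p (fun x => g (W x)) = σ * ∑ e, Ex p (fun x => C e x * D e (fun x => f (W x)) x) := by
    have : (fun x => g (W x)) = fun x => ∑ e, Y p e x * (C e x * f (W x)) := by
      funext x
      simp only [hg]
      nth_rewrite 1 [hW x]
      rw [Finset.sum_mul]
      exact Finset.sum_congr rfl fun e _ => by ring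
    rw [this, Ex_sum, Finset.mul_sum]
    refine Finset.sum_congr rfl fun e _ => ?_
    rw [Ex_Y_mul]
    congr 2
    funext x
    exact D_mul_of_indep (hC e) _ x
  -- `K` is increasing and bounded by 2. The increments of `W` and of `K (W)` have the same sign, so
  -- their product can bound the linearization error of `f`, whichever end of the increment `x` sits
  -- at.
  set K : ℝ → ℝ := fun w => g w - h w with hK
  have pt : ∀ e x, |D e W x * (g (W x) + h (W x)) - D e (fun x => f (W x)) x| ≤
      D e W x * D e (fun x => K (W x)) x := by
    intro e x
    simp only [D, hK]
    set v := W (Function.update x e true) with hv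
    set u := W (Function.update x e false) with hu
    have hx : W x = v ∨ W x = u := by
      rcases hxe : x e with _ | _
      · right
        rw [hu, ← hxe, Function.update_eq_self]
      · left
        rw [hv, ← hxe, Function.update_eq_self]
    have gm : Monotone g := NormalStein.monotone_mul_steinSol z
    have hm : Antitone h := NormalStein.antitone_centredInd z
    rcases le_total u v with huv | huv
    · obtain ⟨a1, a2⟩ := NormalStein.steinSol_sub_bounds z huv
      have a1 : (v - u) * (g u + h v) ≤ f v - f u := a1
      have a2 : f v - f u ≤ (v - u) * (g v + h u) := a2
      have g1 := mul_le_mul_of_nonneg_left (gm huv) (sub_nonneg.2 huv)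
      have g2 := mul_le_mul_of_nonneg_left (hm huv) (sub_nonneg.2 huv)
      rw [abs_le]
      rcases hx with hx | hx <;> rw [hx] <;> constructor <;> linarith
    · obtain ⟨a1, a2⟩ := NormalStein.steinSol_sub_bounds z huv
      have a1 : (u - v) * (g v + h u) ≤ f u - f v := a1
      have a2 : f u - f v ≤ (u - v) * (g u + h v) := a2
      have g1 := mul_le_mul_of_nonneg_left (gm huv) (sub_nonneg.2 huv)
      have g2 := mul_le_mul_of_nonneg_left (hm huv) (sub_nonneg.2 huv)
      rw [abs_le]
      rcases hx with hx | hx <;> rw [hx] <;> constructor <;> linarith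
  have main : Ex p (fun x => h (W x)) =
      Ex p (fun x => (g (W x) + h (W x)) * (1 - σ * ∑ e, C e x * D e W x)) +
      σ * ∑ e, Ex p (fun x => C e x * (D e W x * (g (W x) + h (W x))
        - D e (fun x => f (W x)) x)) := by
    have e1 : Ex p (fun x => (g (W x) + h (W x)) * (1 - σ * ∑ e, C e x * D e W x)) =
        Ex p (fun x => g (W x)) + Ex p (fun x => h (W x)) -
          σ * ∑ e, Ex p (fun x => C e x * (D e W x * (g (W x) + h (W x)))) := by
      rw [← Ex_add, ← Ex_sum, ← Ex_const_mul, ← Ex_sub]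
      congr 1
      funext x
      have : ∑ e, C e x * (D e W x * (g (W x) + h (W x)))
          = (∑ e, C e x * D e W x) * (g (W x) + h (W x)) := by
        rw [Finset.sum_mul]
        exact Finset.sum_congr rfl fun e _ => by ring
      rw [this]
      ring
    simp only [mul_sub (C _ _), Ex_sub, Finset.sum_sub_distrib]
    rw [e1, hWf]
    ring
  have b1 : |Ex p (fun x => (g (W x) + h (W x)) * (1 - σ * ∑ e, C e x * D e W x))| ≤
      Ex p (fun x => |1 - σ * ∑ e, C e x * D e W x|) := by
    refine (abs_Ex_le h0 h1 _).trans (Ex_mono h0 h1 fun x => ?_)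
    rw [abs_mul]
    exact mul_le_of_le_one_left (abs_nonneg _)
      (NormalStein.abs_mul_steinSol_add_centredInd_le z (W x))
  have b2 : |σ * ∑ e, Ex p (fun x => C e x * (D e W x * (g (W x) + h (W x))
        - D e (fun x => f (W x)) x))| ≤
      2 * Ex p (fun x => |∑ e, Y p e x * (|C e x| * D e W x)|) := by
    have c1 : |σ * ∑ e, Ex p (fun x => C e x * (D e W x * (g (W x) + h (W x))
        - D e (fun x => f (W x)) x))| ≤
        σ * ∑ e, Ex p (fun x => |C e x| * D e W x * D e (fun x => K (W x)) x) := by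
      rw [abs_mul, abs_of_nonneg hσ0]
      refine mul_le_mul_of_nonneg_left ((Finset.abs_sum_le_sum_abs _ _).trans
        (Finset.sum_le_sum fun e _ => (abs_Ex_le h0 h1 _).trans (Ex_mono h0 h1 fun x => ?_))) hσ0
      rw [abs_mul, mul_assoc]
      exact mul_le_mul_of_nonneg_left (pt e x) (abs_nonneg _)
    -- Second integration by parts, read backwards: `|C e| * D e W` does not depend on `e`, so the
    -- increment of `K (W)` is traded for the factor `Y_e`.
    have c2 : σ * ∑ e, Ex p (fun x => |C e x| * D e W x * D e (fun x => K (W x)) x) =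
        Ex p (fun x => (∑ e, Y p e x * (|C e x| * D e W x)) * K (W x)) := by
      simp only [Finset.sum_mul, mul_assoc (Y p _ _)]
      rw [Ex_sum, Finset.mul_sum]
      refine Finset.sum_congr rfl fun e _ => ?_
      rw [Ex_Y_mul]
      congr 2
      funext x
      have hi : Indep e (fun x => |C e x| * D e W x) :=
        Indep.mul (fun x b => by rw [hC e x b]) (indep_D e W)
      exact (D_mul_of_indep hi _ x).symm
    have c3 : Ex p (fun x => (∑ e, Y p e x * (|C e x| * D e W x)) * K (W x)) ≤
        2 * Ex p (fun x => |∑ e, Y p e x * (|C e x| * D e W x)|) := by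
      rw [← Ex_const_mul]
      refine Ex_mono h0 h1 fun x => (le_abs_self _).trans ?_
      rw [abs_mul, mul_comm]
      refine mul_le_mul_of_nonneg_right ?_ (abs_nonneg _)
      refine (abs_sub _ _).trans ?_
      have t1 : |g (W x)| ≤ 1 := NormalStein.abs_mul_steinSol_le z (W x)
      have t2 : |h (W x)| ≤ 1 := NormalStein.abs_centredInd_le z (W x)
      linarith
    exact c1.trans (c2.trans_le c3)
  rw [main]
  exact (abs_add_le _ _).trans (add_le_add b1 b2)

end BiasedCube

/-! ### Vertex counts of doubly covered quadruples of edge sets. -/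

namespace EdgeSystem

variable {E V : Type*} (vs : E → Finset V)

/-- The vertices covered by a set of edges. -/
noncomputable def supp (γ : Finset E) : Finset V := γ.biUnion vs

/-- The vertices covered by a quadruple of sets of edges. -/
noncomputable def usupp (τ : Fin 4 → Finset E) : Finset V :=
  Finset.univ.biUnion fun j => supp vs (τ j)

/-- The number of members of the quadruple that cover the vertex `u`. -/
noncomputable def mult (τ : Fin 4 → Finset E) (u : V) : ℕ :=
  (Finset.univ.filter fun j => u ∈ supp vs (τ j)).card

/-- Each edge of the quadruple lies in at least two of its members. -/
def DoublyCovered (τ : Fin 4 → Finset E) : Prop :=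
  ∀ j, ∀ g ∈ τ j, ∃ i, i ≠ j ∧ g ∈ τ i

variable {vs}

lemma vs_subset_supp {γ : Finset E} {e : E} (h : e ∈ γ) : vs e ⊆ supp vs γ :=
  Finset.subset_biUnion_of_mem vs h

lemma supp_subset_usupp (τ : Fin 4 → Finset E) (j : Fin 4) : supp vs (τ j) ⊆ usupp vs τ :=
  Finset.subset_biUnion_of_mem (fun j => supp vs (τ j)) (Finset.mem_univ j)

lemma mem_usupp {τ : Fin 4 → Finset E} {u : V} : u ∈ usupp vs τ ↔ ∃ j, u ∈ supp vs (τ j) := by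
  simp [usupp]

lemma two_le_mult {τ : Fin 4 → Finset E} {u : V} {i j : Fin 4} (hij : i ≠ j)
    (hi : u ∈ supp vs (τ i)) (hj : u ∈ supp vs (τ j)) : 2 ≤ mult vs τ u := by
  rw [← Finset.card_pair hij]
  refine Finset.card_le_card fun t ht => ?_
  simp only [Finset.mem_insert, Finset.mem_singleton] at ht
  rcases ht with rfl | rfl <;> simpa

lemma three_le_mult {τ : Fin 4 → Finset E} {u : V} {i j l : Fin 4} (hij : i ≠ j) (hil : i ≠ l)
    (hjl : j ≠ l) (hi : u ∈ supp vs (τ i)) (hj : u ∈ supp vs (τ j)) (hl : u ∈ supp vs (τ l)) :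
    3 ≤ mult vs τ u := by
  have : ({i, j, l} : Finset (Fin 4)).card = 3 := Finset.card_eq_three.2 ⟨i, j, l, hij, hil, hjl, rfl⟩
  rw [← this]
  refine Finset.card_le_card fun t ht => ?_
  simp only [Finset.mem_insert, Finset.mem_singleton] at ht
  rcases ht with rfl | rfl | rfl <;> simpa

lemma exists_edge {γ : Finset E} {u : V} (h : u ∈ supp vs γ) : ∃ g ∈ γ, u ∈ vs g := by
  simpa [supp] using h

lemma DoublyCovered.two_le_mult {τ : Fin 4 → Finset E} (h : DoublyCovered τ) {u : V}
    (hu : u ∈ usupp vs τ) : 2 ≤ mult vs τ u := by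
  obtain ⟨j, hj⟩ := mem_usupp.1 hu
  obtain ⟨g, hg, hug⟩ := exists_edge hj
  obtain ⟨i, hij, hi⟩ := h j g hg
  exact EdgeSystem.two_le_mult hij (vs_subset_supp hi hug) hj

lemma sum_card_supp (τ : Fin 4 → Finset E) :
    ∑ j, (supp vs (τ j)).card = ∑ u ∈ usupp vs τ, mult vs τ u := by
  have h := Finset.sum_card_bipartiteAbove_eq_sum_card_bipartiteBelow
    (s := (Finset.univ : Finset (Fin 4))) (t := usupp vs τ) (fun j u => u ∈ supp vs (τ j))
  rw [show ∑ u ∈ usupp vs τ, mult vs τ u = _ from h.symm]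
  refine Finset.sum_congr rfl fun j _ => congrArg Finset.card ?_
  ext u
  simp only [Finset.bipartiteAbove, Finset.mem_filter]
  exact ⟨fun hu => ⟨supp_subset_usupp τ j hu, hu⟩, fun hu => hu.2⟩

/-- Double counting of incidences between vertices and members. The last sum is the excess of the
multiplicities over two; the bounds below play it off against lower bounds for the left side. -/
lemma DoublyCovered.sum_card_eq {τ : Fin 4 → Finset E} (h : DoublyCovered τ) :
    ∑ j, (supp vs (τ j)).card
      = 2 * (usupp vs τ).card + ∑ u ∈ usupp vs τ, (mult vs τ u - 2) := by
  rw [sum_card_supp, mul_comm, ← smul_eq_mul, ← Finset.sum_const, ← Finset.sum_add_distrib]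
  exact Finset.sum_congr rfl fun u hu => by
    have := h.two_le_mult hu
    omega

lemma excess_le {τ : Fin 4 → Finset E} (T : Finset V) (hT : T ⊆ usupp vs τ) :
    ∑ u ∈ T, (mult vs τ u - 2) ≤ ∑ u ∈ usupp vs τ, (mult vs τ u - 2) :=
  Finset.sum_le_sum_of_subset hT

lemma mem_usupp_of_mult_pos {τ : Fin 4 → Finset E} {u : V} (h : 0 < mult vs τ u) :
    u ∈ usupp vs τ := by
  obtain ⟨j, hj⟩ := Finset.card_pos.1 h
  exact mem_usupp.2 ⟨j, (Finset.mem_filter.1 hj).2⟩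

lemma one_le_excess {τ : Fin 4 → Finset E} {u : V} (hu : 3 ≤ mult vs τ u) :
    1 ≤ ∑ u ∈ usupp vs τ, (mult vs τ u - 2) := by
  have h := excess_le (vs := vs) (τ := τ) {u} (by
    simpa using mem_usupp_of_mult_pos (by omega : 0 < mult vs τ u))
  rw [Finset.sum_singleton] at h
  omega

lemma two_le_excess {τ : Fin 4 → Finset E} {u v : V} (huv : u ≠ v) (hu : 3 ≤ mult vs τ u)
    (hv : 3 ≤ mult vs τ v) : 2 ≤ ∑ u ∈ usupp vs τ, (mult vs τ u - 2) := by
  have h := excess_le (vs := vs) (τ := τ) {u, v} (by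
    intro t ht
    simp only [Finset.mem_insert, Finset.mem_singleton] at ht
    rcases ht with rfl | rfl
    · exact mem_usupp_of_mult_pos (by omega)
    · exact mem_usupp_of_mult_pos (by omega))
  rw [Finset.sum_pair huv] at h
  omega

section Common

variable {τ : Fin 4 → Finset E} {e : E}

/-- A quadruple of sets of edges that share an edge. -/
lemma card_usupp_add_six_le (hvs : ∀ e, (vs e).card = 2) (h : DoublyCovered τ)
    (he : ∀ j, e ∈ τ j) :
    (usupp vs τ).card + 6 ≤ ∑ j, (supp vs (τ j)).card ∧
    ((∀ j, 3 ≤ (supp vs (τ j)).card) →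
      (usupp vs τ).card + 8 ≤ ∑ j, (supp vs (τ j)).card) := by
  have hm : ∀ u ∈ vs e, mult vs τ u = 4 := by
    intro u hu
    have : (Finset.univ.filter fun j => u ∈ supp vs (τ j)) = Finset.univ :=
      Finset.filter_true_of_mem fun j _ => vs_subset_supp (he j) hu
    rw [mult, this]
    simp
  have hsub : vs e ⊆ usupp vs τ := (vs_subset_supp (he 0)).trans (supp_subset_usupp τ 0)
  have h4 : ∑ u ∈ vs e, (mult vs τ u - 2) = 4 := by
    rw [Finset.sum_congr rfl fun u hu => by rw [hm u hu], Finset.sum_const, hvs]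
    rfl
  have h5 := excess_le (vs := vs) (τ := τ) (vs e) hsub
  have h6 := h.sum_card_eq (vs := vs)
  have h7 : 2 ≤ (usupp vs τ).card := (hvs e) ▸ Finset.card_le_card hsub
  -- Let U be the size of the union. Both ends of `e` have multiplicity four, so the total is at
  -- least 2U + 4. As U ≥ 2, this gives U + 6. It gives U + 8 when U ≥ 4, and for smaller U the
  -- total of at least 12 suffices.
  refine ⟨by omega, fun h3 => ?_⟩
  have h8 : ∑ _j : Fin 4, 3 ≤ ∑ j, (supp vs (τ j)).card := Finset.sum_le_sum fun j _ => h3 j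
  simp at h8
  omega

end Common

section Linked

variable {τ : Fin 4 → Finset E} {e e' f : E}

lemma inter_nonempty_of_card_le (hvs : ∀ e, (vs e).card = 2) {a b : E} {S : Finset V}
    (ha : vs a ⊆ S) (hb : vs b ⊆ S) (hS : S.card ≤ 3) : ∃ u, u ∈ vs a ∧ u ∈ vs b := by
  by_contra hc
  push Not at hc
  have hd : Disjoint (vs a) (vs b) := Finset.disjoint_left.2 hc
  have := Finset.card_le_card (Finset.union_subset ha hb)
  rw [Finset.card_union_of_disjoint hd, hvs, hvs] at this
  omega

lemma three_le_card_of_ne (hvs : ∀ e, (vs e).card = 2) (hinj : Function.Injective vs)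
    {γ : Finset E} {a b : E} (ha : a ∈ γ) (hb : b ∈ γ) (hab : a ≠ b) :
    3 ≤ (supp vs γ).card := by
  by_contra hc
  have h1 : vs a = supp vs γ := Finset.eq_of_subset_of_card_le (vs_subset_supp ha)
    (by rw [hvs]; omega)
  have h2 : vs b = supp vs γ := Finset.eq_of_subset_of_card_le (vs_subset_supp hb)
    (by rw [hvs]; omega)
  exact hab (hinj (h1.trans h2.symm))

lemma two_le_card_supp (hvs : ∀ e, (vs e).card = 2) {γ : Finset E} {a : E} (ha : a ∈ γ) :
    2 ≤ (supp vs γ).card := hvs a ▸ Finset.card_le_card (vs_subset_supp ha)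

/-- A quadruple of sets of edges, the first and the third of which share the edge `f`, the first
two an edge `e ≠ f` and the last two an edge `e' ≠ f`. -/
structure Linked (τ : Fin 4 → Finset E) (e e' f : E) : Prop where
  covered : DoublyCovered τ
  e_mem_zero : e ∈ τ 0
  e_mem_one : e ∈ τ 1
  e'_mem_two : e' ∈ τ 2
  e'_mem_three : e' ∈ τ 3
  f_mem_zero : f ∈ τ 0
  f_mem_two : f ∈ τ 2
  e_ne : e ≠ f
  e'_ne : e' ≠ f

lemma Linked.swap (h : Linked τ e e' f) : Linked (τ ∘ ![2, 3, 0, 1]) e' e f where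
  covered := by
    intro j g hg
    obtain ⟨i, hi, hgi⟩ := h.covered _ g hg
    have hs : ∀ i : Fin 4, ![2, 3, 0, 1] (![2, 3, 0, 1] i) = i := by decide
    refine ⟨![2, 3, 0, 1] i, ?_, ?_⟩
    · rintro rfl
      exact hi (hs i).symm
    · simpa [hs] using hgi
  e_mem_zero := h.e'_mem_two
  e_mem_one := h.e'_mem_three
  e'_mem_two := h.e_mem_zero
  e'_mem_three := h.e_mem_one
  f_mem_zero := h.f_mem_two
  f_mem_two := h.f_mem_zero
  e_ne := h.e'_ne
  e'_ne := h.e_ne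

lemma usupp_swap (τ : Fin 4 → Finset E) : usupp vs (τ ∘ ![2, 3, 0, 1]) = usupp vs τ := by
  ext u
  simp only [mem_usupp, Fin.exists_fin_succ, Function.comp]
  simp
  tauto

lemma sum_card_swap (τ : Fin 4 → Finset E) :
    ∑ j, (supp vs ((τ ∘ ![2, 3, 0, 1]) j)).card = ∑ j, (supp vs (τ j)).card := by
  simp [Fin.sum_univ_four]
  ring

lemma Linked.common_mult (h : Linked τ e e' f) {u : V} (he : u ∈ vs e) (hf : u ∈ vs f) :
    3 ≤ mult vs τ u :=
  three_le_mult (i := 0) (j := 1) (l := 2) (by decide) (by decide) (by decide)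
    (vs_subset_supp h.e_mem_zero he) (vs_subset_supp h.e_mem_one he)
    (vs_subset_supp h.f_mem_two hf)

/-- Members 0 and 2 contain two distinct edges, hence at least three vertices, and the total is at
least 10. If `τ 0` has three vertices, then `e` and `f` meet in a vertex of multiplicity at least
three; otherwise the total is at least 11. Either gain is enough. -/
lemma Linked.card_add_six_le (hvs : ∀ e, (vs e).card = 2) (hinj : Function.Injective vs)
    (h : Linked τ e e' f) : (usupp vs τ).card + 6 ≤ ∑ j, (supp vs (τ j)).card := by
  have h0 := three_le_card_of_ne hvs hinj h.e_mem_zero h.f_mem_zero h.e_ne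
  have h2 := three_le_card_of_ne hvs hinj h.e'_mem_two h.f_mem_two h.e'_ne
  have h1 := two_le_card_supp hvs h.e_mem_one
  have h3 := two_le_card_supp hvs h.e'_mem_three
  have hs := h.covered.sum_card_eq (vs := vs)
  have h4 := Fin.sum_univ_four fun j => (supp vs (τ j)).card
  rcases le_or_gt (supp vs (τ 0)).card 3 with hc | hc
  · obtain ⟨u, hu1, hu2⟩ := inter_nonempty_of_card_le hvs (vs_subset_supp h.e_mem_zero)
      (vs_subset_supp h.f_mem_zero) hc
    have := one_le_excess (h.common_mult hu1 hu2)
    omega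
  · omega

/-- The same dichotomy starting from a total of at least 12. Equality occurs: for four edges `e`,
`f`, `e'`, `g` at one vertex with distinct other ends, take the pairs `{e, f}`, `{e, g}`, `{e', f}`,
`{e', g}`. -/
lemma Linked.card_add_seven_le (hvs : ∀ e, (vs e).card = 2)
    (h : Linked τ e e' f) (h3 : ∀ j, 3 ≤ (supp vs (τ j)).card) :
    (usupp vs τ).card + 7 ≤ ∑ j, (supp vs (τ j)).card := by
  have hs := h.covered.sum_card_eq (vs := vs)
  have h4 := Fin.sum_univ_four fun j => (supp vs (τ j)).card
  have := h3 0
  have := h3 1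
  have := h3 2
  have := h3 3
  rcases le_or_gt (supp vs (τ 0)).card 3 with hc | hc
  · obtain ⟨u, hu1, hu2⟩ := inter_nonempty_of_card_le hvs (vs_subset_supp h.e_mem_zero)
      (vs_subset_supp h.f_mem_zero) hc
    have := one_le_excess (h.common_mult hu1 hu2)
    omega
  · omega

/-- All pairs of covered vertices are edges. -/
def IsComplete (vs : E → Finset V) (γ : Finset E) : Prop :=
  ∀ u ∈ supp vs γ, ∀ v ∈ supp vs γ, u ≠ v → ∃ g ∈ γ, u ∈ vs g ∧ v ∈ vs g

lemma exists_mem_not_mem (hvs : ∀ e, (vs e).card = 2) (hinj : Function.Injective vs) {a b : E}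
    (hab : a ≠ b) : ∃ u, u ∈ vs a ∧ u ∉ vs b := by
  by_contra hc
  push Not at hc
  exact hab (hinj (Finset.eq_of_subset_of_card_le hc (by rw [hvs, hvs])))

/-- Let `e = yz` and `f = xy`. The vertex `y` lies in members 0, 1, 2. The third side `xz` lies in a
further member: if it is member 2, then `z` is in members 0, 1, 2; otherwise `x` is in three
members. -/
lemma Linked.two_le_excess_of_triangle (hvs : ∀ e, (vs e).card = 2)
    (hinj : Function.Injective vs) (h : Linked τ e e' f) (hc : (supp vs (τ 0)).card = 3)
    (ht : IsComplete vs (τ 0)) : 2 ≤ ∑ u ∈ usupp vs τ, (mult vs τ u - 2) := by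
  obtain ⟨y, hye, hyf⟩ := inter_nonempty_of_card_le hvs (vs_subset_supp h.e_mem_zero)
    (vs_subset_supp h.f_mem_zero) hc.le
  obtain ⟨z, hze, hzf⟩ := exists_mem_not_mem hvs hinj h.e_ne
  obtain ⟨x, hxf, hxe⟩ := exists_mem_not_mem hvs hinj h.e_ne.symm
  have hy := h.common_mult hye hyf
  have hxy : x ≠ y := by rintro rfl; exact hxe hye
  have hzy : z ≠ y := by rintro rfl; exact hzf hyf
  have hxz : x ≠ z := by rintro rfl; exact hxe hze
  obtain ⟨g, hg, hxg, hzg⟩ := ht x (vs_subset_supp h.f_mem_zero hxf) z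
    (vs_subset_supp h.e_mem_zero hze) hxz
  obtain ⟨i, hi, hgi⟩ := h.covered 0 g hg
  have hxi := vs_subset_supp hgi hxg
  have hzi := vs_subset_supp hgi hzg
  by_cases hi2 : i = 2
  · subst hi2
    exact two_le_excess hzy (three_le_mult (i := 0) (j := 1) (l := 2) (by decide) (by decide)
      (by decide) (vs_subset_supp h.e_mem_zero hze) (vs_subset_supp h.e_mem_one hze) hzi) hy
  · exact two_le_excess hxy (three_le_mult (i := 0) (j := 2) (l := i) (by decide) hi.symm
      (Ne.symm hi2) (vs_subset_supp h.f_mem_zero hxf) (vs_subset_supp h.f_mem_two hxf) hxi) hy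

/-- Members 0 and 2 share `f` and cover at most four vertices together. A fifth vertex `q` must lie
in members 1 and 3, which are then the triangles on `e` and `q` and on `e'` and `q`; moreover
members 0 and 2 share only the ends of `f`. With `z` the end of `e` off `f`, the side `zq` of member
1 has no second member to lie in. -/
lemma Linked.card_le_four (hvs : ∀ e, (vs e).card = 2)
    (hinj : Function.Injective vs) (h : Linked τ e e' f) (hc : ∀ j, (supp vs (τ j)).card = 3)
    (ht : ∀ j, IsComplete vs (τ j)) : (usupp vs τ).card ≤ 4 := by
  by_contra hcon
  set S := fun j => supp vs (τ j) with hS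
  have hfS : vs f ⊆ S 0 ∩ S 2 :=
    Finset.subset_inter (vs_subset_supp h.f_mem_zero) (vs_subset_supp h.f_mem_two)
  have hf2 : 2 ≤ (S 0 ∩ S 2).card := hvs f ▸ Finset.card_le_card hfS
  have hun := Finset.card_union_add_card_inter (S 0) (S 2)
  have hc0 : (S 0).card = 3 := hc 0
  have hc2 : (S 2).card = 3 := hc 2
  obtain ⟨q, hq, hq02⟩ : ∃ q ∈ usupp vs τ, q ∉ S 0 ∪ S 2 := by
    by_contra hno
    push Not at hno
    have := Finset.card_le_card (show usupp vs τ ⊆ S 0 ∪ S 2 from hno)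
    omega
  simp only [Finset.mem_union, not_or] at hq02
  have fin4 : ∀ i : Fin 4, i = 0 ∨ i = 1 ∨ i = 2 ∨ i = 3 := by decide
  have hq13 : q ∈ S 1 ∧ q ∈ S 3 := by
    obtain ⟨j, hj⟩ := mem_usupp.1 hq
    obtain ⟨g, hg, hqg⟩ := exists_edge hj
    obtain ⟨i, hij, hi⟩ := h.covered j g hg
    have hqi : q ∈ S i := vs_subset_supp hi hqg
    have hqj : q ∈ S j := hj
    rcases fin4 i with rfl | rfl | rfl | rfl <;> rcases fin4 j with rfl | rfl | rfl | rfl <;>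
      first | exact absurd hqi hq02.1 | exact absurd hqi hq02.2 | exact absurd hqj hq02.1 |
        exact absurd hqj hq02.2 | exact absurd rfl hij | exact ⟨hqi, hqj⟩ | exact ⟨hqj, hqi⟩
  have hqe : q ∉ vs e := fun hqe => hq02.1 (vs_subset_supp h.e_mem_zero hqe)
  have hqe' : q ∉ vs e' := fun hqe => hq02.2 (vs_subset_supp h.e'_mem_two hqe)
  have hS1 : insert q (vs e) = S 1 := Finset.eq_of_subset_of_card_le
    (Finset.insert_subset hq13.1 (vs_subset_supp h.e_mem_one))
    (by rw [Finset.card_insert_of_notMem hqe, hvs]; exact (hc 1).le)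
  have hS3 : insert q (vs e') = S 3 := Finset.eq_of_subset_of_card_le
    (Finset.insert_subset hq13.2 (vs_subset_supp h.e'_mem_three))
    (by rw [Finset.card_insert_of_notMem hqe', hvs]; exact (hc 3).le)
  have hU : usupp vs τ ⊆ insert q (S 0 ∪ S 2) := by
    intro u hu
    obtain ⟨j, hj⟩ := mem_usupp.1 hu
    have hj' : u ∈ S j := hj
    have he0 := vs_subset_supp (vs := vs) h.e_mem_zero
    have he2 := vs_subset_supp (vs := vs) h.e'_mem_two
    simp only [Finset.mem_insert, Finset.mem_union]
    rcases fin4 j with rfl | rfl | rfl | rfl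
    · exact Or.inr (Or.inl hj')
    · rw [← hS1] at hj'
      rcases Finset.mem_insert.1 hj' with rfl | hue
      · exact Or.inl rfl
      · exact Or.inr (Or.inl (he0 hue))
    · exact Or.inr (Or.inr hj')
    · rw [← hS3] at hj'
      rcases Finset.mem_insert.1 hj' with rfl | hue
      · exact Or.inl rfl
      · exact Or.inr (Or.inr (he2 hue))
  have hUc := (Finset.card_le_card hU).trans (Finset.card_insert_le _ _)
  have hi2 : (S 0 ∩ S 2).card ≤ 2 := by omega
  have hfeq : vs f = S 0 ∩ S 2 := Finset.eq_of_subset_of_card_le hfS (by rw [hvs]; exact hi2)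
  obtain ⟨z, hze, hzf⟩ := exists_mem_not_mem hvs hinj h.e_ne
  have hz0 : z ∈ S 0 := vs_subset_supp h.e_mem_zero hze
  have hz2 : z ∉ S 2 := fun hz2 => hzf (hfeq ▸ Finset.mem_inter.2 ⟨hz0, hz2⟩)
  have hzq : z ≠ q := by rintro rfl; exact hq02.1 hz0
  obtain ⟨g, hg, hzg, hqg⟩ := ht 1 z (vs_subset_supp h.e_mem_one hze) q hq13.1 hzq
  obtain ⟨i, hi, hgi⟩ := h.covered 1 g hg
  have hqi : q ∈ S i := vs_subset_supp hgi hqg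
  have hzi : z ∈ S i := vs_subset_supp hgi hzg
  rcases fin4 i with rfl | rfl | rfl | rfl
  · exact hq02.1 hqi
  · exact hi rfl
  · exact hq02.2 hqi
  · rw [← hS3] at hzi
    rcases Finset.mem_insert.1 hzi with hzq' | hze'
    · exact hzq hzq'
    · exact hz2 (vs_subset_supp h.e'_mem_two hze')

lemma Linked.card_add_eight_le (hvs : ∀ e, (vs e).card = 2)
    (hinj : Function.Injective vs) (h : Linked τ e e' f)
    (h3 : ∀ j, 3 ≤ (supp vs (τ j)).card)
    (ht : ∀ j, (supp vs (τ j)).card = 3 → IsComplete vs (τ j)) :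
    (usupp vs τ).card + 8 ≤ ∑ j, (supp vs (τ j)).card := by
  have hs := h.covered.sum_card_eq (vs := vs)
  have h4 := Fin.sum_univ_four fun j => (supp vs (τ j)).card
  have c0 := h3 0
  have c1 := h3 1
  have c2 := h3 2
  have c3 := h3 3
  by_cases hall : ∀ j, (supp vs (τ j)).card = 3
  · have := h.card_le_four hvs hinj hall fun j => ht j (hall j)
    rw [Finset.sum_congr rfl fun j _ => hall j]
    simpa using this
  -- From here the claim can fail only with small excess: a triangle as member 0 or 2 supplies
  -- excess two, and any excess at all settles the case where both have at least four vertices. What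
  -- remains has sizes 4, 3, 4, 3 and no vertex in three members.
  have hge : 13 ≤ ∑ j, (supp vs (τ j)).card := by
    by_contra hlt
    refine hall fun j => ?_
    fin_cases j <;> simp <;> omega
  rcases c0.eq_or_lt with e0 | g0
  · have := h.two_le_excess_of_triangle hvs hinj e0.symm (ht 0 e0.symm)
    omega
  rcases c2.eq_or_lt with e2 | g2
  · have hsw := h.swap
    have := hsw.two_le_excess_of_triangle hvs hinj e2.symm (ht 2 e2.symm)
    have hs' := hsw.covered.sum_card_eq (vs := vs)
    rw [usupp_swap, sum_card_swap] at hs'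
    rw [usupp_swap] at this
    omega
  by_cases hex : 1 ≤ ∑ u ∈ usupp vs τ, (mult vs τ u - 2)
  · omega
  have hm : ∀ u, mult vs τ u ≤ 2 := fun u => by
    by_contra hu
    exact hex (one_le_excess (u := u) (by omega))
  by_contra hlt
  have k0 : (supp vs (τ 0)).card = 4 := by omega
  have k1 : (supp vs (τ 1)).card = 3 := by omega
  obtain ⟨a, ha⟩ : (vs e).Nonempty := Finset.card_pos.1 (by rw [hvs]; norm_num)
  have ha0 := vs_subset_supp (vs := vs) h.e_mem_zero ha
  have ha1 := vs_subset_supp (vs := vs) h.e_mem_one ha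
  -- The sides of the triangle `τ 1` at `a` need a second member containing `a`. With no triple
  -- multiplicities this is `τ 0`. So the triangle lies in the four vertices of `τ 0` and meets `f`,
  -- which creates a triple vertex after all.
  have hsub : supp vs (τ 1) ⊆ supp vs (τ 0) := by
    intro c hc
    by_cases hac : a = c
    · exact hac ▸ ha0
    obtain ⟨g, hg, hag, hcg⟩ := ht 1 k1 a ha1 c hc hac
    obtain ⟨i, hi, hgi⟩ := h.covered 1 g hg
    by_cases hi0 : i = 0
    · exact hi0 ▸ vs_subset_supp hgi hcg
    · exact absurd (three_le_mult (i := 0) (j := 1) (l := i) (by decide) (Ne.symm hi0) hi.symm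
        ha0 ha1 (vs_subset_supp hgi hag)) (by have := hm a; omega)
  obtain ⟨u, hu1, huf⟩ : ∃ u, u ∈ supp vs (τ 1) ∧ u ∈ vs f := by
    by_contra hno
    push Not at hno
    have hd : Disjoint (supp vs (τ 1)) (vs f) := Finset.disjoint_left.2 hno
    have := Finset.card_le_card (Finset.union_subset hsub (vs_subset_supp (vs := vs) h.f_mem_zero))
    rw [Finset.card_union_of_disjoint hd, hvs] at this
    omega
  have hu3 : 3 ≤ mult vs τ u := three_le_mult (i := 0) (j := 1) (l := 2) (by decide) (by decide)
    (by decide) (hsub hu1) hu1 (vs_subset_supp h.f_mem_two huf)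
  have := hm u
  omega

end Linked

end EdgeSystem

/-! ### Weighted counts of edge sets by the vertices they cover. -/

namespace EdgeSystem

section Counting

variable {V : Type*} [Fintype V] [Nonempty V]

/-- The inverse of the number of vertices. -/
noncomputable def invCard (V : Type*) [Fintype V] : ℝ := (Fintype.card V : ℝ)⁻¹

lemma invCard_pos : 0 < invCard V := inv_pos.2 (Nat.cast_pos.2 Fintype.card_pos)

lemma invCard_le_one : invCard V ≤ 1 :=
  inv_le_one_of_one_le₀ (Nat.one_le_cast.2 Fintype.card_pos)

lemma card_mul_invCard : (Fintype.card V : ℝ) * invCard V = 1 :=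
  mul_inv_cancel₀ (Nat.cast_ne_zero.2 Fintype.card_ne_zero)

lemma card_supersets_le (A : Finset V) (j : ℕ) :
    (Finset.univ.filter fun U : Finset V => A ⊆ U ∧ U.card = A.card + j).card
      ≤ Fintype.card V ^ j := by
  have h1 : (Finset.univ.filter fun U : Finset V => A ⊆ U ∧ U.card = A.card + j).card ≤
      (Finset.powersetCard j (Finset.univ : Finset V)).card := by
    refine Finset.card_le_card_of_injOn (fun U => U \ A) ?_ ?_
    · intro U hU
      simp only [Finset.coe_filter, Finset.mem_univ, true_and, Set.mem_ofPred_eq] at hU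
      simp [Finset.mem_powersetCard, Finset.card_sdiff_of_subset hU.1, hU.2]
    · intro U hU U' hU' h
      simp only [Finset.coe_filter, Finset.mem_univ, true_and, Set.mem_ofPred_eq] at hU hU'
      simp only at h
      rw [← Finset.sdiff_union_of_subset hU.1, h, Finset.sdiff_union_of_subset hU'.1]
  refine h1.trans ?_
  rw [Finset.card_powersetCard]
  exact Nat.choose_le_pow _ _

/-- With n points there are at most n^j supersets with j extra points, each of weight n^(-|A|-j), so
each j contributes at most n^(-|A|). -/
lemma sum_supersets_le (A : Finset V) (M : ℕ) :
    ∑ U : Finset V with A ⊆ U ∧ U.card ≤ M, invCard V ^ U.card ≤ (M + 1) * invCard V ^ A.card := by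
  set r := invCard V
  have hr : 0 < r := invCard_pos
  have h1 : ∑ U : Finset V with A ⊆ U ∧ U.card ≤ M, r ^ U.card ≤
      ∑ j ∈ Finset.range (M + 1), ∑ U : Finset V with A ⊆ U ∧ U.card = A.card + j, r ^ U.card := by
    rw [← Finset.sum_biUnion]
    · refine Finset.sum_le_sum_of_subset_of_nonneg ?_ fun _ _ _ => by positivity
      intro U hU
      simp only [Finset.mem_filter, Finset.mem_univ, true_and] at hU
      have := Finset.card_le_card hU.1
      simp only [Finset.mem_biUnion, Finset.mem_filter, Finset.mem_univ, true_and, Finset.mem_range]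
      exact ⟨U.card - A.card, by omega, hU.1, by omega⟩
    · intro i _ j _ hij
      refine Finset.disjoint_left.2 fun U hi hj => hij ?_
      simp only [Finset.mem_filter, Finset.mem_univ, true_and] at hi hj
      omega
  have h2 : ∀ j ∈ Finset.range (M + 1),
      ∑ U : Finset V with A ⊆ U ∧ U.card = A.card + j, r ^ U.card ≤ r ^ A.card := by
    intro j _
    have : ∑ U : Finset V with A ⊆ U ∧ U.card = A.card + j, r ^ U.card
        = ∑ U : Finset V with A ⊆ U ∧ U.card = A.card + j, r ^ (A.card + j) :=
      Finset.sum_congr rfl fun U hU => by rw [(Finset.mem_filter.1 hU).2.2]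
    rw [this, Finset.sum_const, nsmul_eq_mul]
    have hc : ((Finset.univ.filter fun U : Finset V => A ⊆ U ∧ U.card = A.card + j).card : ℝ)
        ≤ (Fintype.card V : ℝ) ^ j := by exact_mod_cast card_supersets_le A j
    calc _ ≤ (Fintype.card V : ℝ) ^ j * r ^ (A.card + j) :=
          mul_le_mul_of_nonneg_right hc (by positivity)
      _ = ((Fintype.card V : ℝ) * r) ^ j * r ^ A.card := by ring
      _ = r ^ A.card := by rw [card_mul_invCard, one_pow, one_mul]
  refine h1.trans ((Finset.sum_le_sum h2).trans ?_)
  simp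

lemma sum_le_of_fiber_le {ι : Type*} (S : Finset ι) (U : ι → Finset V) (A : Finset V) (M c : ℕ)
    (hS : ∀ i ∈ S, A ⊆ U i ∧ (U i).card ≤ M)
    (hc : ∀ T : Finset V, T.card ≤ M → (S.filter fun i => U i = T).card ≤ c) :
    ∑ i ∈ S, invCard V ^ (U i).card ≤ c * (M + 1) * invCard V ^ A.card := by
  have hr : 0 < invCard V := invCard_pos
  have h := Finset.sum_fiberwise_of_maps_to (s := S)
    (t := Finset.univ.filter fun T : Finset V => A ⊆ T ∧ T.card ≤ M) (g := U)
    (fun i hi => by simpa using hS i hi) (fun i => invCard V ^ (U i).card)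
  rw [← h]
  have h2 : ∀ T ∈ Finset.univ.filter (fun T : Finset V => A ⊆ T ∧ T.card ≤ M),
      ∑ i ∈ S with U i = T, invCard V ^ (U i).card ≤ c * invCard V ^ T.card := by
    intro T hT
    rw [Finset.sum_congr rfl fun i hi => by rw [(Finset.mem_filter.1 hi).2], Finset.sum_const,
      nsmul_eq_mul]
    exact mul_le_mul_of_nonneg_right (Nat.cast_le.2 (hc T (Finset.mem_filter.1 hT).2.2))
      (by positivity)
  refine (Finset.sum_le_sum h2).trans ?_
  rw [← Finset.mul_sum, mul_assoc]
  exact mul_le_mul_of_nonneg_left (sum_supersets_le A M) (Nat.cast_nonneg c)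

variable {E : Type*} [Fintype E] {vs : E → Finset V}

variable (vs) in
/-- The edges spanned by a set of vertices. -/
noncomputable def edgesIn (T : Finset V) : Finset E := Finset.univ.filter fun e => vs e ⊆ T

lemma mem_edgesIn {T : Finset V} {e : E} : e ∈ edgesIn vs T ↔ vs e ⊆ T := by simp [edgesIn]

lemma card_edgesIn_le (hinj : Function.Injective vs) (T : Finset V) :
    (edgesIn vs T).card ≤ 2 ^ T.card := by
  rw [← Finset.card_powerset]
  refine Finset.card_le_card_of_injOn vs (fun e he => ?_) hinj.injOn
  simpa [edgesIn] using he

lemma subset_edgesIn {T : Finset V} {γ : Finset E} (h : supp vs γ ⊆ T) : γ ⊆ edgesIn vs T :=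
  fun _ he => mem_edgesIn.2 ((vs_subset_supp he).trans h)

lemma card_powerset_edgesIn_le (hinj : Function.Injective vs) {T : Finset V} {M : ℕ}
    (hT : T.card ≤ M) : (edgesIn vs T).powerset.card ≤ 2 ^ 2 ^ M := by
  rw [Finset.card_powerset]
  exact Nat.pow_le_pow_right (by norm_num) ((card_edgesIn_le hinj T).trans
    (Nat.pow_le_pow_right (by norm_num) hT))

/-- A constant in counting bounds for quadruples of sets of edges. -/
def quadConst (M : ℕ) : ℕ := 2 ^ (4 * M) * (2 ^ (4 * M) * (2 ^ 2 ^ (4 * M)) ^ 4) * (4 * M + 1)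

/-- The weighted number of quadruples whose total support exceeds the joint support by `x`. -/
lemma sum_quadruples_le (hinj : Function.Injective vs) {ι : Type*} (S : Finset ι) (a b : ι → E)
    (τ : ι → Fin 4 → Finset E) (hinj' : Set.InjOn (fun i => (a i, b i, τ i)) S)
    (A : Finset V) (M x : ℕ)
    (ha : ∀ i ∈ S, vs (a i) ⊆ usupp vs (τ i)) (hb : ∀ i ∈ S, vs (b i) ⊆ usupp vs (τ i))
    (hA : ∀ i ∈ S, A ⊆ usupp vs (τ i)) (hM : ∀ i ∈ S, ∀ j, (supp vs (τ i j)).card ≤ M)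
    (hx : ∀ i ∈ S, (usupp vs (τ i)).card + x ≤ ∑ j, (supp vs (τ i j)).card) :
    ∑ i ∈ S, ∏ j, invCard V ^ (supp vs (τ i j)).card ≤ quadConst M * invCard V ^ (A.card + x) := by
  have hr : 0 < invCard V := invCard_pos
  have h1 : ∑ i ∈ S, ∏ j, invCard V ^ (supp vs (τ i j)).card ≤
      ∑ i ∈ S, invCard V ^ (usupp vs (τ i)).card * invCard V ^ x := by
    refine Finset.sum_le_sum fun i hi => ?_
    rw [Finset.prod_pow_eq_pow_sum, ← pow_add]
    exact pow_le_pow_of_le_one hr.le invCard_le_one (hx i hi)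
  refine h1.trans ?_
  rw [← Finset.sum_mul, pow_add, ← mul_assoc]
  refine mul_le_mul_of_nonneg_right ?_ (by positivity)
  -- A union of at most `4 * M` vertices spans at most `2 ^ (4 * M)` edges, which bounds the choices
  -- of `a` and of `b`, and leaves at most `2 ^ 2 ^ (4 * M)` choices for each member. These are all
  -- but the last factor of `quadConst`.
  refine (sum_le_of_fiber_le S (fun i => usupp vs (τ i)) A (4 * M)
    (2 ^ (4 * M) * (2 ^ (4 * M) * (2 ^ 2 ^ (4 * M)) ^ 4)) (fun i hi => ⟨hA i hi, ?_⟩) ?_).trans ?_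
  · refine Finset.card_biUnion_le.trans ((Finset.sum_le_sum fun j _ => hM i hi j).trans ?_)
    simp
  · intro T hT
    have hsub : ((S.filter fun i => usupp vs (τ i) = T).image fun i => (a i, b i, τ i)) ⊆
        edgesIn vs T ×ˢ (edgesIn vs T ×ˢ Fintype.piFinset fun _ => (edgesIn vs T).powerset) := by
      intro t ht
      obtain ⟨i, hi, rfl⟩ := Finset.mem_image.1 ht
      obtain ⟨hiS, rfl⟩ := Finset.mem_filter.1 hi
      simp only [Finset.mem_product, mem_edgesIn, Fintype.mem_piFinset, Finset.mem_powerset]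
      exact ⟨ha i hiS, hb i hiS, fun j => subset_edgesIn (supp_subset_usupp (τ i) j)⟩
    have hcard := Finset.card_le_card hsub
    rw [Finset.card_image_of_injOn (hinj'.mono fun i hi => (Finset.mem_filter.1 hi).1),
      Finset.card_product, Finset.card_product, Fintype.card_piFinset_const] at hcard
    have he : (edgesIn vs T).card ≤ 2 ^ (4 * M) := (card_edgesIn_le hinj T).trans
      (Nat.pow_le_pow_right (by norm_num) hT)
    refine hcard.trans (Nat.mul_le_mul he (Nat.mul_le_mul he ?_))
    exact Nat.pow_le_pow_left (card_powerset_edgesIn_le hinj hT) 4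
  · simp [quadConst]

lemma sum_supp_le (hinj : Function.Injective vs) (S : Finset (Finset E)) (A : Finset V) (M : ℕ)
    (hS : ∀ γ ∈ S, A ⊆ supp vs γ ∧ (supp vs γ).card ≤ M) :
    ∑ γ ∈ S, invCard V ^ (supp vs γ).card ≤ quadConst M * invCard V ^ A.card := by
  refine (sum_le_of_fiber_le S (supp vs) A M (2 ^ 2 ^ M) hS fun T hT => ?_).trans ?_
  · refine (Finset.card_le_card fun γ hγ => ?_).trans (card_powerset_edgesIn_le hinj hT)
    rw [Finset.mem_powerset]
    exact subset_edgesIn (Finset.mem_filter.1 hγ).2.le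
  · refine mul_le_mul_of_nonneg_right ?_ (pow_nonneg invCard_pos.le _)
    have : 2 ^ 2 ^ M * (M + 1) ≤ quadConst M := by
      rw [quadConst]
      refine Nat.mul_le_mul ?_ (by omega)
      have h0 : 2 ^ 2 ^ M ≤ 2 ^ 2 ^ (4 * M) :=
        Nat.pow_le_pow_right (by norm_num) (Nat.pow_le_pow_right (by norm_num) (by omega))
      have h1 : 2 ^ 2 ^ (4 * M) ≤ (2 ^ 2 ^ (4 * M)) ^ 4 := Nat.le_self_pow (by norm_num) _
      have h2 : 1 ≤ 2 ^ (4 * M) := Nat.one_le_two_pow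
      calc 2 ^ 2 ^ M ≤ 1 * (1 * (2 ^ 2 ^ (4 * M)) ^ 4) := by simpa using h0.trans h1
        _ ≤ _ := Nat.mul_le_mul h2 (Nat.mul_le_mul h2 le_rfl)
    exact_mod_cast this

/-- 80 = 16 * (4 + 1): the union has at most four vertices and contains at most `2 ^ 4` edges. -/
lemma sum_edges_le (hvs : ∀ e, (vs e).card = 2) (hinj : Function.Injective vs) (e : E) :
    ∑ f, invCard V ^ (vs e ∪ vs f).card ≤ 80 * invCard V ^ 2 := by
  have h := sum_le_of_fiber_le Finset.univ (fun f => vs e ∪ vs f) (vs e) 4 16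
    (fun f _ => ⟨Finset.subset_union_left, ?_⟩) ?_
  · refine h.trans ?_
    rw [hvs]
    norm_num
  · exact (Finset.card_union_le _ _).trans (by rw [hvs, hvs])
  · intro T hT
    refine (Finset.card_le_card (t := edgesIn vs T) fun f hf => ?_).trans
      ((card_edgesIn_le hinj T).trans (Nat.pow_le_pow_right (n := 2) (by norm_num) hT))
    exact mem_edgesIn.2 ((Finset.mem_filter.1 hf).2 ▸ Finset.subset_union_right)

lemma card_edges_mul_le (hvs : ∀ e, (vs e).card = 2) (hinj : Function.Injective vs) :
    (Fintype.card E : ℝ) * invCard V ^ 2 ≤ 1 := by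
  have h : Fintype.card E ≤ Fintype.card V ^ 2 := by
    have : (Finset.univ : Finset E).card ≤ (Finset.powersetCard 2 (Finset.univ : Finset V)).card :=
      Finset.card_le_card_of_injOn vs (fun e _ => by simp [Finset.mem_powersetCard, hvs])
        hinj.injOn
    rw [Finset.card_powersetCard] at this
    exact this.trans (Nat.choose_le_pow _ _)
  calc (Fintype.card E : ℝ) * invCard V ^ 2 ≤ (Fintype.card V : ℝ) ^ 2 * invCard V ^ 2 :=
        mul_le_mul_of_nonneg_right (by exact_mod_cast h) (sq_nonneg _)
    _ = 1 := by rw [← mul_pow, card_mul_invCard, one_pow]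

end Counting

end EdgeSystem

/-! ### Multilinear polynomials in the edges, their derivatives and moments. -/

namespace EdgeSystem

open BiasedCube

section Polynomials

variable {E : Type*} [Fintype E] (p : ℝ)

/-- The multilinear polynomial with coefficients `u`. -/
noncomputable def poly (u : Finset E → ℝ) (x : E → Bool) : ℝ := ∑ γ, u γ * mono p γ x

/-- The derivative in direction `e` of the polynomial with coefficients `u`. -/
noncomputable def dpoly (u : Finset E → ℝ) (e : E) (x : E → Bool) : ℝ :=
  ∑ γ with e ∈ γ, u γ * mono p (γ.erase e) x

/-- The second derivative of the polynomial with coefficients `u`. -/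
noncomputable def ddpoly (u : Finset E → ℝ) (e f : E) (x : E → Bool) : ℝ :=
  ∑ γ with e ∈ γ ∧ f ∈ γ, u γ * mono p ((γ.erase e).erase f) x

/-- The part of the derivative in direction `e` that does not involve the coordinate `f`. -/
noncomputable def dpolyRest (u : Finset E → ℝ) (e f : E) (x : E → Bool) : ℝ :=
  ∑ γ with e ∈ γ ∧ f ∉ γ, u γ * mono p ((γ.erase e).erase f) x

lemma D_poly (u : Finset E → ℝ) (e : E) (x : E → Bool) : D e (poly p u) x = dpoly p u e x := by
  rw [show poly p u = fun x => ∑ γ, u γ * mono p γ x from rfl, D_sum, dpoly, Finset.sum_filter]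
  refine Finset.sum_congr rfl fun γ _ => ?_
  rw [D_const_mul]
  split_ifs with h
  · rw [D_mono p h]
  · rw [(indep_mono p h).D_eq_zero, mul_zero]

lemma indep_dpoly (u : Finset E → ℝ) (e : E) : Indep e (dpoly p u e) := by
  intro x b
  simp only [dpoly, indep_mono p (Finset.notMem_erase e _) x b]

lemma indep_ddpoly (u : Finset E → ℝ) (e f : E) : Indep f (ddpoly p u e f) := by
  intro x b
  simp only [ddpoly, indep_mono p (Finset.notMem_erase f _) x b]

lemma indep_dpolyRest (u : Finset E → ℝ) (e f : E) : Indep f (dpolyRest p u e f) := by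
  intro x b
  simp only [dpolyRest, indep_mono p (Finset.notMem_erase f _) x b]

lemma dpoly_eq (u : Finset E → ℝ) {e f : E} (hef : e ≠ f) (x : E → Bool) :
    dpoly p u e x = dpolyRest p u e f x + Y p f x * ddpoly p u e f x := by
  simp only [dpoly, dpolyRest, ddpoly, Finset.sum_filter, Finset.mul_sum]
  rw [← Finset.sum_add_distrib]
  refine Finset.sum_congr rfl fun γ _ => ?_
  by_cases he : e ∈ γ
  · by_cases hf : f ∈ γ
    · simp only [he, hf, not_true, and_self, and_false, if_true, if_false, zero_add]
      rw [mono_eq_mul_erase p (Finset.mem_erase.2 ⟨hef.symm, hf⟩)]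
      ring
    · simp only [he, hf, not_false_eq_true, and_self, and_false, if_true, if_false, add_zero,
        mul_zero]
      rw [Finset.erase_eq_of_notMem fun h => hf (Finset.mem_of_mem_erase h)]
  · simp [he]

lemma D_dpoly (u : Finset E → ℝ) {e f : E} (hef : e ≠ f) (x : E → Bool) :
    D f (dpoly p u e) x = ddpoly p u e f x := by
  rw [D, dpoly_eq p u hef, dpoly_eq p u hef, indep_dpolyRest p u e f, indep_dpolyRest p u e f,
    indep_ddpoly p u e f, indep_ddpoly p u e f, Y_update_true, Y_update_false]
  ring

/-- Both factors are affine in `Y_f`, and `1 - 2 * p` is the increment of its square. The idle `0 *`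
gives both summands the shape treated by `Ex_sum_ddpoly_mul_sq_le`. -/
lemma D_dpoly_mul_dpoly (u w : Finset E → ℝ) {e f : E} (hef : e ≠ f) (x : E → Bool) :
    D f (fun x => dpoly p u e x * dpoly p w e x) x =
      ddpoly p u e f x * (dpolyRest p w e f x + (1 - 2 * p) * ddpoly p w e f x) +
      ddpoly p w e f x * (dpolyRest p u e f x + 0 * ddpoly p u e f x) := by
  simp only [D, dpoly_eq p u hef, dpoly_eq p w hef, indep_dpolyRest p u e f x,
    indep_dpolyRest p w e f x, indep_ddpoly p u e f x, indep_ddpoly p w e f x, Y_update_true,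
    Y_update_false]
  ring

/-- The coefficients of the polynomial in the equation `poly u = ∑ Y_e C_e`. -/
noncomputable def divCard (u : Finset E → ℝ) (γ : Finset E) : ℝ := u γ / γ.card

/-- The monomial of γ arises once for each edge of γ, which the division in `divCard` compensates.
The empty set is never reached, so its coefficient must vanish. -/
lemma poly_eq_sum {u : Finset E → ℝ} (h0 : u ∅ = 0) (x : E → Bool) :
    poly p u x = ∑ e, Y p e x * dpoly p (divCard u) e x := by
  simp only [dpoly, Finset.mul_sum, Finset.sum_filter]
  rw [Finset.sum_comm, poly]
  refine Finset.sum_congr rfl fun γ _ => ?_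
  rcases γ.eq_empty_or_nonempty with rfl | hγ
  · simp [h0]
  · have h1 : ∀ e, (if e ∈ γ then Y p e x * (divCard u γ * mono p (γ.erase e) x) else 0) =
        if e ∈ γ then divCard u γ * mono p γ x else 0 := by
      intro e
      split_ifs with he
      · rw [mono_eq_mul_erase p he]
        ring
      · rfl
    have h2 : (γ.card : ℝ) ≠ 0 := Nat.cast_ne_zero.2 (Finset.card_ne_zero.2 hγ)
    have h3 : ∀ e, (Y p e x * if e ∈ γ then divCard u γ * mono p (γ.erase e) x else 0) =
        if e ∈ γ then Y p e x * (divCard u γ * mono p (γ.erase e) x) else 0 := fun e => by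
      split_ifs <;> simp
    simp only [h3, h1]
    rw [Finset.sum_ite_mem, Finset.univ_inter, Finset.sum_const, nsmul_eq_mul, divCard]
    field_simp

lemma Ex_poly_sq (u : Finset E → ℝ) :
    Ex p (fun x => poly p u x ^ 2) = ∑ γ, u γ ^ 2 * (p * (1 - p)) ^ γ.card := by
  have h : (fun x : E → Bool => poly p u x ^ 2) =
      fun x => ∑ γ, ∑ δ, (u γ * u δ) * (mono p γ x * mono p δ x) := by
    funext x
    rw [sq, poly, Finset.sum_mul_sum]
    exact Finset.sum_congr rfl fun γ _ => Finset.sum_congr rfl fun δ _ => by ring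
  rw [h, Ex_sum]
  refine Finset.sum_congr rfl fun γ _ => ?_
  rw [Ex_sum]
  simp only [Ex_const_mul, Ex_mono_mul_mono]
  rw [Finset.sum_eq_single γ]
  · simp [sq]
  · intro δ _ hδ
    simp [hδ.symm]
  · simp

end Polynomials

section Bounds

variable {E V : Type*} [Fintype E] [Fintype V] [Nonempty V] {vs : E → Finset V} {p : ℝ}

/-- The coefficients `u` decay with the number of vertices and vanish beyond `M` vertices. -/
structure Decay (vs : E → Finset V) (u : Finset E → ℝ) (A : ℝ) (M : ℕ) : Prop where
  abs_le : ∀ γ, |u γ| ≤ A * invCard V ^ (supp vs γ).card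
  card_le : ∀ γ, u γ ≠ 0 → (supp vs γ).card ≤ M

lemma Decay.nonneg {u : Finset E → ℝ} {A : ℝ} {M : ℕ} (h : Decay vs u A M) : 0 ≤ A := by
  have := (abs_nonneg _).trans (h.abs_le ∅)
  simpa [supp] using this

lemma Decay.divCard {u : Finset E → ℝ} {A : ℝ} {M : ℕ} (h : Decay vs u A M) :
    Decay vs (divCard u) A M where
  abs_le γ := by
    refine le_trans ?_ (h.abs_le γ)
    rw [EdgeSystem.divCard, abs_div, Nat.abs_cast]
    rcases Nat.eq_zero_or_pos γ.card with h0 | h0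
    · simp [h0]
    · exact div_le_self (abs_nonneg _) (Nat.one_le_cast.2 h0)
  card_le γ hγ := h.card_le γ fun h0 => hγ (by simp [EdgeSystem.divCard, h0])

/-- Only sets containing `e` and `f` contribute. All of them cover the vertices of both edges, so
the decay can be summed over supersets. -/
lemma abs_ddpoly_le (h0 : 0 ≤ p) (h1 : p ≤ 1) (hinj : Function.Injective vs)
    {u : Finset E → ℝ} {A : ℝ} {M : ℕ} (h : Decay vs u A M) (e f : E) (x : E → Bool) :
    |ddpoly p u e f x| ≤ A * quadConst M * invCard V ^ (vs e ∪ vs f).card := by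
  set S := Finset.univ.filter fun γ : Finset E => (e ∈ γ ∧ f ∈ γ) ∧ u γ ≠ 0 with hS
  have e1 : ddpoly p u e f x = ∑ γ ∈ S, u γ * mono p ((γ.erase e).erase f) x := by
    rw [ddpoly, hS, ← Finset.filter_filter (fun γ => e ∈ γ ∧ f ∈ γ) (fun γ => u γ ≠ 0)]
    refine Eq.symm (Finset.sum_filter_of_ne ?_)
    intro γ _ hne hz
    exact hne (by rw [hz, zero_mul])
  rw [e1]
  refine (Finset.abs_sum_le_sum_abs _ _).trans ?_
  have e2 : ∀ γ ∈ S, |u γ * mono p ((γ.erase e).erase f) x| ≤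
      A * invCard V ^ (supp vs γ).card := by
    intro γ _
    rw [abs_mul]
    exact (mul_le_of_le_one_right (abs_nonneg _) (abs_mono_le h0 h1 _ x)).trans (h.abs_le γ)
  refine (Finset.sum_le_sum e2).trans ?_
  rw [← Finset.mul_sum, mul_assoc]
  refine mul_le_mul_of_nonneg_left (sum_supp_le hinj S _ M fun γ hγ => ?_) h.nonneg
  obtain ⟨hef, hu⟩ := (Finset.mem_filter.1 hγ).2
  exact ⟨Finset.union_subset (vs_subset_supp hef.1) (vs_subset_supp hef.2), h.card_le γ hu⟩

/-- The fourth power expands over quadruples through `e`, of which only doubly covered ones survive.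
The exponent collects the two vertices of `e` and the deficit `y`. -/
lemma Ex_dpoly_pow_four_le (h0 : 0 ≤ p) (h1 : p ≤ 1) (hvs : ∀ e, (vs e).card = 2)
    (hinj : Function.Injective vs)
    {u : Finset E → ℝ} {A : ℝ} {M : ℕ} (h : Decay vs u A M) (e : E) (y : ℕ)
    (hy : ∀ τ : Fin 4 → Finset E, DoublyCovered τ → (∀ j, e ∈ τ j) → (∀ j, u (τ j) ≠ 0) →
      (usupp vs τ).card + y ≤ ∑ j, (supp vs (τ j)).card) :
    Ex p (fun x => dpoly p u e x ^ 4) ≤ A ^ 4 * quadConst M * invCard V ^ (2 + y) := by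
  set S : Finset (Fin 4 → Finset E) := Fintype.piFinset fun _ =>
    Finset.univ.filter fun γ : Finset E => e ∈ γ with hS
  have e1 : (fun x => dpoly p u e x ^ 4) =
      fun x => ∑ τ ∈ S, (∏ j, u (τ j)) * ∏ j, mono p ((τ j).erase e) x := by
    funext x
    have : dpoly p u e x ^ 4 = ∏ _j : Fin 4, dpoly p u e x := by simp
    rw [this]
    simp only [dpoly]
    rw [Finset.prod_univ_sum]
    exact Finset.sum_congr rfl fun τ _ => Finset.prod_mul_distrib
  set S' := S.filter fun τ => DoublyCovered τ ∧ ∀ j, u (τ j) ≠ 0 with hS'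
  have hmem : ∀ τ ∈ S, ∀ j, e ∈ τ j := by
    intro τ hτ j
    simpa using Fintype.mem_piFinset.1 hτ j
  have e2 : ∑ τ ∈ S, (∏ j, u (τ j)) * Ex p (fun x => ∏ j, mono p ((τ j).erase e) x) =
      ∑ τ ∈ S', (∏ j, u (τ j)) * Ex p (fun x => ∏ j, mono p ((τ j).erase e) x) := by
    refine (Finset.sum_filter_of_ne fun τ hτ hne => ⟨?_, fun j hj => hne ?_⟩).symm
    · by_contra hcov
      simp only [DoublyCovered] at hcov
      push Not at hcov
      obtain ⟨j, g, hg, hi⟩ := hcov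
      -- The erased edge `e` lies in all four sets, so it cannot be the one that is covered once.
      have hge : g ≠ e := by
        rintro rfl
        obtain ⟨i, hij⟩ := exists_ne j
        exact hi i hij (hmem τ hτ i)
      refine hne ?_
      rw [Ex_four_eq_zero p (γ := fun j => (τ j).erase e) (g := g) (i := j)
        (Finset.mem_erase.2 ⟨hge, hg⟩) fun i hij hgi => hi i hij (Finset.mem_of_mem_erase hgi),
        mul_zero]
    · rw [Finset.prod_eq_zero (Finset.mem_univ j) hj, zero_mul]
  rw [e1, Ex_sum]
  simp only [Ex_const_mul]
  rw [e2]
  have e3 : ∀ τ ∈ S', (∏ j, u (τ j)) * Ex p (fun x => ∏ j, mono p ((τ j).erase e) x) ≤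
      A ^ 4 * ∏ j, invCard V ^ (supp vs (τ j)).card := by
    intro τ _
    refine (le_abs_self _).trans ?_
    rw [abs_mul]
    refine (mul_le_of_le_one_right (abs_nonneg _) (abs_Ex_four_le h0 h1 _)).trans ?_
    rw [Finset.abs_prod]
    have : A ^ 4 = ∏ _j : Fin 4, A := by simp
    rw [this, ← Finset.prod_mul_distrib]
    exact Finset.prod_le_prod (fun _ _ => abs_nonneg _) fun j _ => h.abs_le _
  refine (Finset.sum_le_sum e3).trans ?_
  rw [← Finset.mul_sum, mul_assoc]
  refine mul_le_mul_of_nonneg_left ?_ (pow_nonneg h.nonneg 4)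
  have he2 : (2 + y) = (vs e).card + y := by rw [hvs]
  rw [he2]
  have hsub : ∀ τ ∈ S', vs e ⊆ usupp vs τ := fun τ hτ =>
    (vs_subset_supp (hmem τ (Finset.mem_filter.1 hτ).1 0)).trans (supp_subset_usupp τ 0)
  refine sum_quadruples_le hinj S' (fun _ => e) (fun _ => e) id ?_ (vs e) M y hsub hsub hsub ?_ ?_
  · intro τ _ τ' _ hτ
    simpa using hτ
  · exact fun τ hτ j => h.card_le _ ((Finset.mem_filter.1 hτ).2.2 j)
  · exact fun τ hτ => hy τ (Finset.mem_filter.1 hτ).2.1 (hmem τ (Finset.mem_filter.1 hτ).1)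
      (Finset.mem_filter.1 hτ).2.2

/-- Controls either half of the derivative in direction `f` of Σ C_e D_e W. Squaring gives
quadruples with coefficients `u`, `w`, `u`, `w`: `e` joins the first two, `e'` the last two, and `f`
the first and third. This is the configuration `Linked`. -/
lemma Ex_sum_ddpoly_mul_sq_le (h0 : 0 ≤ p) (h1 : p ≤ 1) (hvs : ∀ e, (vs e).card = 2)
    (hinj : Function.Injective vs) {u w : Finset E → ℝ} {A : ℝ} {M : ℕ} (hu : Decay vs u A M)
    (hw : Decay vs w A M) {κ : ℝ} (hκ : |κ| ≤ 1) (f : E) (y : ℕ)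
    (hy : ∀ (τ : Fin 4 → Finset E) (e e' : E), Linked τ e e' f → (u (τ 0) ≠ 0) → (w (τ 1) ≠ 0) →
      (u (τ 2) ≠ 0) → (w (τ 3) ≠ 0) → (usupp vs τ).card + y ≤ ∑ j, (supp vs (τ j)).card) :
    Ex p (fun x => (∑ e with e ≠ f, ddpoly p u e f x *
      (dpolyRest p w e f x + κ * ddpoly p w e f x)) ^ 2) ≤
      A ^ 4 * quadConst M * invCard V ^ (2 + y) := by
  set S : Finset (E × Finset E × Finset E) := Finset.univ.filter fun s =>
    s.1 ≠ f ∧ (s.1 ∈ s.2.1 ∧ f ∈ s.2.1) ∧ s.1 ∈ s.2.2 with hS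
  set c : E × Finset E × Finset E → ℝ := fun s =>
    u s.2.1 * w s.2.2 * (if f ∈ s.2.2 then κ else 1) with hc
  set m : E × Finset E × Finset E → (E → Bool) → ℝ := fun s x =>
    mono p ((s.2.1.erase s.1).erase f) x * mono p ((s.2.2.erase s.1).erase f) x with hm
  have e1 : ∀ x, ∑ e with e ≠ f, ddpoly p u e f x *
      (dpolyRest p w e f x + κ * ddpoly p w e f x) = ∑ s ∈ S, c s * m s x := by
    intro x
    -- The factor `κ` occurs exactly for the sets through `f`, so it becomes a bounded weight.
    have i1 : ∀ e, dpolyRest p w e f x + κ * ddpoly p w e f x = ∑ δ with e ∈ δ,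
        w δ * (if f ∈ δ then κ else 1) * mono p ((δ.erase e).erase f) x := by
      intro e
      rw [dpolyRest, ddpoly, Finset.mul_sum, Finset.sum_filter, Finset.sum_filter,
        Finset.sum_filter, ← Finset.sum_add_distrib]
      refine Finset.sum_congr rfl fun δ _ => ?_
      by_cases h1 : e ∈ δ <;> by_cases h2 : f ∈ δ <;> simp [h1, h2]
      ring
    simp only [i1]
    simp only [ddpoly, Finset.sum_mul_sum]
    rw [hS, Finset.sum_filter, Finset.sum_filter, Fintype.sum_prod_type]
    refine Finset.sum_congr rfl fun e _ => ?_
    rw [Fintype.sum_prod_type]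
    by_cases he : e = f
    · simp [he]
    · rw [if_pos he, Finset.sum_filter]
      refine Finset.sum_congr rfl fun γ _ => ?_
      rw [Finset.sum_filter]
      by_cases hg : e ∈ γ ∧ f ∈ γ
      · rw [if_pos hg]
        refine Finset.sum_congr rfl fun δ _ => ?_
        by_cases hd : e ∈ δ
        · rw [if_pos hd, if_pos (show e ≠ f ∧ (e ∈ γ ∧ f ∈ γ) ∧ e ∈ δ from ⟨he, hg, hd⟩)]
          simp only [hc, hm]
          ring
        · rw [if_neg hd, if_neg (show ¬(e ≠ f ∧ (e ∈ γ ∧ f ∈ γ) ∧ e ∈ δ) from fun h => hd h.2.2)]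
      · rw [if_neg hg]
        exact (Finset.sum_eq_zero fun δ _ => if_neg fun h => hg h.2.1).symm
  set T : (E × Finset E × Finset E) × (E × Finset E × Finset E) → Fin 4 → Finset E :=
    fun q => ![q.1.2.1, q.1.2.2, q.2.2.1, q.2.2.2] with hT
  have e2 : (fun x => (∑ e with e ≠ f, ddpoly p u e f x *
      (dpolyRest p w e f x + κ * ddpoly p w e f x)) ^ 2) =
      fun x => ∑ q ∈ S ×ˢ S, (c q.1 * c q.2) * (m q.1 x * m q.2 x) := by
    funext x
    rw [e1, sq, Finset.sum_mul_sum, ← Finset.sum_product']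
    exact Finset.sum_congr rfl fun q _ => by ring
  have e3 : ∀ q : (E × Finset E × Finset E) × (E × Finset E × Finset E), ∀ x,
      m q.1 x * m q.2 x = ∏ j, mono p (((T q j).erase (![q.1.1, q.1.1, q.2.1, q.2.1] j)).erase f) x := by
    intro q x
    simp [Fin.prod_univ_four, hm, hT]
    ring
  set S' := (S ×ˢ S).filter fun q => Linked (T q) q.1.1 q.2.1 f ∧ (u (T q 0) ≠ 0 ∧ w (T q 1) ≠ 0 ∧
      u (T q 2) ≠ 0 ∧ w (T q 3) ≠ 0) with hS'
  have e4 : ∑ q ∈ S ×ˢ S, (c q.1 * c q.2) * Ex p (fun x => m q.1 x * m q.2 x) =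
      ∑ q ∈ S', (c q.1 * c q.2) * Ex p (fun x => m q.1 x * m q.2 x) := by
    refine (Finset.sum_filter_of_ne fun q hq hne => ⟨?_, ?_, ?_, ?_, ?_⟩).symm
    · obtain ⟨hq1, hq2⟩ := Finset.mem_product.1 hq
      obtain ⟨a1, ⟨a2, a3⟩, a4⟩ := (Finset.mem_filter.1 hq1).2
      obtain ⟨b1, ⟨b2, b3⟩, b4⟩ := (Finset.mem_filter.1 hq2).2
      refine ⟨?_, a2, a4, b2, b4, a3, b3, a1, b1⟩
      by_contra hcov
      simp only [DoublyCovered] at hcov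
      push Not at hcov
      obtain ⟨j, g, hg, hi⟩ := hcov
      refine hne ?_
      -- No erased edge can be singly covered: `f` lies in members 0 and 2, and each of the other
      -- two in two members by construction.
      have hgf : g ≠ f := by
        rintro rfl
        by_cases hj : j = 0
        · subst hj
          exact hi 2 (by decide) b3
        · exact hi 0 (Ne.symm hj) a3
      have hge : g ≠ ![q.1.1, q.1.1, q.2.1, q.2.1] j := by
        intro hge
        fin_cases j
        · exact hi 1 (by decide) (by simp at hge; rw [hge]; exact a4)
        · exact hi 0 (by decide) (by simp at hge; rw [hge]; exact a2)
        · exact hi 3 (by decide) (by simp at hge; rw [hge]; exact b4)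
        · exact hi 2 (by decide) (by simp at hge; rw [hge]; exact b2)
      simp only [e3]
      rw [Ex_four_eq_zero p (g := g) (i := j)
        (γ := fun j => ((T q j).erase (![q.1.1, q.1.1, q.2.1, q.2.1] j)).erase f)
        (Finset.mem_erase.2 ⟨hgf, Finset.mem_erase.2 ⟨hge, hg⟩⟩) fun i hij hgi => hi i hij
          (Finset.mem_of_mem_erase (Finset.mem_of_mem_erase hgi)), mul_zero]
    · intro hz
      exact hne (by simp only [hc]; rw [show u q.1.2.1 = 0 from hz]; ring)
    · intro hz
      exact hne (by simp only [hc]; rw [show w q.1.2.2 = 0 from hz]; ring)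
    · intro hz
      exact hne (by simp only [hc]; rw [show u q.2.2.1 = 0 from hz]; ring)
    · intro hz
      exact hne (by simp only [hc]; rw [show w q.2.2.2 = 0 from hz]; ring)
  rw [e2, Ex_sum]
  simp only [Ex_const_mul]
  rw [e4]
  have hcb : ∀ s, |c s| ≤ A * invCard V ^ (supp vs s.2.1).card *
      (A * invCard V ^ (supp vs s.2.2).card) := by
    intro s
    have hk : |(if f ∈ s.2.2 then κ else 1)| ≤ 1 := by split_ifs <;> simp [hκ]
    simp only [hc]
    rw [abs_mul, abs_mul]
    refine (mul_le_of_le_one_right (by positivity) hk).trans ?_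
    exact mul_le_mul (hu.abs_le _) (hw.abs_le _) (abs_nonneg _)
      ((abs_nonneg _).trans (hu.abs_le _))
  have e5 : ∀ q ∈ S', (c q.1 * c q.2) * Ex p (fun x => m q.1 x * m q.2 x) ≤
      A ^ 4 * ∏ j, invCard V ^ (supp vs (T q j)).card := by
    intro q _
    refine (le_abs_self _).trans ?_
    rw [abs_mul, abs_mul]
    have : |Ex p (fun x => m q.1 x * m q.2 x)| ≤ 1 := by
      simp only [e3]
      exact abs_Ex_four_le h0 h1 _
    refine (mul_le_of_le_one_right (by positivity) this).trans ?_
    refine (mul_le_mul (hcb q.1) (hcb q.2) (abs_nonneg _)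
      ((abs_nonneg _).trans (hcb q.1))).trans (le_of_eq ?_)
    simp only [Fin.prod_univ_four, hT]
    simp
    ring
  refine (Finset.sum_le_sum e5).trans ?_
  rw [← Finset.mul_sum, mul_assoc]
  refine mul_le_mul_of_nonneg_left ?_ (pow_nonneg hu.nonneg 4)
  have hf2 : (2 + y) = (vs f).card + y := by rw [hvs]
  rw [hf2]
  refine sum_quadruples_le hinj S' (fun q => q.1.1) (fun q => q.2.1) T ?_ (vs f) M y ?_ ?_ ?_ ?_ ?_
  · rintro ⟨⟨a, b, c⟩, ⟨a', b', c'⟩⟩ _ ⟨⟨d, e, f⟩, ⟨d', e', f'⟩⟩ _ hq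
    simp [hT] at hq
    simp [hq]
  · exact fun q hq => (vs_subset_supp (Finset.mem_filter.1 hq).2.1.e_mem_zero).trans
      (supp_subset_usupp _ _)
  · exact fun q hq => (vs_subset_supp (Finset.mem_filter.1 hq).2.1.e'_mem_two).trans
      (supp_subset_usupp _ _)
  · exact fun q hq => (vs_subset_supp (Finset.mem_filter.1 hq).2.1.f_mem_zero).trans
      (supp_subset_usupp _ _)
  · intro q hq j
    obtain ⟨-, a0, a1, a2, a3⟩ := Finset.mem_filter.1 hq |>.2
    fin_cases j
    · exact hu.card_le _ a0
    · exact hw.card_le _ a1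
    · exact hu.card_le _ a2
    · exact hw.card_le _ a3
  · intro q hq
    obtain ⟨hl, a0, a1, a2, a3⟩ := Finset.mem_filter.1 hq |>.2
    exact hy _ _ _ hl a0 a1 a2 a3

end Bounds

end EdgeSystem

/-! ### The two Stein terms and the rate for polynomials with decaying coefficients. -/

namespace EdgeSystem

open BiasedCube

variable {E V : Type*} [Fintype E] [Fintype V] [Nonempty V] {vs : E → Finset V} {p : ℝ}

lemma var_bound_nonneg (h0 : 0 ≤ p) (h1 : p ≤ 1) : 0 ≤ p * (1 - p) :=
  mul_nonneg h0 (sub_nonneg.2 h1)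

lemma var_bound_le_one (h0 : 0 ≤ p) (h1 : p ≤ 1) : p * (1 - p) ≤ 1 :=
  mul_le_one₀ h1 (sub_nonneg.2 h1) (by linarith)

/-- Writing one factor of W² as Σ Y_e C_e and integrating by parts identifies the mean with the
second moment of W. -/
lemma Ex_carre_eq_one {u : Finset E → ℝ} (hu0 : u ∅ = 0)
    (hW : Ex p (fun x => poly p u x ^ 2) = 1) :
    p * (1 - p) * Ex p (fun x => ∑ e, dpoly p (divCard u) e x * dpoly p u e x) = 1 := by
  refine Eq.trans ?_ hW
  rw [Ex_sum, Finset.mul_sum]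
  have : (fun x => poly p u x ^ 2) =
      fun x => ∑ e, Y p e x * (dpoly p (divCard u) e x * poly p u x) := by
    funext x
    rw [sq]
    nth_rewrite 1 [poly_eq_sum p hu0]
    rw [Finset.sum_mul]
    exact Finset.sum_congr rfl fun e _ => by ring
  rw [this, Ex_sum]
  refine Finset.sum_congr rfl fun e _ => ?_
  rw [Ex_Y_mul]
  congr 2
  funext x
  rw [D_mul_of_indep (indep_dpoly p _ e), D_poly]

/-- The deviation is centred, so Efron-Stein applies. Each derivative has second moment O(A^4
n^(-2-y)), and summation over at most n² directions removes the 2. The factor 4 comes from splitting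
the derivative into two halves. -/
lemma Ex_carre_deviation_sq_le (h0 : 0 ≤ p) (h1 : p ≤ 1) (hvs : ∀ e, (vs e).card = 2)
    (hinj : Function.Injective vs) {u : Finset E → ℝ} {A : ℝ} {M : ℕ} (hu : Decay vs u A M)
    (hu0 : u ∅ = 0) (hW : Ex p (fun x => poly p u x ^ 2) = 1) (y : ℕ)
    (hy : ∀ (τ : Fin 4 → Finset E) (e e' f : E), Linked τ e e' f → (∀ j, u (τ j) ≠ 0) →
      (usupp vs τ).card + y ≤ ∑ j, (supp vs (τ j)).card) :
    Ex p (fun x => (1 - p * (1 - p) * ∑ e, dpoly p (divCard u) e x * dpoly p u e x) ^ 2) ≤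
      4 * (A ^ 4 * quadConst M * invCard V ^ y) := by
  set σ := p * (1 - p) with hσ
  have hσ0 : 0 ≤ σ := var_bound_nonneg h0 h1
  have hσ1 : σ ≤ 1 := var_bound_le_one h0 h1
  set w := divCard u with hw
  have hwd : Decay vs w A M := hu.divCard
  have hwu : ∀ γ, w γ ≠ 0 → u γ ≠ 0 := fun γ h hz => h (by simp [hw, divCard, hz])
  set U : (E → Bool) → ℝ := fun x => ∑ e, dpoly p w e x * dpoly p u e x with hU
  set β := A ^ 4 * quadConst M * invCard V ^ (2 + y) with hβ
  have hD : ∀ f, Ex p (fun x => D f U x ^ 2) ≤ 4 * β := by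
    intro f
    set Q1 : (E → Bool) → ℝ := fun x => ∑ e with e ≠ f, ddpoly p w e f x *
      (dpolyRest p u e f x + (1 - 2 * p) * ddpoly p u e f x) with hQ1
    set Q2 : (E → Bool) → ℝ := fun x => ∑ e with e ≠ f, ddpoly p u e f x *
      (dpolyRest p w e f x + 0 * ddpoly p w e f x) with hQ2
    have b1 : Ex p (fun x => Q1 x ^ 2) ≤ β :=
      Ex_sum_ddpoly_mul_sq_le h0 h1 hvs hinj hwd hu
        (abs_le.2 ⟨by linarith, by linarith⟩) f y fun τ e e' hl a0 a1 a2 a3 =>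
        hy τ e e' f hl fun j => by fin_cases j; exacts [hwu _ a0, a1, hwu _ a2, a3]
    have b2 : Ex p (fun x => Q2 x ^ 2) ≤ β :=
      Ex_sum_ddpoly_mul_sq_le h0 h1 hvs hinj hu hwd (by simp) f y fun τ e e' hl a0 a1 a2 a3 =>
        hy τ e e' f hl fun j => by fin_cases j; exacts [a0, hwu _ a1, a2, hwu _ a3]
    have hDU : ∀ x, D f U x = Q1 x + Q2 x := by
      intro x
      rw [hU, D_sum, hQ1, hQ2, ← Finset.sum_add_distrib,
        ← Finset.sum_filter_add_sum_filter_not Finset.univ (fun e => e ≠ f)]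
      have hz : ∑ e with ¬ e ≠ f, D f (fun x => dpoly p w e x * dpoly p u e x) x = 0 := by
        refine Finset.sum_eq_zero fun e he => ?_
        have hef : e = f := by simpa using he
        subst hef
        exact ((indep_dpoly p w e).mul (indep_dpoly p u e)).D_eq_zero x
      rw [hz, add_zero]
      exact Finset.sum_congr rfl fun e he =>
        D_dpoly_mul_dpoly p w u (by simpa using he) x
    have : Ex p (fun x => D f U x ^ 2) ≤ Ex p (fun x => 2 * Q1 x ^ 2 + 2 * Q2 x ^ 2) := by
      refine Ex_mono h0 h1 fun x => ?_
      rw [hDU]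
      nlinarith [sq_nonneg (Q1 x - Q2 x)]
    rw [Ex_add, Ex_const_mul, Ex_const_mul] at this
    linarith
  have hmean : σ * Ex p U = 1 := Ex_carre_eq_one hu0 hW
  have hES := efron_stein h0 h1 U
  have e1 : (fun x => (1 - σ * U x) ^ 2) = fun x => σ ^ 2 * (U x - Ex p U) ^ 2 := by
    funext x
    rw [← hmean]
    ring
  have hsum : ∑ f, Ex p (fun x => D f U x ^ 2) ≤ Fintype.card E * (4 * β) := by
    refine (Finset.sum_le_sum fun f _ => hD f).trans ?_
    simp
  have hr : 0 < invCard V := invCard_pos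
  have hA := hu.nonneg
  have hfin : Fintype.card E * (4 * β) ≤ 4 * (A ^ 4 * quadConst M * invCard V ^ y) := by
    have : (Fintype.card E : ℝ) * (4 * β) = (Fintype.card E * invCard V ^ 2) *
        (4 * (A ^ 4 * quadConst M * invCard V ^ y)) := by
      rw [hβ, pow_add]
      ring
    rw [this]
    exact mul_le_of_le_one_left (by positivity) (card_edges_mul_le hvs hinj)
  have hnn : 0 ≤ ∑ f, Ex p (fun x => D f U x ^ 2) :=
    Finset.sum_nonneg fun f _ => Ex_nonneg h0 h1 fun x => sq_nonneg _
  rw [e1, Ex_const_mul]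
  calc σ ^ 2 * Ex p (fun x => (U x - Ex p U) ^ 2)
      ≤ 1 * Ex p (fun x => (U x - Ex p U) ^ 2) :=
        mul_le_mul_of_nonneg_right (pow_le_one₀ hσ0 hσ1) (Ex_nonneg h0 h1 fun x => sq_nonneg _)
    _ ≤ σ * ∑ f, Ex p (fun x => D f U x ^ 2) := by rw [one_mul]; exact hES
    _ ≤ 1 * ∑ f, Ex p (fun x => D f U x ^ 2) := mul_le_mul_of_nonneg_right hσ1 hnn
    _ ≤ _ := by rw [one_mul]; exact hsum.trans hfin

lemma Indep.D_of {e f : E} {G : (E → Bool) → ℝ} (h : Indep f G) : Indep f (D e G) := by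
  intro x b
  simp only [D]
  by_cases hef : e = f
  · subst hef
    simp
  · rw [Function.update_comm (Ne.symm hef), Function.update_comm (Ne.symm hef), h, h]

/-- The second moment of `∑ Y_e G_e` with `G_e` not depending on the coordinate `e`. -/
lemma Ex_divergence_sq_le (h0 : 0 ≤ p) (h1 : p ≤ 1) {G : E → (E → Bool) → ℝ}
    (hG : ∀ e, Indep e (G e)) :
    Ex p (fun x => (∑ e, Y p e x * G e x) ^ 2) ≤
      ∑ e, Ex p (fun x => G e x ^ 2) + ∑ e, ∑ f with f ≠ e, Ex p (fun x => D f (G e) x ^ 2) := by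
  set σ := p * (1 - p) with hσ
  have hσ0 : 0 ≤ σ := var_bound_nonneg h0 h1
  have hσ1 : σ ≤ 1 := var_bound_le_one h0 h1
  have e1 : (fun x => (∑ e, Y p e x * G e x) ^ 2) =
      fun x => ∑ e, ∑ f, (Y p e x * G e x) * (Y p f x * G f x) := by
    funext x
    rw [sq, Finset.sum_mul_sum]
  have hdiag : ∀ e, Ex p (fun x => (Y p e x * G e x) * (Y p e x * G e x)) ≤
      Ex p (fun x => G e x ^ 2) := by
    intro e
    refine Ex_mono h0 h1 fun x => ?_
    have hY : Y p e x ^ 2 ≤ 1 := (sq_le_one_iff_abs_le_one _).2 (abs_Y_le h0 h1 e x)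
    nlinarith [sq_nonneg (G e x), mul_le_mul_of_nonneg_right hY (sq_nonneg (G e x))]
  have hoff : ∀ e f, f ≠ e → Ex p (fun x => (Y p e x * G e x) * (Y p f x * G f x)) ≤
      (Ex p (fun x => D f (G e) x ^ 2) + Ex p (fun x => D e (G f) x ^ 2)) / 2 := by
    intro e f hef
    -- Integrating by parts in `e` and then in `f` turns the off-diagonal term into the expectation
    -- of the product of the two cross derivatives.
    have i1 : Ex p (fun x => (Y p e x * G e x) * (Y p f x * G f x)) =
        σ * Ex p (fun x => Y p f x * (G e x * D e (G f) x)) := by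
      have : (fun x => (Y p e x * G e x) * (Y p f x * G f x)) =
          fun x => Y p e x * ((Y p f x * G e x) * G f x) := by
        funext x
        ring
      rw [this, Ex_Y_mul]
      congr 2
      funext x
      have hi : Indep e (fun x => Y p f x * G e x) := Indep.mul
        (fun x b => Y_update_of_ne p hef x b) (hG e)
      rw [D_mul_of_indep hi]
      ring
    have i2 : Ex p (fun x => Y p f x * (G e x * D e (G f) x)) =
        σ * Ex p (fun x => D e (G f) x * D f (G e) x) := by
      rw [Ex_Y_mul]
      congr 2
      funext x
      rw [← D_mul_of_indep (Indep.D_of (hG f))]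
      simp only [mul_comm]
    have i3 : |Ex p (fun x => D e (G f) x * D f (G e) x)| ≤
        (Ex p (fun x => D f (G e) x ^ 2) + Ex p (fun x => D e (G f) x ^ 2)) / 2 := by
      refine (abs_Ex_le h0 h1 _).trans ?_
      rw [← Ex_add, le_div_iff₀ two_pos, mul_comm, ← Ex_const_mul]
      refine Ex_mono h0 h1 fun x => ?_
      rw [abs_mul]
      nlinarith [sq_nonneg (|D e (G f) x| - |D f (G e) x|), sq_abs (D e (G f) x),
        sq_abs (D f (G e) x)]
    rw [i1, i2, ← mul_assoc]
    refine (le_abs_self _).trans ?_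
    rw [abs_mul, abs_of_nonneg (mul_nonneg hσ0 hσ0)]
    exact (mul_le_of_le_one_left (abs_nonneg _) (mul_le_one₀ hσ1 hσ0 hσ1)).trans i3
  rw [e1, Ex_sum]
  simp only [Ex_sum]
  set a : E → E → ℝ := fun e f => if f ≠ e then Ex p (fun x => D f (G e) x ^ 2) else 0 with ha
  have hb : ∀ e f, Ex p (fun x => (Y p e x * G e x) * (Y p f x * G f x)) ≤
      (if e = f then Ex p (fun x => G e x ^ 2) else 0) + (a e f + a f e) / 2 := by
    intro e f
    by_cases hef : e = f
    · subst hef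
      simpa [ha] using hdiag e
    · simpa [ha, hef, Ne.symm hef] using hoff e f (Ne.symm hef)
  refine (Finset.sum_le_sum fun e _ => Finset.sum_le_sum fun f _ => hb e f).trans (le_of_eq ?_)
  have hsymm : ∑ e, ∑ f, a f e = ∑ e, ∑ f, a e f := Finset.sum_comm
  have hr : ∀ e, ∑ f with f ≠ e, Ex p (fun x => D f (G e) x ^ 2) = ∑ f, a e f := fun e =>
    Finset.sum_filter _ _
  simp only [hr, Finset.sum_add_distrib, ← Finset.sum_div, hsymm]
  simp

lemma abs_apply_update_le {f : E} (G : (E → Bool) → ℝ) (x : E → Bool) (b : Bool) :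
    |G (Function.update x f b)| ≤ |G x| + |D f G x| := by
  have hx : G x = G (Function.update x f (x f)) := by rw [Function.update_eq_self]
  have key : |G (Function.update x f b) - G x| ≤ |D f G x| := by
    rw [hx, D]
    cases x f <;> cases b <;> simp [abs_sub_comm]
  have := abs_sub_abs_le_abs_sub (G (Function.update x f b)) (G x)
  linarith

/-- The absolute value is 1-Lipschitz, so it needs no differentiation. Moving the updated values of
`C` and `B` back to `x` costs `η` each. -/
lemma abs_D_abs_mul_le {f : E} (C B : (E → Bool) → ℝ) (x : E → Bool) {η : ℝ}
    (hC : |D f C x| ≤ η) (hB : |D f B x| ≤ η) :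
    |D f (fun x => |C x| * B x) x| ≤ η * (|B x| + |C x| + 2 * η) := by
  have hη : 0 ≤ η := (abs_nonneg _).trans hC
  set x1 := Function.update x f true
  set x0 := Function.update x f false
  have e1 : D f (fun x => |C x| * B x) x = |C x1| * D f B x + (|C x1| - |C x0|) * B x0 := by
    simp only [D]
    ring
  have c1 : |C x1| ≤ |C x| + η := (abs_apply_update_le C x true).trans (by linarith)
  have b0 : |B x0| ≤ |B x| + η := (abs_apply_update_le B x false).trans (by linarith)
  have c2 : |(|C x1| - |C x0|)| ≤ η := (abs_abs_sub_abs_le_abs_sub _ _).trans hC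
  rw [e1]
  refine (abs_add_le _ _).trans ?_
  rw [abs_mul, abs_mul, abs_abs]
  have t1 := mul_le_mul c1 hB (abs_nonneg _) (by positivity)
  have t2 := mul_le_mul c2 b0 (abs_nonneg _) hη
  linarith

lemma Ex_sq_le_of_pow_four (h0 : 0 ≤ p) (h1 : p ≤ 1) {G : (E → Bool) → ℝ} {b : ℝ} (hb : 0 ≤ b)
    (h : Ex p (fun x => G x ^ 4) ≤ b ^ 2) : Ex p (fun x => G x ^ 2) ≤ b := by
  have := Ex_abs_le_sqrt h0 h1 (G := fun x => G x ^ 2) (c := b) (by simpa [← pow_mul] using h) hb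
  simpa using this

/-- The diagonal terms are controlled by fourth moments. The off-diagonal ones use pointwise bounds
on second derivatives, where distinct edges cover at least three vertices; 240 = 3 * 80. -/
lemma Ex_divergence_abs_sq_le (h0 : 0 ≤ p) (h1 : p ≤ 1) (hvs : ∀ e, (vs e).card = 2)
    (hinj : Function.Injective vs) {u : Finset E → ℝ} {A b : ℝ} {M : ℕ} (hu : Decay vs u A M)
    (hb : 0 ≤ b) (hb4 : ∀ e, Ex p (fun x => dpoly p u e x ^ 4) ≤ b ^ 2)
    (hb4' : ∀ e, Ex p (fun x => dpoly p (divCard u) e x ^ 4) ≤ b ^ 2) :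
    Ex p (fun x => (∑ e, Y p e x * (|dpoly p (divCard u) e x| * dpoly p u e x)) ^ 2) ≤
      Fintype.card E * b ^ 2 + 240 * (A * quadConst M) ^ 2 * invCard V ^ 3 *
        (2 * b + 4 * (A * quadConst M) ^ 2 * invCard V ^ 6) := by
  set w := divCard u with hw
  set q := A * quadConst M with hq
  set r := invCard V with hr
  have hr0 : 0 < r := invCard_pos
  have hr1 : r ≤ 1 := invCard_le_one
  have hq0 : 0 ≤ q := mul_nonneg hu.nonneg (Nat.cast_nonneg _)
  have hG : ∀ e, Indep e (fun x => |dpoly p w e x| * dpoly p u e x) := fun e =>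
    Indep.mul (fun x c => by rw [indep_dpoly p w e x c]) (indep_dpoly p u e)
  refine (Ex_divergence_sq_le h0 h1 hG).trans (add_le_add ?_ ?_)
  · refine (Finset.sum_le_sum (g := fun _ => b ^ 2) fun e _ => ?_).trans (by simp)
    have : Ex p (fun x => (|dpoly p w e x| * dpoly p u e x) ^ 2) ≤
        Ex p (fun x => (1 / 2) * dpoly p w e x ^ 4 + (1 / 2) * dpoly p u e x ^ 4) := by
      refine Ex_mono h0 h1 fun x => ?_
      rw [mul_pow, sq_abs]
      nlinarith [sq_nonneg (dpoly p w e x ^ 2 - dpoly p u e x ^ 2)]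
    rw [Ex_add, Ex_const_mul, Ex_const_mul] at this
    linarith [hb4 e, hb4' e]
  · have key : ∀ e f, f ≠ e → Ex p (fun x => D f (fun x => |dpoly p w e x| * dpoly p u e x) x ^ 2) ≤
        3 * q ^ 2 * (2 * b + 4 * q ^ 2 * r ^ 6) * (r ^ 3 * r ^ (vs e ∪ vs f).card) := by
      intro e f hfe
      set ρ := r ^ (vs e ∪ vs f).card with hρ
      have hρ0 : 0 < ρ := by positivity
      have hc3 : 3 ≤ (vs e ∪ vs f).card := by
        have := three_le_card_of_ne hvs hinj (γ := {e, f}) (a := e) (b := f) (by simp) (by simp)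
          hfe.symm
        simpa [supp, Finset.biUnion_insert] using this
      have hρ3 : ρ ≤ r ^ 3 := pow_le_pow_of_le_one hr0.le hr1 hc3
      have hd : ∀ x, |D f (dpoly p u e) x| ≤ q * ρ := fun x => by
        rw [D_dpoly p u hfe.symm]
        exact abs_ddpoly_le h0 h1 hinj hu e f x
      have hd' : ∀ x, |D f (dpoly p w e) x| ≤ q * ρ := fun x => by
        rw [D_dpoly p w hfe.symm]
        exact abs_ddpoly_le h0 h1 hinj hu.divCard e f x
      have s1 : Ex p (fun x => D f (fun x => |dpoly p w e x| * dpoly p u e x) x ^ 2) ≤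
          Ex p (fun x => (3 * (q * ρ) ^ 2) * (dpoly p u e x ^ 2 + dpoly p w e x ^ 2)
            + 12 * (q * ρ) ^ 4) := by
        refine Ex_mono h0 h1 fun x => ?_
        have := abs_D_abs_mul_le (dpoly p w e) (dpoly p u e) x (hd' x) (hd x)
        rw [← sq_abs]
        refine (pow_le_pow_left₀ (abs_nonneg _) this 2).trans ?_
        rw [mul_pow, ← sq_abs (dpoly p u e x), ← sq_abs (dpoly p w e x)]
        have h3 : (|dpoly p u e x| + |dpoly p w e x| + 2 * (q * ρ)) ^ 2 ≤
            3 * (|dpoly p u e x| ^ 2 + |dpoly p w e x| ^ 2 + 4 * (q * ρ) ^ 2) := by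
          nlinarith [sq_nonneg (|dpoly p u e x| - |dpoly p w e x|),
            sq_nonneg (|dpoly p u e x| - 2 * (q * ρ)), sq_nonneg (|dpoly p w e x| - 2 * (q * ρ))]
        refine (mul_le_mul_of_nonneg_left h3 (sq_nonneg _)).trans (le_of_eq ?_)
        ring
      rw [Ex_add, Ex_const_mul, Ex_add, Ex_const] at s1
      have u2 := Ex_sq_le_of_pow_four h0 h1 hb (hb4 e)
      have w2 := Ex_sq_le_of_pow_four h0 h1 hb (hb4' e)
      have hρ2 : ρ ^ 2 ≤ r ^ 3 * ρ := by
        rw [sq]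
        exact mul_le_mul_of_nonneg_right hρ3 hρ0.le
      have hρ6 : ρ ^ 2 ≤ r ^ 6 := by
        calc ρ ^ 2 ≤ (r ^ 3) ^ 2 := pow_le_pow_left₀ hρ0.le hρ3 2
          _ = r ^ 6 := by ring
      calc _ ≤ 3 * (q * ρ) ^ 2 * (Ex p (fun x => dpoly p u e x ^ 2)
            + Ex p (fun x => dpoly p w e x ^ 2)) + 12 * (q * ρ) ^ 4 := s1
        _ ≤ 3 * (q * ρ) ^ 2 * (b + b) + 12 * (q * ρ) ^ 4 := by gcongr
        _ = 3 * q ^ 2 * (2 * b + 4 * q ^ 2 * ρ ^ 2) * ρ ^ 2 := by ring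
        _ ≤ 3 * q ^ 2 * (2 * b + 4 * q ^ 2 * r ^ 6) * (r ^ 3 * ρ) := by gcongr
    set κ := 3 * q ^ 2 * (2 * b + 4 * q ^ 2 * r ^ 6) with hκ
    have hκ0 : 0 ≤ κ := by positivity
    have hrow : ∀ e, ∑ f with f ≠ e, Ex p (fun x =>
        D f (fun x => |dpoly p w e x| * dpoly p u e x) x ^ 2) ≤ κ * r ^ 3 * (80 * r ^ 2) := by
      intro e
      calc _ ≤ ∑ f with f ≠ e, κ * (r ^ 3 * r ^ (vs e ∪ vs f).card) :=
            Finset.sum_le_sum fun f hf => key e f (by simpa using hf)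
        _ ≤ ∑ f, κ * (r ^ 3 * r ^ (vs e ∪ vs f).card) :=
            Finset.sum_le_sum_of_subset_of_nonneg (Finset.filter_subset _ _)
              fun _ _ _ => by positivity
        _ = κ * r ^ 3 * ∑ f, r ^ (vs e ∪ vs f).card := by
            rw [Finset.mul_sum]
            exact Finset.sum_congr rfl fun f _ => by ring
        _ ≤ κ * r ^ 3 * (80 * r ^ 2) :=
            mul_le_mul_of_nonneg_left (sum_edges_le hvs hinj e) (by positivity)
    refine (Finset.sum_le_sum fun e _ => hrow e).trans ?_
    rw [Finset.sum_const, nsmul_eq_mul, Finset.card_univ]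
    have hE := card_edges_mul_le hvs hinj
    calc (Fintype.card E : ℝ) * (κ * r ^ 3 * (80 * r ^ 2))
        = (Fintype.card E * r ^ 2) * (80 * κ * r ^ 3) := by ring
      _ ≤ 1 * (80 * κ * r ^ 3) := mul_le_mul_of_nonneg_right hE (by positivity)
      _ = _ := by rw [hκ]; ring

/-- A constant in the normal approximation bound. -/
noncomputable def rateConst (K : ℝ) (M : ℕ) : ℝ := 100 * (K + 1) ^ 2 * (quadConst M + 1) ^ 2

/-- Normal approximation for polynomials whose coefficients decay with the number of vertices. -/
theorem abs_Ex_centredInd_poly_le (h0 : 0 ≤ p) (h1 : p ≤ 1) (hvs : ∀ e, (vs e).card = 2)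
    (hinj : Function.Injective vs) {u : Finset E → ℝ} {A K t : ℝ} {M : ℕ} (hu : Decay vs u A M)
    (hu0 : u ∅ = 0) (hW : Ex p (fun x => poly p u x ^ 2) = 1) (hK : 0 ≤ K) (ht : 0 ≤ t)
    (y y' : ℕ)
    (hy : ∀ (τ : Fin 4 → Finset E) (e e' f : E), Linked τ e e' f → (∀ j, u (τ j) ≠ 0) →
      (usupp vs τ).card + y ≤ ∑ j, (supp vs (τ j)).card)
    (hy' : ∀ (τ : Fin 4 → Finset E) (e : E), DoublyCovered τ → (∀ j, e ∈ τ j) →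
      (∀ j, u (τ j) ≠ 0) → (usupp vs τ).card + y' ≤ ∑ j, (supp vs (τ j)).card)
    (hA : A ^ 2 * invCard V ^ 3 ≤ K ^ 2) (hAt : A ^ 4 * invCard V ^ y ≤ K ^ 4 * t ^ 2)
    (hA4 : A ^ 4 * invCard V ^ (2 + y') ≤ K ^ 4 * invCard V ^ 4) (z : ℝ) :
    |Ex p (fun x => NormalStein.centredInd z (poly p u x))| ≤
      rateConst K M * (t + invCard V) := by
  set r := invCard V with hr
  have hr0 : 0 < r := invCard_pos
  have hr1 : r ≤ 1 := invCard_le_one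
  set Q : ℝ := (quadConst M : ℝ) with hQ
  have hQ0 : 0 ≤ Q := Nat.cast_nonneg _
  have hAn := hu.nonneg
  have hwu : ∀ γ, divCard u γ ≠ 0 → u γ ≠ 0 := fun γ h hz => h (by simp [divCard, hz])
  have hS := abs_Ex_centredInd_le h0 h1 (W := poly p u) (C := dpoly p (divCard u))
    (indep_dpoly p _) (poly_eq_sum p hu0) z
  simp only [D_poly] at hS
  -- Chosen so that `b ^ 2` dominates the fourth moments of both families of derivatives, which
  -- `hA4` makes of order `r ^ 4`.
  set b := K ^ 2 * (Q + 1) * r ^ 2 with hb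
  have hb0 : 0 ≤ b := by positivity
  have hQb : K ^ 4 * r ^ 4 * Q ≤ b ^ 2 := by
    have : b ^ 2 = K ^ 4 * r ^ 4 * (Q + 1) ^ 2 := by rw [hb]; ring
    rw [this]
    exact mul_le_mul_of_nonneg_left (by nlinarith) (by positivity)
  have h4 : ∀ e, Ex p (fun x => dpoly p u e x ^ 4) ≤ b ^ 2 := fun e => by
    refine (Ex_dpoly_pow_four_le h0 h1 hvs hinj hu e y' fun τ hc he hne =>
      hy' τ e hc he hne).trans (le_trans ?_ hQb)
    nlinarith
  have h4' : ∀ e, Ex p (fun x => dpoly p (divCard u) e x ^ 4) ≤ b ^ 2 := fun e => by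
    refine (Ex_dpoly_pow_four_le h0 h1 hvs hinj hu.divCard e y' fun τ hc he hne =>
      hy' τ e hc he fun j => hwu _ (hne j)).trans (le_trans ?_ hQb)
    nlinarith
  have t1 : Ex p (fun x => |1 - p * (1 - p) * ∑ e, dpoly p (divCard u) e x * dpoly p u e x|) ≤
      2 * K ^ 2 * (Q + 1) * t := by
    refine Ex_abs_le_sqrt h0 h1 ((Ex_carre_deviation_sq_le h0 h1 hvs hinj hu hu0 hW y hy).trans ?_)
      (by positivity)
    have : A ^ 4 * Q * r ^ y ≤ K ^ 4 * t ^ 2 * (Q + 1) ^ 2 := by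
      calc A ^ 4 * Q * r ^ y = (A ^ 4 * r ^ y) * Q := by ring
        _ ≤ (K ^ 4 * t ^ 2) * Q := mul_le_mul_of_nonneg_right hAt hQ0
        _ ≤ (K ^ 4 * t ^ 2) * (Q + 1) ^ 2 :=
            mul_le_mul_of_nonneg_left (by nlinarith) (by positivity)
    linarith
  have t2 : Ex p (fun x => |∑ e, Y p e x * (|dpoly p (divCard u) e x| * dpoly p u e x)|) ≤
      40 * (K + 1) ^ 2 * (Q + 1) ^ 2 * r := by
    refine Ex_abs_le_sqrt h0 h1
      ((Ex_divergence_abs_sq_le h0 h1 hvs hinj hu hb0 h4 h4').trans ?_) (by positivity)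
    have hE := card_edges_mul_le hvs hinj
    have c1 : Fintype.card E * b ^ 2 ≤ K ^ 4 * (Q + 1) ^ 2 * r ^ 2 := by
      calc (Fintype.card E : ℝ) * b ^ 2
          = (Fintype.card E * r ^ 2) * (K ^ 4 * (Q + 1) ^ 2 * r ^ 2) := by rw [hb]; ring
        _ ≤ 1 * (K ^ 4 * (Q + 1) ^ 2 * r ^ 2) := mul_le_mul_of_nonneg_right hE (by positivity)
        _ = _ := one_mul _
    have c2 : (A * Q) ^ 2 * r ^ 3 ≤ K ^ 2 * Q ^ 2 := by
      calc (A * Q) ^ 2 * r ^ 3 = (A ^ 2 * r ^ 3) * Q ^ 2 := by ring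
        _ ≤ _ := mul_le_mul_of_nonneg_right hA (sq_nonneg _)
    have c3 : 2 * b + 4 * (A * Q) ^ 2 * r ^ 6 ≤ (2 * K ^ 2 * (Q + 1) + 4 * (K ^ 2 * Q ^ 2)) * r ^ 2 := by
      have : (A * Q) ^ 2 * r ^ 6 ≤ K ^ 2 * Q ^ 2 * r ^ 2 := by
        calc (A * Q) ^ 2 * r ^ 6 = ((A * Q) ^ 2 * r ^ 3) * r ^ 3 := by ring
          _ ≤ (K ^ 2 * Q ^ 2) * r ^ 2 := mul_le_mul c2
            (pow_le_pow_of_le_one hr0.le hr1 (by norm_num)) (by positivity) (by positivity)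
      rw [hb]
      linarith
    have c4 : 240 * (A * Q) ^ 2 * r ^ 3 * (2 * b + 4 * (A * Q) ^ 2 * r ^ 6) ≤
        240 * (K ^ 2 * Q ^ 2) * ((2 * K ^ 2 * (Q + 1) + 4 * (K ^ 2 * Q ^ 2)) * r ^ 2) := by
      rw [mul_assoc 240, mul_assoc 240, mul_assoc 240]
      refine mul_le_mul_of_nonneg_left ?_ (by norm_num)
      exact mul_le_mul c2 c3 (by positivity) (by positivity)
    have hK4 : K ^ 4 ≤ (K + 1) ^ 4 := pow_le_pow_left₀ hK (by linarith) 4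
    have hQ2 : (Q + 1) ^ 2 ≤ (Q + 1) ^ 4 := pow_le_pow_right₀ (by linarith) (by norm_num)
    have hQ3 : Q ^ 2 * (Q + 1) ≤ (Q + 1) ^ 4 := by
      calc Q ^ 2 * (Q + 1) ≤ (Q + 1) ^ 2 * (Q + 1) := by gcongr; linarith
        _ = (Q + 1) ^ 3 := by ring
        _ ≤ (Q + 1) ^ 4 := pow_le_pow_right₀ (by linarith) (by norm_num)
    have hQ4 : Q ^ 4 ≤ (Q + 1) ^ 4 := pow_le_pow_left₀ hQ0 (by linarith) 4
    calc Fintype.card E * b ^ 2 +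
          240 * (A * Q) ^ 2 * r ^ 3 * (2 * b + 4 * (A * Q) ^ 2 * r ^ 6)
        ≤ K ^ 4 * (Q + 1) ^ 2 * r ^ 2 +
          240 * (K ^ 2 * Q ^ 2) * ((2 * K ^ 2 * (Q + 1) + 4 * (K ^ 2 * Q ^ 2)) * r ^ 2) :=
          add_le_add c1 c4
      _ = K ^ 4 * ((Q + 1) ^ 2 + 480 * (Q ^ 2 * (Q + 1)) + 960 * Q ^ 4) * r ^ 2 := by ring
      _ ≤ (K + 1) ^ 4 * ((Q + 1) ^ 4 + 480 * (Q + 1) ^ 4 + 960 * (Q + 1) ^ 4) * r ^ 2 := by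
          gcongr
      -- 1441 = 1 + 480 + 960, rounded up below to 1600 = 40 ^ 2.
      _ = 1441 * ((K + 1) ^ 4 * (Q + 1) ^ 4 * r ^ 2) := by ring
      _ ≤ 1600 * ((K + 1) ^ 4 * (Q + 1) ^ 4 * r ^ 2) :=
          mul_le_mul_of_nonneg_right (by norm_num) (by positivity)
      _ = (40 * (K + 1) ^ 2 * (Q + 1) ^ 2 * r) ^ 2 := by ring
  have hK2 : K ^ 2 ≤ (K + 1) ^ 2 := pow_le_pow_left₀ hK (by linarith) 2
  have hQ1 : Q + 1 ≤ (Q + 1) ^ 2 := by nlinarith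
  have t1' : 2 * K ^ 2 * (Q + 1) * t ≤ rateConst K M * t := by
    rw [rateConst]
    refine mul_le_mul_of_nonneg_right ?_ ht
    have := mul_le_mul hK2 hQ1 (by positivity) (by positivity)
    nlinarith [mul_nonneg (sq_nonneg (K + 1)) (sq_nonneg (Q + 1))]
  have t2' : 2 * (40 * (K + 1) ^ 2 * (Q + 1) ^ 2 * r) ≤ rateConst K M * r := by
    rw [rateConst]
    have : 0 ≤ (K + 1) ^ 2 * (Q + 1) ^ 2 * r := by positivity
    linarith
  linarith

end EdgeSystem

/-! ### From increasing tuples to injective tuples, and counts of embeddings. -/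

namespace InducedCount

section Relabelling

variable {k n : ℕ}

/-- The indicator that the graph on `{0, …, k - 1}` induced by `α` is `F`. -/
noncomputable def labelled (F : SimpleGraph (Fin k)) (G : SimpleGraph (Fin n))
    (α : Fin k ↪ Fin n) : ℝ := if G.comap α = F then 1 else 0

lemma prod_edgeInd_eq (H : SimpleGraph (Fin k)) (G : SimpleGraph (Fin n)) (α : Fin k → Fin n) :
    (∏ e : Fin k × Fin k with e.1 < e.2 ∧ H.Adj e.1 e.2, edgeInd G (α e.1) (α e.2)) *
      (∏ e : Fin k × Fin k with e.1 < e.2 ∧ ¬ H.Adj e.1 e.2, (1 - edgeInd G (α e.1) (α e.2))) =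
      if G.comap α = H then 1 else 0 := by
  split_ifs with h
  · subst h
    rw [Finset.prod_eq_one, Finset.prod_eq_one, one_mul]
    · intro e he
      have := (Finset.mem_filter.1 he).2.2
      simp only [SimpleGraph.comap_adj] at this
      simp [edgeInd, this]
    · intro e he
      have := (Finset.mem_filter.1 he).2.2
      simp only [SimpleGraph.comap_adj] at this
      simp [edgeInd, this]
  · have : ∃ i j : Fin k, i < j ∧ ¬ (G.Adj (α i) (α j) ↔ H.Adj i j) := by
      by_contra hc
      push Not at hc
      refine h (SimpleGraph.ext ?_)
      funext i j
      rcases lt_trichotomy i j with hij | rfl | hij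
      · exact propext (hc i j hij)
      · simp
      · rw [SimpleGraph.comap_adj, G.adj_comm, H.adj_comm]
        exact propext (hc j i hij)
    obtain ⟨i, j, hij, hne⟩ := this
    by_cases hH : H.Adj i j
    · have hG : ¬ G.Adj (α i) (α j) := fun hG => hne ⟨fun _ => hH, fun _ => hG⟩
      rw [Finset.prod_eq_zero (i := (i, j)) (by simp [hij, hH]) (by simp [edgeInd, hG]), zero_mul]
    · have hG : G.Adj (α i) (α j) := by
        by_contra hG
        exact hne ⟨fun h => absurd h hG, fun h => absurd h hH⟩
      rw [mul_comm, Finset.prod_eq_zero (i := (i, j)) (by simp [hij, hH]) (by simp [edgeInd, hG]),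
        zero_mul]

lemma phiInd_eq (F : SimpleGraph (Fin k)) (G : SimpleGraph (Fin n)) (α : Fin k → Fin n) :
    phiInd F (fun i j => edgeInd G (α i) (α j)) =
      if Nonempty (G.comap α ≃g F) then 1 else 0 := by
  simp only [phiInd, prod_edgeInd_eq]
  rw [Finset.sum_ite_eq]
  simp

/-- The number of automorphisms of `F`. -/
noncomputable def numAut (F : SimpleGraph (Fin k)) : ℕ :=
  (Finset.univ.filter fun σ : Equiv.Perm (Fin k) => F.comap σ = F).card

lemma one_le_numAut (F : SimpleGraph (Fin k)) : 1 ≤ numAut F :=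
  Finset.card_pos.2 ⟨1, by
    simp only [Finset.mem_filter, Finset.mem_univ, true_and]
    ext i j
    simp⟩

/-- Composition with one fixed isomorphism maps all of them bijectively onto the automorphisms of
`F`. -/
lemma card_isos (F K : SimpleGraph (Fin k)) :
    (Finset.univ.filter fun σ : Equiv.Perm (Fin k) => K.comap σ = F).card =
      if Nonempty (K ≃g F) then numAut F else 0 := by
  split_ifs with h
  · obtain ⟨φ⟩ := h
    refine Finset.card_bij (fun σ _ => σ.trans φ.toEquiv) ?_ ?_ ?_
    · intro σ hσ
      simp only [Finset.mem_filter, Finset.mem_univ, true_and] at hσ ⊢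
      have hadj : ∀ i j, F.Adj i j ↔ K.Adj (σ i) (σ j) := fun i j => by
        rw [← hσ]
        rfl
      ext i j
      exact (φ.map_adj_iff (v := σ i) (w := σ j)).trans (hadj i j).symm
    · intro σ _ τ _ h
      ext i
      have := congrFun (congrArg DFunLike.coe h) i
      simp only [Equiv.trans_apply] at this
      rw [φ.toEquiv.injective this]
    · intro τ hτ
      simp only [Finset.mem_filter, Finset.mem_univ, true_and] at hτ
      refine ⟨τ.trans φ.toEquiv.symm, ?_, ?_⟩
      · simp only [Finset.mem_filter, Finset.mem_univ, true_and]
        have hadj : ∀ i j, F.Adj i j ↔ F.Adj (τ i) (τ j) := fun i j => by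
          nth_rewrite 1 [← hτ]
          rfl
        ext i j
        exact (φ.symm.map_adj_iff (v := τ i) (w := τ j)).trans (hadj i j).symm
      · ext i
        simp
  · rw [Finset.card_eq_zero, Finset.filter_eq_empty_iff]
    intro σ _ hσ
    refine h ⟨⟨σ.symm, ?_⟩⟩
    intro i j
    rw [← hσ]
    simp

/-- Increasing tuples together with permutations are the same as injective tuples. -/
lemma sum_orderEmb_perm (g : (Fin k ↪ Fin n) → ℝ) :
    ∑ α : Fin k ↪o Fin n, ∑ σ : Equiv.Perm (Fin k), g (σ.toEmbedding.trans α.toEmbedding) =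
      ∑ α : Fin k ↪ Fin n, g α := by
  rw [← Fintype.sum_prod_type']
  refine Function.Bijective.sum_comp
    (e := fun q : (Fin k ↪o Fin n) × Equiv.Perm (Fin k) =>
      q.2.toEmbedding.trans q.1.toEmbedding) ⟨?_, ?_⟩ g
  · rintro ⟨α, σ⟩ ⟨β, τ⟩ h
    have hp : ∀ i, α (σ i) = β (τ i) := fun i => DFunLike.congr_fun h i
    have hr : Set.range α = Set.range β := by
      rw [← σ.surjective.range_comp α, ← τ.surjective.range_comp β]
      exact congrArg Set.range (funext hp)
    obtain rfl := OrderEmbedding.range_inj.1 hr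
    have : σ = τ := Equiv.ext fun i => α.injective (hp i)
    rw [this]
  · intro β
    have hc : (Finset.univ.map β).card = k := by simp
    set α := (Finset.univ.map β).orderEmbOfFin hc
    have hr : Set.range α = Set.range β := by
      rw [Finset.range_orderEmbOfFin]
      simp
    have hex : ∀ i, ∃ j, α j = β i := fun i => by
      have : β i ∈ Set.range α := hr ▸ Set.mem_range_self i
      exact this
    choose s hs using hex
    have hinj : Function.Injective s := fun i j hij => β.injective (by rw [← hs, ← hs, hij])
    refine ⟨(α, Equiv.ofBijective s (Finite.injective_iff_bijective.1 hinj)), ?_⟩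
    ext i
    simp [hs]

/-- An increasing tuple that induces a copy of `F` is counted once for each automorphism. Injective
tuples have the advantage of full symmetry in the vertices. -/
lemma indCount_eq (F : SimpleGraph (Fin k)) (G : SimpleGraph (Fin n)) :
    indCount F G = (numAut F : ℝ)⁻¹ * ∑ α : Fin k ↪ Fin n, labelled F G α := by
  have ha : (numAut F : ℝ) ≠ 0 := Nat.cast_ne_zero.2 (Nat.one_le_iff_ne_zero.1 (one_le_numAut F))
  rw [← sum_orderEmb_perm, indCount, Finset.mul_sum]
  refine Finset.sum_congr rfl fun α _ => ?_
  rw [phiInd_eq]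
  have h := card_isos F (G.comap α)
  have h2 : ∑ σ : Equiv.Perm (Fin k), labelled F G (σ.toEmbedding.trans α.toEmbedding) =
      (Finset.univ.filter fun σ : Equiv.Perm (Fin k) => (G.comap α).comap σ = F).card := by
    simp only [labelled]
    rw [Finset.sum_boole]
    rfl
  rw [h2, h]
  split_ifs
  · rw [inv_mul_cancel₀ ha]
  · simp

end Relabelling

section Embeddings

variable {m k n : ℕ}

/-- The number of embeddings of `k` points whose composition with `ι` is `q`. -/
noncomputable def numExt (ι : Fin m ↪ Fin k) (q : Fin m ↪ Fin n) : ℕ :=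
  (Finset.univ.filter fun α : Fin k ↪ Fin n => ι.trans α = q).card

lemma exists_perm {a : ℕ} (x y : Fin m ↪ Fin a) :
    ∃ g : Equiv.Perm (Fin a), x.trans g.toEmbedding = y := by
  obtain ⟨g, hg⟩ := MulAction.isMultiplyPretransitive_iff.1
    (Equiv.Perm.isMultiplyPretransitive (Fin a) m) x y
  refine ⟨g, ?_⟩
  rw [← hg]
  ext i
  simp

/-- Permutations of the target act transitively on embeddings and carry one fibre of extensions onto
another. -/
lemma numExt_congr_right (ι : Fin m ↪ Fin k) (q q' : Fin m ↪ Fin n) :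
    numExt ι q = numExt ι q' := by
  obtain ⟨g, rfl⟩ := exists_perm q q'
  refine Finset.card_bij (fun α _ => α.trans g.toEmbedding) ?_ ?_ ?_
  · intro α hα
    simp only [Finset.mem_filter, Finset.mem_univ, true_and] at hα ⊢
    rw [← hα]
    rfl
  · intro α _ β _ h
    ext i
    have := DFunLike.congr_fun h i
    simpa using congrArg Fin.val (g.injective this)
  · intro β hβ
    simp only [Finset.mem_filter, Finset.mem_univ, true_and] at hβ
    refine ⟨β.trans g.symm.toEmbedding, ?_, ?_⟩
    · simp only [Finset.mem_filter, Finset.mem_univ, true_and]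
      ext i
      have := DFunLike.congr_fun hβ i
      simp only [Function.Embedding.trans_apply] at this ⊢
      simp [this]
    · ext i
      simp

lemma numExt_congr_left (ι ι' : Fin m ↪ Fin k) (q : Fin m ↪ Fin n) :
    numExt ι q = numExt ι' q := by
  obtain ⟨g, rfl⟩ := exists_perm ι' ι
  refine Finset.card_bij (fun α _ => g.toEmbedding.trans α) ?_ ?_ ?_
  · intro α hα
    simp only [Finset.mem_filter, Finset.mem_univ, true_and] at hα ⊢
    rw [← hα]
    rfl
  · intro α _ β _ h
    ext i
    have := DFunLike.congr_fun h (g.symm i)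
    simpa using congrArg Fin.val this
  · intro β hβ
    simp only [Finset.mem_filter, Finset.mem_univ, true_and] at hβ
    refine ⟨g.symm.toEmbedding.trans β, ?_, ?_⟩
    · simp only [Finset.mem_filter, Finset.mem_univ, true_and]
      rw [← hβ]
      ext i
      simp
    · ext i
      simp

lemma numExt_mul (ι : Fin m ↪ Fin k) (q : Fin m ↪ Fin n) :
    n.descFactorial m * numExt ι q = n.descFactorial k := by
  have h1 : ∑ q' : Fin m ↪ Fin n, numExt ι q' = Fintype.card (Fin k ↪ Fin n) := by
    rw [← Finset.card_univ, Finset.card_eq_sum_card_fiberwise (f := fun α => ι.trans α)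
      (t := Finset.univ) (by simp)]
    rfl
  rw [Finset.sum_congr rfl fun q' _ => numExt_congr_right ι q' q, Finset.sum_const,
    Finset.card_univ, Fintype.card_embedding_eq, Fintype.card_embedding_eq] at h1
  simpa using h1

/-- Each factor of the falling factorial is at least n + 1 - k, and n ≤ k (n + 1 - k). -/
lemma pow_le_mul_descFactorial {k n : ℕ} (h : k ≤ n) : n ^ k ≤ k ^ k * n.descFactorial k := by
  rcases Nat.eq_zero_or_pos k with rfl | hk
  · simp
  calc n ^ k ≤ (k * (n + 1 - k)) ^ k := by
        refine Nat.pow_le_pow_left ?_ k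
        obtain ⟨d, rfl⟩ := Nat.exists_eq_add_of_le h
        have : k + d + 1 - k = d + 1 := by omega
        rw [this]
        nlinarith
    _ = k ^ k * (n + 1 - k) ^ k := by rw [mul_pow]
    _ ≤ k ^ k * n.descFactorial k := Nat.mul_le_mul_left _ (Nat.pow_sub_le_descFactorial n k)

lemma pow_le_mul_numExt (h : k ≤ n) (ι : Fin m ↪ Fin k) (q : Fin m ↪ Fin n) :
    n ^ k ≤ k ^ k * (n ^ m * numExt ι q) := by
  refine (pow_le_mul_descFactorial h).trans (Nat.mul_le_mul_left _ ?_)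
  rw [← numExt_mul ι q]
  exact Nat.mul_le_mul_right _ (Nat.descFactorial_le_pow n m)

/-- The number of embeddings of `k` points whose range contains a given set. -/
lemma card_embeddings_range_superset_le [Nonempty (Fin n)] (A : Finset (Fin n)) :
    ((Finset.univ.filter fun α : Fin k ↪ Fin n => A ⊆ Finset.univ.map α).card : ℝ) ≤
      (k : ℝ) ^ k * ((n : ℝ) ^ k * EdgeSystem.invCard (Fin n) ^ A.card) := by
  have hn : (n : ℝ) * EdgeSystem.invCard (Fin n) = 1 := by
    simpa using EdgeSystem.card_mul_invCard (V := Fin n)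
  by_cases hA : A.card ≤ k
  · set T := Finset.univ.filter fun U : Finset (Fin n) => A ⊆ U ∧ U.card = A.card + (k - A.card)
      with hT
    have h1 : (Finset.univ.filter fun α : Fin k ↪ Fin n => A ⊆ Finset.univ.map α).card ≤
        T.card * k ^ k := by
      rw [Finset.card_eq_sum_card_fiberwise (f := fun α : Fin k ↪ Fin n => Finset.univ.map α)
        (t := T)]
      · rw [← smul_eq_mul, ← Finset.sum_const]
        refine Finset.sum_le_sum fun U hU => ?_
        have hUk : U.card = k := by
          have := (Finset.mem_filter.1 hU).2.2
          omega
        have : (Fintype.piFinset fun _ : Fin k => U).card = k ^ k := by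
          rw [Fintype.card_piFinset_const, hUk]
        rw [← this]
        refine Finset.card_le_card_of_injOn (fun α i => α i) ?_ ?_
        · intro α hα
          have hα2 := (Finset.mem_filter.1 hα).2
          simp only [Finset.mem_coe, Fintype.mem_piFinset]
          intro i
          rw [← hα2]
          simp
        · intro α _ β _ h
          exact DFunLike.coe_injective h
      · intro α hα
        have := (Finset.mem_filter.1 hα).2
        simp only [hT, Finset.coe_filter, Finset.mem_univ, true_and, Set.mem_ofPred_eq]
        exact ⟨this, by simp; omega⟩
    have h2 : T.card ≤ n ^ (k - A.card) := by
      have := EdgeSystem.card_supersets_le A (k - A.card)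
      rw [Fintype.card_fin] at this
      convert this
    have h3 : ((n : ℝ) ^ k * EdgeSystem.invCard (Fin n) ^ A.card) = (n : ℝ) ^ (k - A.card) := by
      obtain ⟨d, hd⟩ := Nat.exists_eq_add_of_le' hA
      rw [hd, Nat.add_sub_cancel, pow_add, mul_assoc, ← mul_pow, hn, one_pow, mul_one]
    have h4 : ((T.card * k ^ k : ℕ) : ℝ) ≤ ((n ^ (k - A.card) * k ^ k : ℕ) : ℝ) :=
      Nat.cast_le.2 (Nat.mul_le_mul_right _ h2)
    rw [h3, mul_comm]
    push_cast at h4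
    refine le_trans ?_ h4
    have h5 := Nat.cast_le (α := ℝ) |>.2 h1
    push_cast at h5
    exact h5
  · have : (Finset.univ.filter fun α : Fin k ↪ Fin n => A ⊆ Finset.univ.map α) = ∅ := by
      refine Finset.filter_eq_empty_iff.2 fun α _ h => hA ?_
      simpa using Finset.card_le_card h
    rw [this]
    have := EdgeSystem.invCard_pos (V := Fin n)
    simp only [Finset.card_empty, Nat.cast_zero]
    positivity

end Embeddings

end InducedCount

/-! ### The polynomial expansion of the count and its coefficients. -/

namespace InducedCount

open BiasedCube EdgeSystem

section Edges

/-- The edges of the complete graph on `{0, …, n - 1}`. -/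
def Edge (n : ℕ) : Type := {e : Sym2 (Fin n) // ¬ e.IsDiag}

noncomputable instance (n : ℕ) : Fintype (Edge n) :=
  inferInstanceAs (Fintype {e : Sym2 (Fin n) // ¬ e.IsDiag})

variable {k m n : ℕ}

/-- The edge between two distinct vertices. -/
def Edge.mk (a b : Fin n) (h : a ≠ b) : Edge n := ⟨s(a, b), by simpa using h⟩

/-- The two ends of an edge. -/
noncomputable def Edge.verts (e : Edge n) : Finset (Fin n) := Finset.univ.filter fun v => v ∈ e.1

/-- The action of embeddings on edges. -/
def Edge.map (α : Fin m ↪ Fin n) : Edge m ↪ Edge n where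
  toFun e := ⟨e.1.map α, fun h => e.2 ((Sym2.isDiag_map α.injective).1 h)⟩
  inj' _ _ h := Subtype.ext (α.sym2Map.injective (congrArg Subtype.val h))

lemma Edge.exists_eq_mk (e : Edge n) : ∃ a b h, e = Edge.mk a b h := by
  obtain ⟨e, he⟩ := e
  induction e with
  | h a b => exact ⟨a, b, by simpa using he, rfl⟩

lemma Edge.mk_comm (a b : Fin n) (h : a ≠ b) : Edge.mk a b h = Edge.mk b a h.symm :=
  Subtype.ext Sym2.eq_swap

lemma Edge.map_mk (α : Fin m ↪ Fin n) (a b : Fin m) (h : a ≠ b) :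
    Edge.map α (Edge.mk a b h) = Edge.mk (α a) (α b) (α.injective.ne h) := rfl

lemma Edge.map_trans (ι : Fin m ↪ Fin k) (α : Fin k ↪ Fin n) (e : Edge m) :
    Edge.map (ι.trans α) e = Edge.map α (Edge.map ι e) := by
  obtain ⟨a, b, h, rfl⟩ := e.exists_eq_mk
  rfl

lemma Edge.verts_mk (a b : Fin n) (h : a ≠ b) : (Edge.mk a b h).verts = {a, b} := by
  ext v
  simp [Edge.verts, Edge.mk]

lemma Edge.card_verts (e : Edge n) : e.verts.card = 2 := by
  obtain ⟨a, b, h, rfl⟩ := e.exists_eq_mk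
  rw [Edge.verts_mk, Finset.card_pair h]

lemma Edge.verts_injective : Function.Injective (Edge.verts : Edge n → Finset (Fin n)) := by
  intro e f h
  refine Subtype.ext (Sym2.ext fun v => ?_)
  have := Finset.ext_iff.1 h v
  simpa [Edge.verts] using this

lemma Edge.verts_map (α : Fin m ↪ Fin n) (e : Edge m) :
    (Edge.map α e).verts = e.verts.map α := by
  obtain ⟨a, b, h, rfl⟩ := e.exists_eq_mk
  rw [Edge.map_mk, Edge.verts_mk, Edge.verts_mk, Finset.map_insert, Finset.map_singleton]

lemma Edge.eq_mk_of_mem {e : Edge n} {a b : Fin n} (h : a ≠ b) (ha : a ∈ e.verts)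
    (hb : b ∈ e.verts) : e = Edge.mk a b h := by
  refine Edge.verts_injective (Finset.eq_of_subset_of_card_le ?_ ?_).symm
  · rw [Edge.verts_mk]
    intro v hv
    rcases Finset.mem_insert.1 hv with rfl | hv
    · exact ha
    · rw [Finset.mem_singleton.1 hv]
      exact hb
  · rw [Edge.card_verts, Edge.card_verts]

lemma supp_map (α : Fin m ↪ Fin n) (γ : Finset (Edge m)) :
    supp Edge.verts (γ.map (Edge.map α)) = (supp Edge.verts γ).map α := by
  ext v
  simp only [supp, Finset.mem_biUnion, Finset.mem_map]
  constructor
  · rintro ⟨_, ⟨e, he, rfl⟩, hv⟩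
    rw [Edge.verts_map, Finset.mem_map] at hv
    obtain ⟨w, hw, rfl⟩ := hv
    exact ⟨w, ⟨e, he, hw⟩, rfl⟩
  · rintro ⟨w, ⟨e, he, hw⟩, rfl⟩
    exact ⟨_, ⟨e, he, rfl⟩, by rw [Edge.verts_map]; exact Finset.mem_map_of_mem α hw⟩

/-- The graph with given edge indicators. -/
def toGraph (x : Edge n → Bool) : SimpleGraph (Fin n) where
  Adj a b := ∃ h : a ≠ b, x (Edge.mk a b h) = true
  symm := ⟨fun a b ⟨h, hx⟩ => ⟨h.symm, by rw [← Edge.mk_comm a b h]; exact hx⟩⟩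
  loopless := ⟨fun _ ⟨h, _⟩ => h rfl⟩

lemma toGraph_adj (x : Edge n → Bool) {a b : Fin n} (h : a ≠ b) :
    (toGraph x).Adj a b ↔ x (Edge.mk a b h) = true := ⟨fun ⟨_, hx⟩ => hx, fun hx => ⟨h, hx⟩⟩

lemma mem_edgeSet_toGraph (x : Edge n → Bool) (e : Edge n) :
    e.1 ∈ (toGraph x).edgeSet ↔ x e = true := by
  obtain ⟨a, b, h, rfl⟩ := e.exists_eq_mk
  exact toGraph_adj x h

end Edges

section Coefficients

variable {k m n : ℕ} (F : SimpleGraph (Fin k)) (p : ℝ)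

/-- The centred edge indicator of `F`. -/
noncomputable def centredEdge (e : Edge k) : ℝ := (if e.1 ∈ F.edgeSet then 1 else 0) - p

/-- The expectation of the indicator that an edge has the status prescribed by `F`. -/
noncomputable def edgeMean (e : Edge k) : ℝ := if e.1 ∈ F.edgeSet then p else 1 - p

/-- The sign of the fluctuation of the indicator that an edge has the status prescribed by `F`. -/
noncomputable def edgeSign (e : Edge k) : ℝ := if e.1 ∈ F.edgeSet then 1 else -1

/-- The coefficients of the indicator that a labelled random graph is `F`. -/
noncomputable def patternCoef (β : Finset (Edge k)) : ℝ :=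
  (∏ e ∈ β, edgeSign F e) * ∏ e ∈ Finset.univ \ β, edgeMean F p e

/-- Each affine factor is the indicator that one edge has the status prescribed by `F`. -/
lemma labelled_eq_prod (x : Edge n → Bool) (α : Fin k ↪ Fin n) :
    labelled F (toGraph x) α = ∏ e, (edgeSign F e * Y p (Edge.map α e) x + edgeMean F p e) := by
  have h1 : ∀ e : Edge k, edgeSign F e * Y p (Edge.map α e) x + edgeMean F p e =
      if (e.1 ∈ F.edgeSet ↔ x (Edge.map α e) = true) then 1 else 0 := by
    intro e
    by_cases h : e.1 ∈ F.edgeSet <;> by_cases hx : x (Edge.map α e) = true <;>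
      simp [edgeSign, edgeMean, Y, h, hx]
  simp only [h1, labelled]
  rw [Finset.prod_ite_zero]
  simp only [Finset.mem_univ, forall_true_left, Finset.prod_const_one]
  refine if_congr ⟨?_, ?_⟩ rfl rfl
  · intro h e
    obtain ⟨a, b, hab, rfl⟩ := e.exists_eq_mk
    rw [Edge.map_mk, ← toGraph_adj, ← h]
    rfl
  · intro h
    refine SimpleGraph.ext ?_
    funext a b
    by_cases hab : a = b
    · subst hab
      simp
    · have := h (Edge.mk a b hab)
      rw [Edge.map_mk, ← toGraph_adj] at this
      exact propext this.symm

lemma labelled_eq_sum (x : Edge n → Bool) (α : Fin k ↪ Fin n) :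
    labelled F (toGraph x) α = ∑ β, patternCoef F p β * mono p (β.map (Edge.map α)) x := by
  rw [labelled_eq_prod F p, Finset.prod_add, Finset.powerset_univ]
  refine Finset.sum_congr rfl fun β _ => ?_
  rw [Finset.prod_mul_distrib, mono, Finset.prod_map, patternCoef]
  ring

/-- The coefficients of the induced subgraph count. -/
noncomputable def countCoef (n : ℕ) (γ : Finset (Edge n)) : ℝ :=
  (numAut F : ℝ)⁻¹ * ∑ α : Fin k ↪ Fin n, ∑ β : Finset (Edge k),
    if β.map (Edge.map α) = γ then patternCoef F p β else 0

lemma indCount_toGraph (x : Edge n → Bool) :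
    indCount F (toGraph x) = poly p (countCoef F p n) x := by
  rw [indCount_eq, poly]
  simp only [labelled_eq_sum F p, countCoef, Finset.mul_sum, Finset.sum_mul]
  symm
  rw [Finset.sum_comm]
  refine Finset.sum_congr rfl fun α _ => ?_
  rw [Finset.sum_comm]
  refine Finset.sum_congr rfl fun β _ => ?_
  rw [Finset.sum_eq_single (β.map (Edge.map α))]
  · simp
    ring
  · intro γ _ hγ
    simp [hγ.symm]
  · simp

variable {p}

lemma abs_patternCoef_le (h0 : 0 ≤ p) (h1 : p ≤ 1) (β : Finset (Edge k)) :
    |patternCoef F p β| ≤ 1 := by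
  rw [patternCoef, abs_mul, Finset.abs_prod, Finset.abs_prod]
  refine mul_le_one₀ (Finset.prod_le_one (fun _ _ => abs_nonneg _) fun e _ => ?_)
    (Finset.prod_nonneg fun _ _ => abs_nonneg _)
    (Finset.prod_le_one (fun _ _ => abs_nonneg _) fun e _ => ?_)
  · rw [edgeSign]
    split_ifs <;> simp
  · rw [edgeMean, abs_le]
    split_ifs <;> constructor <;> linarith

lemma sum_patternCoef_eq (α : Fin k ↪ Fin n) (β : Finset (Edge k)) :
    (∑ β' : Finset (Edge k), if β'.map (Edge.map α) = β.map (Edge.map α) then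
      patternCoef F p β' else 0) = patternCoef F p β := by
  rw [Finset.sum_eq_single β]
  · simp
  · intro β' _ h
    exact if_neg fun h' => h (Finset.map_injective _ h')
  · simp

/-- Each `α` contributes through at most one `β`, and only if its range contains the vertices
covered by γ; this fixes that many of the `k` values. -/
lemma abs_countCoef_le [Nonempty (Fin n)] (h0 : 0 ≤ p) (h1 : p ≤ 1) (γ : Finset (Edge n)) :
    |countCoef F p n γ| ≤
      (k : ℝ) ^ k * (n : ℝ) ^ k * invCard (Fin n) ^ (supp Edge.verts γ).card := by
  have hκ : |(numAut F : ℝ)⁻¹| ≤ 1 := by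
    rw [abs_of_nonneg (by positivity)]
    exact inv_le_one_of_one_le₀ (Nat.one_le_cast.2 (one_le_numAut F))
  rw [countCoef, abs_mul]
  refine (mul_le_of_le_one_left (abs_nonneg _) hκ).trans ?_
  refine (Finset.abs_sum_le_sum_abs _ _).trans ?_
  have key : ∀ α : Fin k ↪ Fin n, |∑ β : Finset (Edge k), if β.map (Edge.map α) = γ then
      patternCoef F p β else 0| ≤ if supp Edge.verts γ ⊆ Finset.univ.map α then 1 else 0 := by
    intro α
    by_cases hex : ∃ β : Finset (Edge k), β.map (Edge.map α) = γ
    · obtain ⟨β, rfl⟩ := hex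
      rw [sum_patternCoef_eq, if_pos]
      · exact abs_patternCoef_le F h0 h1 β
      · rw [supp_map]
        exact Finset.map_subset_map.2 (Finset.subset_univ _)
    · rw [Finset.sum_eq_zero fun β _ => if_neg fun h => hex ⟨β, h⟩]
      split_ifs <;> simp
  refine (Finset.sum_le_sum fun α _ => key α).trans ?_
  rw [Finset.sum_boole, mul_assoc]
  exact card_embeddings_range_superset_le _

lemma card_supp_le_of_countCoef_ne_zero {γ : Finset (Edge n)} (h : countCoef F p n γ ≠ 0) :
    (supp Edge.verts γ).card ≤ k := by
  by_contra hc
  refine h ?_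
  rw [countCoef, Finset.sum_eq_zero, mul_zero]
  intro α _
  refine Finset.sum_eq_zero fun β _ => if_neg ?_
  rintro rfl
  refine hc ?_
  rw [supp_map, Finset.card_map]
  simpa using Finset.card_le_univ (supp Edge.verts β)

/-- The sum of the coefficients of `F` over all placements of a pattern. -/
noncomputable def placementSum (p : ℝ) (P : Finset (Edge m)) : ℝ :=
  ∑ ι : Fin m ↪ Fin k, patternCoef F p (P.map (Edge.map ι))

/-- Since `P` has no isolated vertex, any `α` carrying a set onto the copy of `P` has a range
containing that of `q`, so `q` factors through it. Sorting the `α` by the factor `ι` gives fibres of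
common size `N`. -/
lemma countCoef_map {P : Finset (Edge m)} (hP : supp Edge.verts P = Finset.univ)
    (q : Fin m ↪ Fin n) {N : ℕ} (hN : ∀ ι : Fin m ↪ Fin k, numExt ι q = N) :
    countCoef F p n (P.map (Edge.map q)) = (numAut F : ℝ)⁻¹ * (N * placementSum F p P) := by
  rw [countCoef]
  congr 1
  have key : ∀ α : Fin k ↪ Fin n, (∑ β : Finset (Edge k),
      if β.map (Edge.map α) = P.map (Edge.map q) then patternCoef F p β else 0) =
      ∑ ι : Fin m ↪ Fin k, if ι.trans α = q then patternCoef F p (P.map (Edge.map ι)) else 0 := by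
    intro α
    by_cases hex : ∃ ι : Fin m ↪ Fin k, ι.trans α = q
    · obtain ⟨ι, rfl⟩ := hex
      have : P.map (Edge.map (ι.trans α)) = (P.map (Edge.map ι)).map (Edge.map α) := by
        rw [Finset.map_map]
        congr 1
        ext e
        exact Edge.map_trans ι α e
      rw [this, sum_patternCoef_eq, Finset.sum_eq_single ι]
      · simp
      · intro ι' _ hι'
        refine if_neg fun h => hι' ?_
        ext i
        exact congrArg Fin.val (α.injective (DFunLike.congr_fun h i))
      · simp
    · rw [Finset.sum_eq_zero, Finset.sum_eq_zero]
      · exact fun ι _ => if_neg fun h => hex ⟨ι, h⟩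
      · intro β _
        refine if_neg fun h => hex ?_
        have hs := congrArg (supp Edge.verts) h
        rw [supp_map, supp_map, hP] at hs
        have hi : ∀ i, ∃ j, α j = q i := by
          intro i
          have : q i ∈ (supp Edge.verts β).map α := hs ▸ Finset.mem_map_of_mem q (Finset.mem_univ i)
          obtain ⟨j, -, hj⟩ := Finset.mem_map.1 this
          exact ⟨j, hj⟩
        choose s hs using hi
        refine ⟨⟨s, fun i j hij => q.injective (by rw [← hs, ← hs, hij])⟩, ?_⟩
        exact DFunLike.ext _ _ hs
  simp only [key]
  rw [Finset.sum_comm, placementSum, Finset.mul_sum]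
  refine Finset.sum_congr rfl fun ι _ => ?_
  rw [← Finset.sum_filter, Finset.sum_const, nsmul_eq_mul, ← hN ι, numExt]

/-- The probability of `F`. -/
noncomputable def graphProb (p : ℝ) : ℝ := ∏ e, edgeMean F p e

lemma graphProb_pos (h0 : 0 < p) (h1 : p < 1) : 0 < graphProb F p :=
  Finset.prod_pos fun e _ => by
    rw [edgeMean]
    split_ifs <;> linarith

/-- For each edge the sign is the mean times the centred indicator over `p * (1 - p)`. Hence
placement sums become sums of products of centred indicators of `F`. -/
lemma patternCoef_eq (h0 : 0 < p) (h1 : p < 1) (β : Finset (Edge k)) :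
    patternCoef F p β = graphProb F p * ((p * (1 - p))⁻¹ ^ β.card * ∏ e ∈ β, centredEdge F p e) := by
  have h2 : 1 - p ≠ 0 := by linarith
  have hs : ∀ e, edgeSign F e = edgeMean F p e * ((p * (1 - p))⁻¹ * centredEdge F p e) := by
    intro e
    rw [edgeSign, edgeMean, centredEdge]
    split_ifs <;> field_simp
    ring
  rw [patternCoef, Finset.prod_congr rfl fun e _ => hs e, Finset.prod_mul_distrib,
    Finset.prod_mul_distrib, Finset.prod_const, graphProb,
    ← Finset.prod_sdiff (Finset.subset_univ β)]
  ring

lemma placementSum_eq (h0 : 0 < p) (h1 : p < 1) (P : Finset (Edge m)) :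
    placementSum F p P = graphProb F p * (p * (1 - p))⁻¹ ^ P.card *
      ∑ ι : Fin m ↪ Fin k, ∏ e ∈ P, centredEdge F p (Edge.map ι e) := by
  rw [placementSum, Finset.mul_sum]
  refine Finset.sum_congr rfl fun ι _ => ?_
  rw [patternCoef_eq F h0 h1, Finset.card_map, Finset.prod_map, mul_assoc]

end Coefficients

end InducedCount

/-! ### Edges, 2-stars and triangles as sums over embeddings. -/

namespace InducedCount

open BiasedCube EdgeSystem

section Tuples

variable {V : Type*}

/-- The embedding of two points with given images. -/
def embTwo (a b : V) (h : a ≠ b) : Fin 2 ↪ V where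
  toFun := ![a, b]
  inj' i j hij := by
    fin_cases i <;> fin_cases j <;> simp_all

/-- The embedding of three points with given images. -/
def embThree (a b c : V) (hab : a ≠ b) (hac : a ≠ c) (hbc : b ≠ c) : Fin 3 ↪ V where
  toFun := ![a, b, c]
  inj' i j hij := by
    fin_cases i <;> fin_cases j <;> simp_all

variable [Fintype V] [DecidableEq V]

lemma sum_embTwo (g : V → V → ℝ) :
    ∑ ι : Fin 2 ↪ V, g (ι 0) (ι 1) = ∑ t : V × V with t.1 ≠ t.2, g t.1 t.2 := by
  refine Finset.sum_bij (fun ι _ => (ι 0, ι 1)) ?_ ?_ ?_ ?_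
  · intro ι _
    simp
  · intro ι _ κ _ h
    simp only [Prod.mk.injEq] at h
    refine DFunLike.ext _ _ fun i => ?_
    fin_cases i
    exacts [h.1, h.2]
  · rintro ⟨a, b⟩ ht
    exact ⟨embTwo a b (Finset.mem_filter.1 ht).2, Finset.mem_univ _, rfl⟩
  · exact fun _ _ => rfl

lemma sum_embThree (g : V → V → V → ℝ) :
    ∑ ι : Fin 3 ↪ V, g (ι 0) (ι 1) (ι 2) =
      ∑ t : V × V × V with t.1 ≠ t.2.1 ∧ t.1 ≠ t.2.2 ∧ t.2.1 ≠ t.2.2, g t.1 t.2.1 t.2.2 := by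
  refine Finset.sum_bij (fun ι _ => (ι 0, ι 1, ι 2)) ?_ ?_ ?_ ?_
  · intro ι _
    simp
  · intro ι _ κ _ h
    simp only [Prod.mk.injEq] at h
    refine DFunLike.ext _ _ fun i => ?_
    fin_cases i
    exacts [h.1, h.2.1, h.2.2]
  · rintro ⟨a, b, c⟩ ht
    obtain ⟨h1, h2, h3⟩ := (Finset.mem_filter.1 ht).2
    exact ⟨embThree a b c h1 h2 h3, Finset.mem_univ _, rfl⟩
  · exact fun _ _ => rfl

lemma sum_embThree_perm (σ : Equiv.Perm (Fin 3)) (g : (Fin 3 ↪ V) → ℝ) :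
    ∑ ι : Fin 3 ↪ V, g (σ.toEmbedding.trans ι) = ∑ ι : Fin 3 ↪ V, g ι := by
  refine Function.Bijective.sum_comp (e := fun ι : Fin 3 ↪ V => σ.toEmbedding.trans ι) ⟨?_, ?_⟩ g
  · intro ι κ h
    refine DFunLike.ext _ _ fun i => ?_
    simpa using DFunLike.congr_fun h (σ.symm i)
  · intro κ
    refine ⟨σ.symm.toEmbedding.trans κ, DFunLike.ext _ _ fun i => ?_⟩
    simp

end Tuples

section Counts

variable {k : ℕ} (F : SimpleGraph (Fin k))

lemma edgeInd_comm (i j : Fin k) : edgeInd F i j = edgeInd F j i := by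
  simp [edgeInd, F.adj_comm]

lemma sum_edgeInd_two : ∑ ι : Fin 2 ↪ Fin k, edgeInd F (ι 0) (ι 1) = 2 * numEdges F := by
  rw [sum_embTwo (edgeInd F), Finset.sum_filter_of_ne, Fintype.sum_prod_type]
  · have h1 : ∀ i, ∑ j, edgeInd F i j = F.degree i := by
      intro i
      simp only [edgeInd, Finset.sum_boole]
      rw [← SimpleGraph.card_neighborFinset_eq_degree, SimpleGraph.neighborFinset_eq_filter]
    simp only [h1]
    rw [← Nat.cast_sum, SimpleGraph.sum_degrees_eq_twice_card_edges, numEdges]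
    push_cast
    congr!
  · rintro ⟨a, b⟩ _ h hab
    simp only at hab
    subst hab
    simp [edgeInd] at h

lemma card_embTwo : (Fintype.card (Fin 2 ↪ Fin k) : ℝ) = k * (k - 1) := by
  rw [Fintype.card_embedding_eq]
  simp only [Fintype.card_fin, Nat.descFactorial_succ, Nat.descFactorial_zero]
  rcases k with _ | k
  · simp
  · push_cast
    simp
    ring

lemma card_embThree : (Fintype.card (Fin 3 ↪ Fin k) : ℝ) = k * (k - 1) * (k - 2) := by
  rw [Fintype.card_embedding_eq]
  simp only [Fintype.card_fin, Nat.descFactorial_succ, Nat.descFactorial_zero]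
  rcases k with _ | _ | k
  · simp
  · simp
  · push_cast
    simp
    ring

/-- Every choice of the first two points has k - 2 extensions. -/
lemma sum_edgeInd_three :
    ∑ ι : Fin 3 ↪ Fin k, edgeInd F (ι 0) (ι 1) = (k - 2) * (2 * numEdges F) := by
  have h : ∀ q : Fin 2 ↪ Fin k, ((numExt (embTwo (0 : Fin 3) 1 (by decide)) q : ℕ) : ℝ) = k - 2 := by
    intro q
    have hk : 2 ≤ k := by simpa using Fintype.card_le_of_embedding q
    have h1 := numExt_mul (embTwo (0 : Fin 3) 1 (by decide)) q
    rw [Nat.descFactorial_succ k 2, mul_comm] at h1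
    have h2 := Nat.eq_of_mul_eq_mul_right (Nat.descFactorial_pos.2 hk) h1
    rw [h2, Nat.cast_sub hk]
    simp
  rw [← sum_edgeInd_two, Finset.mul_sum, ← Finset.sum_fiberwise_of_maps_to (s := Finset.univ)
    (t := Finset.univ) (g := fun ι : Fin 3 ↪ Fin k => (embTwo (0 : Fin 3) 1 (by decide)).trans ι)
    (fun _ _ => Finset.mem_univ _)]
  refine Finset.sum_congr rfl fun q _ => ?_
  rw [← h q, Finset.sum_congr rfl (g := fun _ => edgeInd F (q 0) (q 1)), Finset.sum_const,
    nsmul_eq_mul, numExt]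
  intro ι hι
  rw [← (Finset.mem_filter.1 hι).2]
  rfl

/-- The two leaves of a 2-star can be ordered in two ways. -/
lemma sum_edgeInd_star :
    ∑ ι : Fin 3 ↪ Fin k, edgeInd F (ι 0) (ι 1) * edgeInd F (ι 0) (ι 2) = 2 * numTwoStars F := by
  rw [sum_embThree fun a b c => edgeInd F a b * edgeInd F a c]
  have h1 : ∀ t : Fin k × Fin k × Fin k, edgeInd F t.1 t.2.1 * edgeInd F t.1 t.2.2 =
      if F.Adj t.1 t.2.1 ∧ F.Adj t.1 t.2.2 then 1 else 0 := by
    intro t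
    simp only [edgeInd]
    split_ifs <;> simp_all
  simp only [h1, Finset.sum_boole, Finset.filter_filter]
  set S := Finset.univ.filter fun t : Fin k × Fin k × Fin k =>
    (t.1 ≠ t.2.1 ∧ t.1 ≠ t.2.2 ∧ t.2.1 ≠ t.2.2) ∧ F.Adj t.1 t.2.1 ∧ F.Adj t.1 t.2.2 with hS
  set T := Finset.univ.filter fun c : Fin k × Finset (Fin k) =>
    c.2.card = 2 ∧ ∀ v ∈ c.2, F.Adj c.1 v with hT
  have h2 : S.card = ∑ c ∈ T, 2 := by
    rw [Finset.card_eq_sum_card_fiberwise (f := fun t => (t.1, ({t.2.1, t.2.2} : Finset (Fin k))))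
      (t := T)]
    · refine Finset.sum_congr rfl ?_
      rintro ⟨c, s⟩ hc
      obtain ⟨hs, hadj⟩ := (Finset.mem_filter.1 hc).2
      obtain ⟨a, b, hab, rfl⟩ := Finset.card_eq_two.1 hs
      have ha := hadj a (by simp)
      have hb := hadj b (by simp)
      have : (S.filter fun t => (t.1, ({t.2.1, t.2.2} : Finset (Fin k))) = (c, {a, b})) =
          {(c, a, b), (c, b, a)} := by
        ext ⟨x, y, z⟩
        simp only [hS, Finset.mem_filter, Finset.mem_univ, true_and, Finset.mem_insert,
          Finset.mem_singleton, Prod.mk.injEq]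
        constructor
        · rintro ⟨⟨⟨-, -, hyz⟩, -⟩, rfl, he⟩
          have hy : y = a ∨ y = b := by
            have : y ∈ ({a, b} : Finset (Fin k)) := he ▸ (by simp)
            simpa using this
          have hz : z = a ∨ z = b := by
            have : z ∈ ({a, b} : Finset (Fin k)) := he ▸ (by simp)
            simpa using this
          rcases hy with rfl | rfl <;> rcases hz with rfl | rfl <;> simp_all
        · rintro (⟨rfl, rfl, rfl⟩ | ⟨rfl, rfl, rfl⟩)
          · exact ⟨⟨⟨ha.ne, hb.ne, hab⟩, ha, hb⟩, rfl, rfl⟩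
          · exact ⟨⟨⟨hb.ne, ha.ne, hab.symm⟩, hb, ha⟩, rfl, Finset.pair_comm _ _⟩
      rw [this, Finset.card_pair]
      simp [hab]
    · rintro ⟨x, y, z⟩ ht
      have ht := (Finset.mem_filter.1 ht).2
      simp only [hT, Finset.coe_filter, Finset.mem_univ, true_and, Set.mem_ofPred_eq]
      refine ⟨Finset.card_pair ht.1.2.2, ?_⟩
      intro v hv
      rcases Finset.mem_insert.1 hv with rfl | hv
      · exact ht.2.1
      · rw [Finset.mem_singleton.1 hv]
        exact ht.2.2
  rw [h2, Finset.sum_const, numTwoStars]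
  rw [smul_eq_mul, mul_comm]
  push_cast
  rfl

/-- Each triangle has six orderings of its vertices. -/
lemma sum_edgeInd_triangle :
    ∑ ι : Fin 3 ↪ Fin k, edgeInd F (ι 0) (ι 1) * edgeInd F (ι 0) (ι 2) * edgeInd F (ι 1) (ι 2) =
      6 * numTriangles F := by
  rw [sum_embThree fun a b c => edgeInd F a b * edgeInd F a c * edgeInd F b c]
  have h1 : ∀ t : Fin k × Fin k × Fin k,
      edgeInd F t.1 t.2.1 * edgeInd F t.1 t.2.2 * edgeInd F t.2.1 t.2.2 =
      if F.Adj t.1 t.2.1 ∧ F.Adj t.1 t.2.2 ∧ F.Adj t.2.1 t.2.2 then 1 else 0 := by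
    intro t
    simp only [edgeInd]
    split_ifs <;> simp_all
  simp only [h1, Finset.sum_boole, Finset.filter_filter]
  set S := Finset.univ.filter fun t : Fin k × Fin k × Fin k =>
    (t.1 ≠ t.2.1 ∧ t.1 ≠ t.2.2 ∧ t.2.1 ≠ t.2.2) ∧
      F.Adj t.1 t.2.1 ∧ F.Adj t.1 t.2.2 ∧ F.Adj t.2.1 t.2.2 with hS
  have h2 : S.card = ∑ c ∈ F.cliqueFinset 3, 6 := by
    rw [Finset.card_eq_sum_card_fiberwise
      (f := fun t => ({t.1, t.2.1, t.2.2} : Finset (Fin k))) (t := F.cliqueFinset 3)]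
    · refine Finset.sum_congr rfl fun s hs => ?_
      rw [SimpleGraph.mem_cliqueFinset_iff, SimpleGraph.is3Clique_iff] at hs
      obtain ⟨a, b, c, hab, hac, hbc, rfl⟩ := hs
      have nab := hab.ne
      have nac := hac.ne
      have nbc := hbc.ne
      have hba := hab.symm
      have hca := hac.symm
      have hcb := hbc.symm
      have : (S.filter fun t => ({t.1, t.2.1, t.2.2} : Finset (Fin k)) = {a, b, c}) =
          {(a, b, c), (a, c, b), (b, a, c), (b, c, a), (c, a, b), (c, b, a)} := by
        ext ⟨x, y, z⟩
        simp only [hS, Finset.mem_filter, Finset.mem_univ, true_and, Finset.mem_insert,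
          Finset.mem_singleton, Prod.mk.injEq]
        constructor
        · rintro ⟨⟨⟨hxy, hxz, hyz⟩, -⟩, he⟩
          have hx : x = a ∨ x = b ∨ x = c := by
            have : x ∈ ({a, b, c} : Finset (Fin k)) := he ▸ (by simp)
            simpa using this
          have hy : y = a ∨ y = b ∨ y = c := by
            have : y ∈ ({a, b, c} : Finset (Fin k)) := he ▸ (by simp)
            simpa using this
          have hz : z = a ∨ z = b ∨ z = c := by
            have : z ∈ ({a, b, c} : Finset (Fin k)) := he ▸ (by simp)
            simpa using this
          clear he
          rcases hx with rfl | rfl | rfl <;> rcases hy with rfl | rfl | rfl <;>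
            rcases hz with rfl | rfl | rfl <;> simp_all
        · rintro (⟨rfl, rfl, rfl⟩ | ⟨rfl, rfl, rfl⟩ | ⟨rfl, rfl, rfl⟩ | ⟨rfl, rfl, rfl⟩ |
            ⟨rfl, rfl, rfl⟩ | ⟨rfl, rfl, rfl⟩)
          all_goals
            refine ⟨⟨⟨?_, ?_, ?_⟩, ?_, ?_, ?_⟩, ?_⟩
            all_goals first | assumption | (symm; assumption) | rfl |
              (ext v; simp only [Finset.mem_insert, Finset.mem_singleton]; tauto)
      rw [this]
      have := nab.symm
      have := nac.symm
      have := nbc.symm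
      rw [Finset.card_insert_of_notMem, Finset.card_insert_of_notMem,
        Finset.card_insert_of_notMem, Finset.card_insert_of_notMem, Finset.card_pair] <;>
        simp_all
    · rintro ⟨x, y, z⟩ ht
      have ht := (Finset.mem_filter.1 ht).2
      simp only [Finset.mem_coe, SimpleGraph.mem_cliqueFinset_iff, SimpleGraph.is3Clique_iff]
      exact ⟨x, y, z, ht.2.1, ht.2.2.1, ht.2.2.2, rfl⟩
  rw [h2, Finset.sum_const, numTriangles, smul_eq_mul, mul_comm]
  push_cast
  congr!

end Counts

end InducedCount

/-! ### Placement sums of the three patterns and the coefficients that vanish. -/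

namespace InducedCount

open BiasedCube EdgeSystem

section Patterns

variable {k n : ℕ} (F : SimpleGraph (Fin k)) {p : ℝ}

/-- The pattern consisting of a single edge. -/
noncomputable def edgePattern : Finset (Edge 2) := {Edge.mk 0 1 (by decide)}

/-- The pattern consisting of two edges with a common vertex. -/
noncomputable def starPattern : Finset (Edge 3) :=
  {Edge.mk 0 1 (by decide), Edge.mk 0 2 (by decide)}

/-- The pattern consisting of the three edges of a triangle. -/
noncomputable def trianglePattern : Finset (Edge 3) :=
  {Edge.mk 0 1 (by decide), Edge.mk 0 2 (by decide), Edge.mk 1 2 (by decide)}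

lemma Edge.mk_inj {a b c d : Fin n} {h : a ≠ b} {h' : c ≠ d} :
    Edge.mk a b h = Edge.mk c d h' ↔ a = c ∧ b = d ∨ a = d ∧ b = c :=
  Subtype.ext_iff.trans Sym2.eq_iff

lemma supp_edgePattern : supp Edge.verts edgePattern = Finset.univ := by
  ext i
  fin_cases i <;> simp [supp, edgePattern, Edge.verts_mk]

lemma supp_starPattern : supp Edge.verts starPattern = Finset.univ := by
  ext i
  fin_cases i <;> simp [supp, starPattern, Edge.verts_mk]

lemma supp_trianglePattern : supp Edge.verts trianglePattern = Finset.univ := by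
  ext i
  fin_cases i <;> simp [supp, trianglePattern, Edge.verts_mk]

lemma centredEdge_mk (a b : Fin k) (h : a ≠ b) :
    centredEdge F p (Edge.mk a b h) = edgeInd F a b - p := rfl

lemma prod_edgePattern (ι : Fin 2 ↪ Fin k) :
    ∏ e ∈ edgePattern, centredEdge F p (Edge.map ι e) = edgeInd F (ι 0) (ι 1) - p := by
  simp [edgePattern, Edge.map_mk, centredEdge_mk]

lemma prod_starPattern (ι : Fin 3 ↪ Fin k) :
    ∏ e ∈ starPattern, centredEdge F p (Edge.map ι e) =
      (edgeInd F (ι 0) (ι 1) - p) * (edgeInd F (ι 0) (ι 2) - p) := by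
  rw [starPattern, Finset.prod_pair (by simp [Edge.mk_inj])]
  simp [Edge.map_mk, centredEdge_mk]

lemma prod_trianglePattern (ι : Fin 3 ↪ Fin k) :
    ∏ e ∈ trianglePattern, centredEdge F p (Edge.map ι e) = (edgeInd F (ι 0) (ι 1) - p) *
      ((edgeInd F (ι 0) (ι 2) - p) * (edgeInd F (ι 1) (ι 2) - p)) := by
  rw [trianglePattern, Finset.prod_insert (by simp [Edge.mk_inj]),
    Finset.prod_pair (by simp [Edge.mk_inj])]
  simp [Edge.map_mk, centredEdge_mk]

lemma sum_const_two (c : ℝ) : ∑ _ι : Fin 2 ↪ Fin k, c = k * (k - 1) * c := by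
  rw [Finset.sum_const, nsmul_eq_mul, Finset.card_univ, card_embTwo]

lemma sum_const_three (c : ℝ) : ∑ _ι : Fin 3 ↪ Fin k, c = k * (k - 1) * (k - 2) * c := by
  rw [Finset.sum_const, nsmul_eq_mul, Finset.card_univ, card_embThree]

lemma sum_edgeInd_zero_two :
    ∑ ι : Fin 3 ↪ Fin k, edgeInd F (ι 0) (ι 2) = (k - 2) * (2 * numEdges F) := by
  rw [← sum_edgeInd_three, ← sum_embThree_perm (Equiv.swap 1 2)]
  rfl

lemma sum_edgeInd_one_two :
    ∑ ι : Fin 3 ↪ Fin k, edgeInd F (ι 1) (ι 2) = (k - 2) * (2 * numEdges F) := by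
  rw [← sum_edgeInd_zero_two, ← sum_embThree_perm (Equiv.swap 0 1)]
  rfl

lemma sum_edgeInd_star_one :
    ∑ ι : Fin 3 ↪ Fin k, edgeInd F (ι 0) (ι 1) * edgeInd F (ι 1) (ι 2) = 2 * numTwoStars F := by
  rw [← sum_edgeInd_star, ← sum_embThree_perm (Equiv.swap 0 1)]
  refine Finset.sum_congr rfl fun ι _ => ?_
  rw [edgeInd_comm F (ι 0) (ι 1)]
  rfl

lemma sum_edgeInd_star_two :
    ∑ ι : Fin 3 ↪ Fin k, edgeInd F (ι 0) (ι 2) * edgeInd F (ι 1) (ι 2) = 2 * numTwoStars F := by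
  rw [← sum_edgeInd_star_one, ← sum_embThree_perm (Equiv.swap 1 2)]
  refine Finset.sum_congr rfl fun ι _ => ?_
  rw [edgeInd_comm F (ι 1) (ι 2)]
  rfl

lemma sum_edgePattern : ∑ ι : Fin 2 ↪ Fin k, ∏ e ∈ edgePattern, centredEdge F p (Edge.map ι e) =
    2 * numEdges F - p * (k * (k - 1)) := by
  simp only [prod_edgePattern, Finset.sum_sub_distrib, sum_edgeInd_two, sum_const_two]
  ring

lemma sum_starPattern : ∑ ι : Fin 3 ↪ Fin k, ∏ e ∈ starPattern, centredEdge F p (Edge.map ι e) =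
    2 * numTwoStars F - 4 * p * (k - 2) * numEdges F + p ^ 2 * (k * (k - 1) * (k - 2)) := by
  have h : ∀ ι : Fin 3 ↪ Fin k, ∏ e ∈ starPattern, centredEdge F p (Edge.map ι e) =
      edgeInd F (ι 0) (ι 1) * edgeInd F (ι 0) (ι 2) - p * edgeInd F (ι 0) (ι 1)
        - p * edgeInd F (ι 0) (ι 2) + p ^ 2 := by
    intro ι
    rw [prod_starPattern]
    ring
  simp only [h, Finset.sum_sub_distrib, Finset.sum_add_distrib, ← Finset.mul_sum, sum_const_three,
    sum_edgeInd_three, sum_edgeInd_zero_two, sum_edgeInd_star]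
  ring

lemma sum_trianglePattern :
    ∑ ι : Fin 3 ↪ Fin k, ∏ e ∈ trianglePattern, centredEdge F p (Edge.map ι e) =
    6 * numTriangles F - 6 * p * numTwoStars F + 6 * p ^ 2 * (k - 2) * numEdges F
      - p ^ 3 * (k * (k - 1) * (k - 2)) := by
  have h : ∀ ι : Fin 3 ↪ Fin k, ∏ e ∈ trianglePattern, centredEdge F p (Edge.map ι e) =
      edgeInd F (ι 0) (ι 1) * edgeInd F (ι 0) (ι 2) * edgeInd F (ι 1) (ι 2)
        - p * (edgeInd F (ι 0) (ι 1) * edgeInd F (ι 0) (ι 2))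
        - p * (edgeInd F (ι 0) (ι 1) * edgeInd F (ι 1) (ι 2))
        - p * (edgeInd F (ι 0) (ι 2) * edgeInd F (ι 1) (ι 2))
        + p ^ 2 * edgeInd F (ι 0) (ι 1) + p ^ 2 * edgeInd F (ι 0) (ι 2)
        + p ^ 2 * edgeInd F (ι 1) (ι 2) - p ^ 3 := by
    intro ι
    rw [prod_trianglePattern]
    ring
  simp only [h, Finset.sum_sub_distrib, Finset.sum_add_distrib, ← Finset.mul_sum, sum_const_three,
    sum_edgeInd_three, sum_edgeInd_zero_two, sum_edgeInd_one_two, sum_edgeInd_star,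
    sum_edgeInd_star_one, sum_edgeInd_star_two, sum_edgeInd_triangle]
  ring

lemma two_mul_choose_two : 2 * (k.choose 2 : ℝ) = k * (k - 1) := by
  have h := Nat.descFactorial_eq_factorial_mul_choose k 2
  rw [← card_embTwo, Fintype.card_embedding_eq, Fintype.card_fin, Fintype.card_fin, h]
  norm_num [Nat.factorial]

lemma six_mul_choose_three : 6 * (k.choose 3 : ℝ) = k * (k - 1) * (k - 2) := by
  have h := Nat.descFactorial_eq_factorial_mul_choose k 3
  rw [← card_embThree, Fintype.card_embedding_eq, Fintype.card_fin, Fintype.card_fin, h]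
  norm_num [Nat.factorial]

lemma placementSum_edgePattern_eq_zero_iff (h0 : 0 < p) (h1 : p < 1) :
    placementSum F p edgePattern = 0 ↔ (numEdges F : ℝ) = p * (k.choose 2 : ℝ) := by
  have hg := (graphProb_pos F h0 h1).ne'
  have hp : (p * (1 - p))⁻¹ ^ edgePattern.card ≠ 0 :=
    pow_ne_zero _ (inv_ne_zero (mul_pos h0 (by linarith)).ne')
  rw [placementSum_eq F h0 h1, mul_eq_zero, or_iff_right (mul_ne_zero hg hp), sum_edgePattern,
    ← two_mul_choose_two]
  constructor <;> intro h <;> linarith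

lemma placementSum_starPattern_eq_zero_iff (h0 : 0 < p) (h1 : p < 1)
    (he : (numEdges F : ℝ) = p * (k.choose 2 : ℝ)) :
    placementSum F p starPattern = 0 ↔ (numTwoStars F : ℝ) = 3 * p ^ 2 * (k.choose 3 : ℝ) := by
  have hg := (graphProb_pos F h0 h1).ne'
  have hp : (p * (1 - p))⁻¹ ^ starPattern.card ≠ 0 :=
    pow_ne_zero _ (inv_ne_zero (mul_pos h0 (by linarith)).ne')
  have h2 := two_mul_choose_two (k := k)
  have h3 := six_mul_choose_three (k := k)
  -- Under the edge equality, the lower-order terms of the centred product merge into the constant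
  -- -6 p² binom(k, 3).
  have h : 2 * (numTwoStars F : ℝ) - 4 * p * (k - 2) * numEdges F + p ^ 2 * (k * (k - 1) * (k - 2))
      = 2 * (numTwoStars F - 3 * p ^ 2 * k.choose 3) := by
    rw [he]
    linear_combination (-2 * p ^ 2 * (k - 2)) * h2 + p ^ 2 * h3
  rw [placementSum_eq F h0 h1, mul_eq_zero, or_iff_right (mul_ne_zero hg hp), sum_starPattern, h]
  constructor <;> intro h <;> linarith

lemma placementSum_trianglePattern_eq_zero_iff (h0 : 0 < p) (h1 : p < 1)
    (he : (numEdges F : ℝ) = p * (k.choose 2 : ℝ))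
    (hs : (numTwoStars F : ℝ) = 3 * p ^ 2 * (k.choose 3 : ℝ)) :
    placementSum F p trianglePattern = 0 ↔ (numTriangles F : ℝ) = p ^ 3 * (k.choose 3 : ℝ) := by
  have hg := (graphProb_pos F h0 h1).ne'
  have hp : (p * (1 - p))⁻¹ ^ trianglePattern.card ≠ 0 :=
    pow_ne_zero _ (inv_ne_zero (mul_pos h0 (by linarith)).ne')
  have h2 := two_mul_choose_two (k := k)
  have h3 := six_mul_choose_three (k := k)
  -- The edge and 2-star equalities reduce everything but the triangle count to -6 p³ binom(k, 3).
  have h : 6 * (numTriangles F : ℝ) - 6 * p * numTwoStars F + 6 * p ^ 2 * (k - 2) * numEdges F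
      - p ^ 3 * (k * (k - 1) * (k - 2)) = 6 * (numTriangles F - p ^ 3 * k.choose 3) := by
    rw [he, hs]
    linear_combination (3 * p ^ 3 * (k - 2)) * h2 - 2 * p ^ 3 * h3
  rw [placementSum_eq F h0 h1, mul_eq_zero, or_iff_right (mul_ne_zero hg hp), sum_trianglePattern,
    h]
  constructor <;> intro h <;> linarith

lemma countCoef_map_eq_zero {m : ℕ} {P : Finset (Edge m)} (hP : supp Edge.verts P = Finset.univ)
    (hS : placementSum F p P = 0) (q : Fin m ↪ Fin n) :
    countCoef F p n (P.map (Edge.map q)) = 0 := by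
  by_cases hι : Nonempty (Fin m ↪ Fin k)
  · obtain ⟨ι₀⟩ := hι
    rw [countCoef_map F hP q fun ι => numExt_congr_left ι ι₀ q, hS, mul_zero, mul_zero]
  · rw [countCoef_map F hP q (N := 0) fun ι => (hι ⟨ι⟩).elim, hS, mul_zero, mul_zero]

lemma exists_map_edgePattern {γ : Finset (Edge n)} (h : (supp Edge.verts γ).card = 2) :
    ∃ q : Fin 2 ↪ Fin n, γ = edgePattern.map (Edge.map q) := by
  obtain ⟨a, b, hab, hs⟩ := Finset.card_eq_two.1 h
  refine ⟨embTwo a b hab, ?_⟩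
  have hγ : ∀ e ∈ γ, e = Edge.mk a b hab := by
    intro e he
    have : e.verts = {a, b} := Finset.eq_of_subset_of_card_le (hs ▸ vs_subset_supp he)
      (by rw [Edge.card_verts, Finset.card_pair hab])
    exact Edge.eq_mk_of_mem hab (by simp [this]) (by simp [this])
  have hne : γ.Nonempty := by
    by_contra hc
    rw [Finset.not_nonempty_iff_eq_empty.1 hc] at h
    simp [supp] at h
  rw [edgePattern, Finset.map_singleton]
  exact Finset.eq_singleton_iff_nonempty_unique_mem.2 ⟨hne, hγ⟩

/-- If `u` and `v` are covered but not joined, every edge of γ contains the third vertex `w`. Both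
`wu` and `wv` occur because `u` and `v` are covered, so γ is the 2-star centred at `w`. -/
lemma exists_map_starPattern {γ : Finset (Edge n)} (h : (supp Edge.verts γ).card = 3)
    (hγ : ¬ IsComplete Edge.verts γ) :
    ∃ q : Fin 3 ↪ Fin n, γ = starPattern.map (Edge.map q) := by
  unfold EdgeSystem.IsComplete at hγ
  push Not at hγ
  obtain ⟨u, hu, v, hv, huv, hno⟩ := hγ
  have hcard : (((supp Edge.verts γ).erase u).erase v).card = 1 := by
    rw [Finset.card_erase_of_mem (Finset.mem_erase.2 ⟨huv.symm, hv⟩), Finset.card_erase_of_mem hu,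
      h]
  obtain ⟨w, hw⟩ := Finset.card_eq_one.1 hcard
  have hmem : ∀ x, x ∈ supp Edge.verts γ → x ≠ v → x ≠ u → x = w := by
    intro x hx hxv hxu
    exact Finset.mem_singleton.1 (hw ▸ Finset.mem_erase.2 ⟨hxv, Finset.mem_erase.2 ⟨hxu, hx⟩⟩)
  have hw' : w ∈ ((supp Edge.verts γ).erase u).erase v := hw ▸ Finset.mem_singleton_self w
  obtain ⟨hwv, hwu⟩ := Finset.mem_erase.1 hw'
  replace hwu := (Finset.mem_erase.1 hwu).1
  have key : ∀ e ∈ γ, (u ∈ e.verts → e = Edge.mk w u hwu) ∧ (v ∈ e.verts → e = Edge.mk w v hwv) ∧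
      (u ∈ e.verts ∨ v ∈ e.verts) := by
    intro e he
    obtain ⟨a, b, hab, rfl⟩ := e.exists_eq_mk
    have ha := hmem a (vs_subset_supp he (by simp [Edge.verts_mk]))
    have hb := hmem b (vs_subset_supp he (by simp [Edge.verts_mk]))
    have hn := hno _ he
    simp only [Edge.verts_mk, Finset.mem_insert, Finset.mem_singleton, Edge.mk_inj] at hn ⊢
    grind
  refine ⟨embThree w u v hwu hwv huv, ?_⟩
  have hmap : starPattern.map (Edge.map (embThree w u v hwu hwv huv)) =
      {Edge.mk w u hwu, Edge.mk w v hwv} := by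
    rw [starPattern, Finset.map_insert, Finset.map_singleton]
    rfl
  rw [hmap]
  ext e
  simp only [Finset.mem_insert, Finset.mem_singleton]
  constructor
  · intro he
    obtain ⟨h1, h2, h3⟩ := key e he
    exact h3.imp h1 h2
  · rintro (rfl | rfl)
    · obtain ⟨g, hg, hug⟩ := exists_edge hu
      exact (key g hg).1 hug ▸ hg
    · obtain ⟨g, hg, hvg⟩ := exists_edge hv
      exact (key g hg).2.1 hvg ▸ hg

/-- A nonempty set covering only two vertices is a single edge, and those coefficients vanish. -/
lemma three_le_card_supp_of_countCoef_ne_zero (hS : placementSum F p edgePattern = 0)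
    {γ : Finset (Edge n)} (h0 : γ ≠ ∅) (h : countCoef F p n γ ≠ 0) :
    3 ≤ (supp Edge.verts γ).card := by
  obtain ⟨e, he⟩ := Finset.nonempty_iff_ne_empty.2 h0
  refine lt_of_le_of_ne (two_le_card_supp Edge.card_verts he) fun h2 => h ?_
  obtain ⟨q, rfl⟩ := exists_map_edgePattern h2.symm
  exact countCoef_map_eq_zero F supp_edgePattern hS q

lemma isComplete_of_countCoef_ne_zero (hS : placementSum F p starPattern = 0)
    {γ : Finset (Edge n)} (h : countCoef F p n γ ≠ 0) (h3 : (supp Edge.verts γ).card = 3) :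
    IsComplete Edge.verts γ := by
  by_contra hc
  obtain ⟨q, rfl⟩ := exists_map_starPattern h3 hc
  exact h (countCoef_map_eq_zero F supp_starPattern hS q)

end Patterns

end InducedCount

/-! ### Lower bound on the variance and the rate on the cube. -/

namespace InducedCount

open BiasedCube EdgeSystem

section Rate

variable {k m n : ℕ} (F : SimpleGraph (Fin k)) (p : ℝ)

/-- The coefficients of the centred induced subgraph count. -/
noncomputable def centredCoef (n : ℕ) (γ : Finset (Edge n)) : ℝ :=
  if γ = ∅ then 0 else countCoef F p n γ

/-- The variance of the induced subgraph count. -/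
noncomputable def countVar (n : ℕ) : ℝ :=
  ∑ γ : Finset (Edge n), centredCoef F p n γ ^ 2 * (p * (1 - p)) ^ γ.card

lemma poly_countCoef (x : Edge n → Bool) :
    poly p (countCoef F p n) x = countCoef F p n ∅ + poly p (centredCoef F p n) x := by
  rw [poly, poly, ← Finset.add_sum_erase _ _ (Finset.mem_univ ∅),
    ← Finset.add_sum_erase _ (fun γ => centredCoef F p n γ * mono p γ x) (Finset.mem_univ ∅)]
  simp only [centredCoef, if_true, zero_mul, zero_add]
  congr 1
  · simp [mono]
  · refine Finset.sum_congr rfl fun γ hγ => ?_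
    rw [if_neg (Finset.ne_of_mem_erase hγ)]

/-- The covered vertices of γ are the range of `q`, so `q` is one of the `m ^ m` maps into that set.
-/
lemma card_maps_eq_le {P : Finset (Edge m)} (hP : supp Edge.verts P = Finset.univ)
    (γ : Finset (Edge n)) :
    (Finset.univ.filter fun q : Fin m ↪ Fin n => P.map (Edge.map q) = γ).card ≤ m ^ m := by
  rcases Finset.eq_empty_or_nonempty
    (Finset.univ.filter fun q : Fin m ↪ Fin n => P.map (Edge.map q) = γ) with h | ⟨q₀, hq₀⟩
  · rw [h]
    simp
  · have hs : ∀ q : Fin m ↪ Fin n, P.map (Edge.map q) = γ →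
        supp Edge.verts γ = Finset.univ.map q := by
      rintro q rfl
      rw [supp_map, hP]
    have hc : (supp Edge.verts γ).card = m := by
      rw [hs q₀ (Finset.mem_filter.1 hq₀).2, Finset.card_map, Finset.card_univ, Fintype.card_fin]
    have hpi : (Fintype.piFinset fun _ : Fin m => supp Edge.verts γ).card = m ^ m := by
      rw [Fintype.card_piFinset_const, hc]
    rw [← hpi]
    refine Finset.card_le_card_of_injOn (fun q => q) ?_ ?_
    · intro q hq
      have hq := (Finset.mem_filter.1 hq).2
      refine Fintype.mem_piFinset.2 fun i => ?_
      rw [hs q hq]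
      exact Finset.mem_map_of_mem q (Finset.mem_univ i)
    · exact fun q _ q' _ h => DFunLike.coe_injective h

variable {p}

lemma sum_maps_le {P : Finset (Edge m)} (hP : supp Edge.verts P = Finset.univ)
    {f : Finset (Edge n) → ℝ} (hf : ∀ γ, 0 ≤ f γ) :
    ∑ q : Fin m ↪ Fin n, f (P.map (Edge.map q)) ≤ (m : ℝ) ^ m * ∑ γ, f γ := by
  rw [← Finset.sum_fiberwise_of_maps_to (s := Finset.univ) (t := Finset.univ)
    (g := fun q : Fin m ↪ Fin n => P.map (Edge.map q)) (fun _ _ => Finset.mem_univ _),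
    Finset.mul_sum]
  refine Finset.sum_le_sum fun γ _ => ?_
  rw [Finset.sum_congr rfl fun q hq => congrArg f (Finset.mem_filter.1 hq).2, Finset.sum_const,
    nsmul_eq_mul]
  refine mul_le_mul_of_nonneg_right ?_ (hf γ)
  exact_mod_cast card_maps_eq_le hP γ

/-- All copies of `P` share one coefficient, of order n^(k-m). There are about n^m embeddings of `P`
and each edge set arises from at most `m ^ m` of them, so by orthogonality the variance is at least
of order n^(2k-m). -/
lemma exists_pow_le_countVar (h0 : 0 < p) (h1 : p < 1) {P : Finset (Edge m)}
    (hP : supp Edge.verts P = Finset.univ) (hP0 : P ≠ ∅) (hS : placementSum F p P ≠ 0) :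
    ∃ L : ℝ, 0 < L ∧ ∀ n, k ≤ n → ((n : ℝ) ^ k) ^ 2 ≤ L * ((n : ℝ) ^ m * countVar F p n) := by
  obtain ⟨ι₀, -, -⟩ := Finset.exists_ne_zero_of_sum_ne_zero (by rw [placementSum] at hS; exact hS)
  have hmk : m ≤ k := by simpa using Fintype.card_le_of_embedding ι₀
  have hτ : 0 < p * (1 - p) := mul_pos h0 (by linarith)
  have hκ : (0 : ℝ) < numAut F := Nat.cast_pos.2 (one_le_numAut F)
  set b : ℝ := ((numAut F : ℝ)⁻¹ * placementSum F p P) ^ 2 * (p * (1 - p)) ^ P.card with hb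
  have hb0 : 0 < b := mul_pos
    (lt_of_le_of_ne (sq_nonneg _) (pow_ne_zero _ (mul_ne_zero (inv_ne_zero hκ.ne') hS)).symm)
    (pow_pos hτ _)
  have hm0 : m ≠ 0 := by
    rintro rfl
    obtain ⟨e, -⟩ := Finset.nonempty_iff_ne_empty.2 hP0
    obtain ⟨a, -⟩ := e.exists_eq_mk
    exact a.elim0
  have hk0 : 0 < k := by omega
  refine ⟨((k : ℝ) ^ k) ^ 2 * ((m : ℝ) ^ m) ^ 2 / b, by positivity, fun n hn => ?_⟩
  have hq₀ : Nonempty (Fin m ↪ Fin n) := ⟨Fin.castLEEmb (hmk.trans hn)⟩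
  obtain ⟨q₀⟩ := hq₀
  set N := numExt ι₀ q₀ with hN
  have hsum : (n.descFactorial m : ℝ) * (N ^ 2 * b) ≤ (m : ℝ) ^ m * countVar F p n := by
    refine le_trans (le_of_eq ?_) (sum_maps_le hP
      (f := fun γ : Finset (Edge n) => centredCoef F p n γ ^ 2 * (p * (1 - p)) ^ γ.card)
      fun γ => by positivity)
    have hterm : ∀ q : Fin m ↪ Fin n, centredCoef F p n (P.map (Edge.map q)) ^ 2 *
        (p * (1 - p)) ^ (P.map (Edge.map q)).card = N ^ 2 * b := by
      intro q
      rw [centredCoef, if_neg (by simpa using hP0), Finset.card_map, countCoef_map F hP q (N := N)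
        fun ι => (numExt_congr_left ι ι₀ q).trans (numExt_congr_right ι₀ q q₀), hb]
      ring
    simp only [hterm, Finset.sum_const, nsmul_eq_mul, Finset.card_univ,
      Fintype.card_embedding_eq, Fintype.card_fin]
  have hN1 : (n : ℝ) ^ k ≤ k ^ k * (n ^ m * N) := by
    exact_mod_cast pow_le_mul_numExt hn ι₀ q₀
  have hD : (n : ℝ) ^ m ≤ m ^ m * n.descFactorial m := by
    exact_mod_cast pow_le_mul_descFactorial (hmk.trans hn)
  rw [div_mul_eq_mul_div, le_div_iff₀ hb0]
  calc ((n : ℝ) ^ k) ^ 2 * b ≤ (k ^ k * (n ^ m * N)) ^ 2 * b := by gcongr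
    _ = (k ^ k) ^ 2 * (n : ℝ) ^ m * (n : ℝ) ^ m * (N ^ 2 * b) := by ring
    _ ≤ (k ^ k) ^ 2 * (n : ℝ) ^ m * (m ^ m * n.descFactorial m) * (N ^ 2 * b) := by gcongr
    _ = (k ^ k) ^ 2 * (n : ℝ) ^ m * m ^ m * (n.descFactorial m * (N ^ 2 * b)) := by ring
    _ ≤ (k ^ k) ^ 2 * (n : ℝ) ^ m * m ^ m * (m ^ m * countVar F p n) := by gcongr
    _ = (k ^ k) ^ 2 * (m ^ m) ^ 2 * (n ^ m * countVar F p n) := by ring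

lemma centredCoef_ne_zero {γ : Finset (Edge n)} (h : centredCoef F p n γ ≠ 0) :
    γ ≠ ∅ ∧ countCoef F p n γ ≠ 0 := by
  rw [centredCoef] at h
  split_ifs at h with h'
  · exact (h rfl).elim
  · exact ⟨h', h⟩

/-- Normal approximation of the induced subgraph count, given a pattern that contributes to the
variance. -/
theorem exists_abs_Ex_centredInd_le (h0 : 0 < p) (h1 : p < 1) {P : Finset (Edge m)}
    (hP : supp Edge.verts P = Finset.univ) (hP0 : P ≠ ∅) (hS : placementSum F p P ≠ 0)
    (hm : m ≤ 3) (t : ℕ → ℝ) (j : ℕ) (ht : ∀ n, 0 ≤ t n)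
    (htj : ∀ n, 0 < n → t n ^ 2 = ((n : ℝ)⁻¹) ^ j)
    (hy : ∀ n, ∀ (τ : Fin 4 → Finset (Edge n)) (e e' f : Edge n), Linked τ e e' f →
      (∀ i, τ i ≠ ∅ ∧ countCoef F p n (τ i) ≠ 0) →
      (usupp Edge.verts τ).card + (2 * m + j) ≤ ∑ i, (supp Edge.verts (τ i)).card)
    (hy' : ∀ n, ∀ (τ : Fin 4 → Finset (Edge n)) (e : Edge n), DoublyCovered τ → (∀ i, e ∈ τ i) →
      (∀ i, τ i ≠ ∅ ∧ countCoef F p n (τ i) ≠ 0) →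
      (usupp Edge.verts τ).card + (2 * m + 2) ≤ ∑ i, (supp Edge.verts (τ i)).card) :
    ∃ C : ℝ, 0 < C ∧ ∀ n, k ≤ n → 0 < n ∧ 0 < countVar F p n ∧ ∀ z,
      |Ex p (fun x : Edge n → Bool => NormalStein.centredInd z
        (poly p (centredCoef F p n) x / √(countVar F p n)))| ≤ C * (t n + (n : ℝ)⁻¹) := by
  obtain ⟨L, hL, hLn⟩ := exists_pow_le_countVar F h0 h1 hP hP0 hS
  have hk0 : 0 < k := by
    obtain ⟨ι₀, -, -⟩ := Finset.exists_ne_zero_of_sum_ne_zero (by rw [placementSum] at hS; exact hS)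
    obtain ⟨e, -⟩ := Finset.nonempty_iff_ne_empty.2 hP0
    obtain ⟨a, -⟩ := e.exists_eq_mk
    exact (ι₀ a).pos
  set K : ℝ := (k : ℝ) ^ k * √L with hK
  have hK0 : 0 ≤ K := by positivity
  refine ⟨rateConst K k, by rw [rateConst]; positivity, fun n hn => ?_⟩
  have hn0 : 0 < n := hk0.trans_le hn
  have hnR : (0 : ℝ) < n := Nat.cast_pos.2 hn0
  have hV : 0 < countVar F p n := by
    have h2 : 0 < L * ((n : ℝ) ^ m * countVar F p n) := lt_of_lt_of_le (by positivity) (hLn n hn)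
    exact pos_of_mul_pos_right (pos_of_mul_pos_right h2 hL.le) (by positivity)
  refine ⟨hn0, hV, fun z => ?_⟩
  have : Nonempty (Fin n) := ⟨⟨0, hn0⟩⟩
  set s := √(countVar F p n) with hs
  have hs0 : 0 < s := Real.sqrt_pos.2 hV
  have hss : s ^ 2 = countVar F p n := Real.sq_sqrt hV.le
  have hr : invCard (Fin n) = (n : ℝ)⁻¹ := by simp [invCard]
  have hr0 : 0 < invCard (Fin n) := invCard_pos
  have hr1 : invCard (Fin n) ≤ 1 := invCard_le_one
  set u : Finset (Edge n) → ℝ := fun γ => centredCoef F p n γ / s with hu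
  -- The coefficient bound divided by the standard deviation; by the variance bound its square is at
  -- most K² n^m.
  set A : ℝ := (k : ℝ) ^ k * (n : ℝ) ^ k / s with hA
  have hpoly : ∀ x, poly p (centredCoef F p n) x / s = poly p u x := by
    intro x
    rw [poly, poly, Finset.sum_div]
    exact Finset.sum_congr rfl fun γ _ => by rw [hu]; ring
  have hne : ∀ γ, u γ ≠ 0 → γ ≠ ∅ ∧ countCoef F p n γ ≠ 0 := fun γ h =>
    centredCoef_ne_zero F (div_ne_zero_iff.1 h).1
  have hdecay : Decay Edge.verts u A k := by
    refine ⟨fun γ => ?_, fun γ h => card_supp_le_of_countCoef_ne_zero F (hne γ h).2⟩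
    rw [hu, hA, abs_div, abs_of_pos hs0, div_mul_eq_mul_div]
    refine div_le_div_of_nonneg_right ?_ hs0.le
    rw [centredCoef]
    split_ifs
    · rw [abs_zero]
      positivity
    · exact abs_countCoef_le F h0.le h1.le γ
  have hAm : A ^ 2 * invCard (Fin n) ^ m ≤ K ^ 2 := by
    rw [hA, hK, mul_pow _ (√L), Real.sq_sqrt hL.le, div_pow, hss, hr, inv_pow,
      ← div_eq_mul_inv, div_div, div_le_iff₀ (by positivity), mul_pow]
    calc ((k : ℝ) ^ k) ^ 2 * ((n : ℝ) ^ k) ^ 2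
        ≤ ((k : ℝ) ^ k) ^ 2 * (L * ((n : ℝ) ^ m * countVar F p n)) := by gcongr; exact hLn n hn
      _ = _ := by ring
  have hA0 : 0 ≤ A := by positivity
  have hA4 : ∀ i : ℕ, A ^ 4 * invCard (Fin n) ^ (2 * m + i) ≤ K ^ 4 * invCard (Fin n) ^ i := by
    intro i
    calc A ^ 4 * invCard (Fin n) ^ (2 * m + i)
        = (A ^ 2 * invCard (Fin n) ^ m) ^ 2 * invCard (Fin n) ^ i := by ring
      _ ≤ (K ^ 2) ^ 2 * invCard (Fin n) ^ i := by gcongr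
      _ = _ := by ring
  simp only [hpoly]
  rw [← hr]
  refine abs_Ex_centredInd_poly_le h0.le h1.le Edge.card_verts Edge.verts_injective hdecay
    (by simp [hu, centredCoef]) ?_ hK0 (ht n) (2 * m + j) (2 * m + 2)
    (fun τ e e' f h hτ => hy n τ e e' f h fun i => hne _ (hτ i))
    (fun τ e h he hτ => hy' n τ e h he fun i => hne _ (hτ i)) ?_ ?_ ?_ z
  · rw [Ex_poly_sq]
    simp only [hu, div_pow, hss, div_mul_eq_mul_div]
    rw [← Finset.sum_div]
    exact div_self hV.ne'
  · refine le_trans ?_ hAm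
    exact mul_le_mul_of_nonneg_left (pow_le_pow_of_le_one hr0.le hr1 hm) (by positivity)
  · rw [htj n hn0, ← hr]
    exact hA4 j
  · rw [show 2 + (2 * m + 2) = 2 * m + 4 by ring]
    exact hA4 4

end Rate

end InducedCount

/-! ### Transfer between the cube and the binomial random graph. -/

namespace InducedCount

open BiasedCube EdgeSystem

section RandomGraph

variable {k n : ℕ}

instance : MeasurableSingletonClass (SimpleGraph (Fin n)) where
  measurableSet_singleton G := by
    have h : ({G} : Set (SimpleGraph (Fin n))) = SimpleGraph.edgeSet ⁻¹' {G.edgeSet} := by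
      ext H
      simp
    rw [h]
    exact SimpleGraph.measurable_edgeSet (measurableSet_singleton _)

lemma toGraph_bijective : Function.Bijective (toGraph : (Edge n → Bool) → SimpleGraph (Fin n)) := by
  constructor
  · intro x y h
    funext e
    rw [Bool.eq_iff_iff, ← mem_edgeSet_toGraph, ← mem_edgeSet_toGraph, h]
  · intro G
    refine ⟨fun e => decide (e.1 ∈ G.edgeSet), ?_⟩
    ext a b
    by_cases h : a = b
    · subst h
      simp
    · rw [toGraph_adj _ h, decide_eq_true_iff]
      rfl

lemma card_edge : Fintype.card (Edge n) = n.choose 2 := by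
  have h := Sym2.card_diagSet_compl (α := Fin n)
  rw [Fintype.card_fin] at h
  rw [← h]
  exact Fintype.card_congr (Equiv.subtypeEquivRight fun e => by simp)

lemma ncard_edgeSet_toGraph (x : Edge n → Bool) :
    (toGraph x).edgeSet.ncard = (Finset.univ.filter fun e => x e = true).card := by
  rw [← Set.ncard_coe_finset]
  refine Eq.trans ?_ (Set.ncard_image_of_injective _ Subtype.val_injective)
  congr 1
  ext e
  constructor
  · intro he
    have hd : ¬ e.IsDiag := SimpleGraph.not_isDiag_of_mem_edgeSet _ he
    refine ⟨⟨e, hd⟩, ?_, rfl⟩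
    exact Finset.mem_coe.2 (Finset.mem_filter.2
      ⟨Finset.mem_univ _, (mem_edgeSet_toGraph x ⟨e, hd⟩).1 he⟩)
  · rintro ⟨e, he, rfl⟩
    exact (mem_edgeSet_toGraph x e).2 (Finset.mem_filter.1 he).2

lemma wt_eq (p : ℝ) (x : Edge n → Bool) :
    wt p x = p ^ (toGraph x).edgeSet.ncard *
      (1 - p) ^ (n.choose 2 - (toGraph x).edgeSet.ncard) := by
  rw [wt, Finset.prod_ite, Finset.prod_const, Finset.prod_const, ncard_edgeSet_toGraph]
  congr 2
  rw [← card_edge, ← Finset.card_univ,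
    ← Finset.card_filter_add_card_filter_not (s := (Finset.univ : Finset (Edge n)))
      (fun e => x e = true), Nat.add_sub_cancel_left]

lemma integral_binomialRandom (p : unitInterval) (f : SimpleGraph (Fin n) → ℝ) :
    ∫ G, f G ∂(SimpleGraph.binomialRandom (Fin n) p) = Ex (p : ℝ) fun x => f (toGraph x) := by
  rw [integral_fintype (.of_finite), Ex, ← Function.Bijective.sum_comp toGraph_bijective]
  refine Finset.sum_congr rfl fun x _ => ?_
  rw [smul_eq_mul, wt_eq, measureReal_def, SimpleGraph.binomialRandom_singleton, Nat.card_fin]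
  simp

variable (F : SimpleGraph (Fin k)) (p : unitInterval)

lemma Ex_mono_eq_zero (q : ℝ) {γ : Finset (Edge n)} (h : γ ≠ ∅) : Ex q (mono q γ) = 0 := by
  have h1 := Ex_mono_mul_mono q γ ∅
  have h2 : ∀ x, mono q γ x * mono q ∅ x = mono q γ x := fun x => by
    rw [mono, mono, Finset.prod_empty, mul_one]
  simpa only [h2, if_neg h] using h1

lemma Ex_poly_centredCoef (q : ℝ) : Ex q (fun x => poly q (centredCoef F q n) x) = 0 := by
  simp only [poly]
  rw [Ex_sum]
  refine Finset.sum_eq_zero fun γ _ => ?_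
  rw [Ex_const_mul]
  by_cases h : γ = ∅
  · rw [centredCoef, if_pos h, zero_mul]
  · rw [Ex_mono_eq_zero q h, mul_zero]

lemma indCount_eq_add (x : Edge n → Bool) :
    indCount F (toGraph x) = countCoef F p n ∅ + poly p (centredCoef F p n) x :=
  (indCount_toGraph F p x).trans (poly_countCoef F p x)

lemma integral_indCount :
    ∫ G, indCount F G ∂(SimpleGraph.binomialRandom (Fin n) p) = countCoef F p n ∅ := by
  rw [integral_binomialRandom]
  simp only [indCount_eq_add F p]
  rw [Ex_add, Ex_const, Ex_poly_centredCoef, add_zero]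

lemma variance_indCount :
    variance (indCount F) (SimpleGraph.binomialRandom (Fin n) p) = countVar F p n := by
  rw [variance_eq_integral (measurable_of_finite _).aemeasurable, integral_indCount,
    integral_binomialRandom]
  simp only [indCount_eq_add F p, add_sub_cancel_left]
  rw [Ex_poly_sq, countVar]

lemma measureReal_binomialRandom (S : Set (SimpleGraph (Fin n))) :
    (SimpleGraph.binomialRandom (Fin n) p).real S =
      Ex (p : ℝ) fun x => if toGraph x ∈ S then 1 else 0 := by
  rw [← integral_indicator_one S.toFinite.measurableSet, integral_binomialRandom]
  rfl

lemma normalDist_indCount_le {b : ℝ} (h : ∀ z,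
    |Ex (p : ℝ) (fun x : Edge n → Bool => NormalStein.centredInd z
      (poly p (centredCoef F p n) x / √(countVar F p n)))| ≤ b) :
    normalDist (SimpleGraph.binomialRandom (Fin n) p) (indCount F) ≤ b := by
  refine ciSup_le fun z => ?_
  rw [measureReal_binomialRandom, integral_indCount, variance_indCount]
  refine le_trans (le_of_eq ?_) (h z)
  simp only [NormalStein.centredInd]
  rw [Ex_sub, Ex_const, NormalStein.ncdf]
  simp only [Set.mem_ofPred_eq, indCount_eq_add F p, add_sub_cancel_left]

end RandomGraph

end InducedCount

/-! ### The theorem, case by case. -/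

open InducedCount BiasedCube EdgeSystem in
-- Here `m` is the number of vertices of the pattern that bounds the variance from below, and `j`
-- encodes the rate n^(-j/2). The vertex deficits 2m + j and 2m + 2 are what the two Stein terms
-- require.
lemma InducedCount.exists_normalDist_le {k m : ℕ} (F : SimpleGraph (Fin k)) (p : unitInterval)
    (h0 : 0 < (p : ℝ)) (h1 : (p : ℝ) < 1) {P : Finset (Edge m)}
    (hP : supp Edge.verts P = Finset.univ) (hP0 : P ≠ ∅) (hS : placementSum F p P ≠ 0)
    (hm : m ≤ 3) (t : ℕ → ℝ) (j : ℕ) (ht : ∀ n, 0 ≤ t n)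
    (htj : ∀ n, 0 < n → t n ^ 2 = ((n : ℝ)⁻¹) ^ j) (htn : ∀ n : ℕ, 0 < n → (n : ℝ)⁻¹ ≤ t n)
    (hy : ∀ n, ∀ (τ : Fin 4 → Finset (Edge n)) (e e' f : Edge n), Linked τ e e' f →
      (∀ i, τ i ≠ ∅ ∧ countCoef F p n (τ i) ≠ 0) →
      (usupp Edge.verts τ).card + (2 * m + j) ≤ ∑ i, (supp Edge.verts (τ i)).card)
    (hy' : ∀ n, ∀ (τ : Fin 4 → Finset (Edge n)) (e : Edge n), DoublyCovered τ → (∀ i, e ∈ τ i) →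
      (∀ i, τ i ≠ ∅ ∧ countCoef F p n (τ i) ≠ 0) →
      (usupp Edge.verts τ).card + (2 * m + 2) ≤ ∑ i, (supp Edge.verts (τ i)).card) :
    ∃ C : ℝ, 0 < C ∧ ∀ n : ℕ, k ≤ n →
        0 < variance (indCount F) (SimpleGraph.binomialRandom (Fin n) p) ∧
        normalDist (SimpleGraph.binomialRandom (Fin n) p) (indCount F) ≤ C * t n := by
  obtain ⟨C, hC, h⟩ := exists_abs_Ex_centredInd_le F h0 h1 hP hP0 hS hm t j ht htj hy hy'
  refine ⟨2 * C, by positivity, fun n hn => ?_⟩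
  obtain ⟨hn0, hV, hz⟩ := h n hn
  refine ⟨by rwa [variance_indCount], normalDist_indCount_le F p fun z => (hz z).trans ?_⟩
  have := mul_le_mul_of_nonneg_left (htn n hn0) hC.le
  linarith

open InducedCount in
theorem theorem3p3 {k : ℕ} (F : SimpleGraph (Fin k)) (p : unitInterval) (hp0 : 0 < p)
    (hp1 : p < 1) :
    (CondG1 F p ∨ CondG3 F p →
      ∃ C : ℝ, 0 < C ∧ ∀ n : ℕ, k ≤ n →
        0 < variance (indCount F) (SimpleGraph.binomialRandom (Fin n) p) ∧
        normalDist (SimpleGraph.binomialRandom (Fin n) p) (indCount F) ≤ C * (n : ℝ)⁻¹) ∧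
    (CondG2 F p →
      ∃ C : ℝ, 0 < C ∧ ∀ n : ℕ, k ≤ n →
        0 < variance (indCount F) (SimpleGraph.binomialRandom (Fin n) p) ∧
        normalDist (SimpleGraph.binomialRandom (Fin n) p) (indCount F)
          ≤ C * (n : ℝ) ^ (-(1 / 2) : ℝ)) := by
  have h0 : 0 < (p : ℝ) := hp0
  have h1 : (p : ℝ) < 1 := hp1
  have hinv : ∀ n : ℕ, 0 ≤ (n : ℝ)⁻¹ := fun n => by positivity
  refine ⟨?_, ?_⟩
  · rintro (he | ⟨he, hs, ht⟩)
    -- m = 2, j = 2: both deficits are 6 and need no vanishing coefficients.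
    · refine exists_normalDist_le F p h0 h1 supp_edgePattern (by simp [edgePattern])
        (mt (placementSum_edgePattern_eq_zero_iff F h0 h1).1 he) (by norm_num)
        (fun n => (n : ℝ)⁻¹) 2 hinv (fun _ _ => rfl) (fun _ _ => le_rfl) ?_ ?_
      · exact fun n τ e e' f hl _ => hl.card_add_six_le Edge.card_verts Edge.verts_injective
      · exact fun n τ e hc hτ _ => (EdgeSystem.card_usupp_add_six_le Edge.card_verts hc hτ).1
    · have hE := (placementSum_edgePattern_eq_zero_iff F h0 h1).2 he
      have hSt := (placementSum_starPattern_eq_zero_iff F h0 h1 he).2 hs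
      -- m = 3, j = 2: deficit 8, which uses the absence of both single edges and 2-stars.
      refine exists_normalDist_le F p h0 h1 supp_trianglePattern (by simp [trianglePattern])
        (mt (placementSum_trianglePattern_eq_zero_iff F h0 h1 he hs).1 ht) le_rfl
        (fun n => (n : ℝ)⁻¹) 2 hinv (fun _ _ => rfl) (fun _ _ => le_rfl) ?_ ?_
      · exact fun n τ e e' f hl hτ => hl.card_add_eight_le Edge.card_verts Edge.verts_injective
          (fun i => three_le_card_supp_of_countCoef_ne_zero F hE (hτ i).1 (hτ i).2)
          (fun i => isComplete_of_countCoef_ne_zero F hSt (hτ i).2)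
      · exact fun n τ e hc he hτ => (EdgeSystem.card_usupp_add_six_le Edge.card_verts hc he).2
          fun i => three_le_card_supp_of_countCoef_ne_zero F hE (hτ i).1 (hτ i).2
  · rintro ⟨he, hs⟩
    have hE := (placementSum_edgePattern_eq_zero_iff F h0 h1).2 he
    -- m = 3, j = 1: 2-stars are present, so only deficit 7 is claimed for the linked quadruples.
    refine exists_normalDist_le F p h0 h1 supp_starPattern (by simp [starPattern])
      (mt (placementSum_starPattern_eq_zero_iff F h0 h1 he).1 hs) le_rfl
      (fun n => (n : ℝ) ^ (-(1 / 2) : ℝ)) 1 (fun n => by positivity) ?_ ?_ ?_ ?_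
    · intro n hn
      rw [← Real.rpow_natCast, ← Real.rpow_mul (Nat.cast_nonneg n), pow_one]
      norm_num
      rw [Real.rpow_neg_one]
    · intro n hn
      rw [← Real.rpow_neg_one]
      exact Real.rpow_le_rpow_of_exponent_le (Nat.one_le_cast.2 hn) (by norm_num)
    · exact fun n τ e e' f hl hτ => hl.card_add_seven_le Edge.card_verts
        fun i => three_le_card_supp_of_countCoef_ne_zero F hE (hτ i).1 (hτ i).2
    · exact fun n τ e hc he hτ => (EdgeSystem.card_usupp_add_six_le Edge.card_verts hc he).2
        fun i => three_le_card_supp_of_countCoef_ne_zero F hE (hτ i).1 (hτ i).2
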